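/- **Notation.** Let $\mathbb T^3=(\mathbb R/\mathbb Z)^3$, $e(k)=3-\sum_{j=1}^3\cos(2\pi k_j)$, and let $\widehat{\ }:\ell^2(\mathbb Z^3)\to L^2(\mathbb T^3)$ be the unitary extension of $\widehat\psi(k)=\sum_x\psi(x)e^{-2\pi i k\cdot x}$. For a Schwartz function $J\in\mathcal S(\mathbb R^3\times\mathbb T^3)$ let $\widehat J$ be its Fourier transform $\int J(x,v)e^{-2\pi i\xi\cdot x}\,dx$ in the first variable and $\widehat{J_\eta}(\xi,v)=\eta^{-3}\widehat J(\xi/\eta,v)$. Let $I$ be the boundary of the rectangle with vertices $-1,7,7-i,-1-i$, run through clockwise, and $\overline I$ its complex conjugate, run through counterclockwise. **Pairings.** Let $n_1,n_2\ge0$ and $\bar n=n_1+n_2$. There are two lines $j=1,2$. Line $j$ carries momenta $k^{(j)}_0,\dots,k^{(j)}_{\bar n+1}\in\mathbb T^3$, and it carries an interaction between $k^{(j)}_l$ and $k^{(j)}_{l+1}$ for every $l\in\{0,\dots,\bar n\}\setminus\{n_1\}$. A pairing $\pi$ is a partition of all $2\bar n$ interactions into pairs (contractions). A contraction is internal if both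 ends $l,l'$ are on the same line $j$; it then contributes the factor $\delta(k^{(j)}_{l+1}-k^{(j)}_l+k^{(j)}_{l'+1}-k^{(j)}_{l'})$. It is a transfer contraction if it joins $l$ on line 1 and $l'$ on line 2; it then contributes $\delta(k^{(1)}_{l+1}-k^{(1)}_l-k^{(2)}_{l'+1}+k^{(2)}_{l'})$. Let $\delta_\pi$ be the product of these $\bar n$ factors. * $\pi$ is connected if it has at least one transfer contraction. * $\pi$ has a generalized crossing on line $j$ if there are two internal contractions $\{l_1,l_2\},\{i_1,i_2\}$ on line $j$ with $l_1<i_1<l_2<i_2$, or an internal contraction $\{l_1,l_2\}$ on line $j$ and a transfer contraction whose end $i_1$ on line $j$ satisfies $l_1<i_1<l_2$. * The transfer contractions $(l_r,l_r')$, $r=1,\dots,m$, listed with $l_1<\dots<l_m$, are parallel if $l'_1<\dots<l'_m$ and anti-parallel if $l'_1>\dots>l'_m$ (for $m=1$ they are both). **Amplitude.** For $\lambda>0$, $\eta=\lambda^2$, $t\ge0$, $\varepsilon>0$, $\varepsilon_1=-\varepsilon$, $\varepsilon_2=\varepsilon$ and $\phi_0\in\ell^2(\mathbb Z^3)$ put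 $$K^{(j)}=\prod_{l=0}^{n_1}\frac1{e(k^{(j)}_l)-\alpha_j+i\varepsilon_j}\prod_{l=n_1+1}^{\bar n+1}\frac1{e(k^{(j)}_l)-\beta_j-i\varepsilon_j}$$ and $$\begin{aligned}\mathrm{Amp}(\pi)=\frac{e^{4\varepsilon t}\lambda^{2\bar n}}{(2\pi)^4}&\int_I d\alpha_1\int_{\overline I}d\beta_1\int_{\overline I}d\alpha_2\int_I d\beta_2\,e^{-it(\alpha_1-\beta_1-\alpha_2+\beta_2)}\int_{(\mathbb T^3)^{2\bar n+4}}dk^{(1)}dk^{(2)}\,\delta_\pi(k^{(1)},k^{(2)})\\&\int_{\mathbb R^3}d\xi^{(1)}\int_{\mathbb R^3}d\xi^{(2)}\,\delta(k^{(1)}_{n_1+1}-k^{(1)}_{n_1}-\xi^{(1)})\,\delta(k^{(2)}_{n_1+1}-k^{(2)}_{n_1}-\xi^{(2)})\\&\widehat{J_\eta}\big(\xi^{(1)},k^{(1)}_{n_1}+\tfrac12\xi^{(1)}\big)\,\overline{\widehat{J_\eta}\big(\xi^{(2)},k^{(2)}_{n_1}+\tfrac12\xi^{(2)}\big)}\,K^{(1)}K^{(2)}\,\widehat{\phi_0}(k^{(1)}_0)\overline{\widehat{\phi_0}(k^{(1)}_{\bar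 n+1})}\,\overline{\widehat{\phi_0}(k^{(2)}_0)}\,\widehat{\phi_0}(k^{(2)}_{\bar n+1}),\end{aligned}$$ where all $\delta$'s are delta distributions on $\mathbb T^3$. **Lemma.** For every $J\in\mathcal S(\mathbb R^3\times\mathbb T^3)$ there is a constant $0<c<\infty$, depending only on $J$, such that for all $n_1,n_2\ge0$, every connected pairing $\pi$ that has no generalized crossing on either line and whose transfer contractions are parallel or anti-parallel, all $\phi_0\in\ell^2(\mathbb Z^3)$, all $\lambda>0$, all $t\ge0$ and all $0<\varepsilon\le\frac13$, $$|\mathrm{Amp}(\pi)|\le e^{4\varepsilon t}\,\lambda^{2\bar n}\,\varepsilon^{\frac15-\bar n}\,|c\log\varepsilon|^{\bar n+5}\,\|\phi_0\|_{\ell^2(\mathbb Z^3)}^4 .$$ -/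

import Mathlib

open MeasureTheory Complex
open scoped ENNReal ContDiff FourierTransform ComplexConjugate

namespace KineticGraphs

noncomputable section

/-! ### Momentum space, dispersion relation, Fourier transforms -/

/-- Position (or conjugate) space `ℝ³` with its Euclidean norm. -/
abbrev R3 : Type := EuclideanSpace ℝ (Fin 3)

/-- The unit torus `𝕋³ = (ℝ/ℤ)³`. -/
abbrev Torus3 : Type := UnitAddTorus (Fin 3)

/-- Lebesgue measure on `𝕋³` (total mass one). -/
abbrev torusMeasure : Measure Torus3 :=
  Measure.pi fun _ : Fin 3 => (AddCircle.haarAddCircle : Measure UnitAddCircle)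

/-- The space `ℓ²(ℤ³)`. -/
abbrev LatticeL2 : Type := lp (fun _ : Fin 3 → ℤ => ℂ) 2

/-- Reduction modulo `ℤ³`. -/
def toTorus (x : R3) : Torus3 := fun i => ((x i : ℝ) : UnitAddCircle)

/-- The kinetic energy `e(k) = 3 - ∑ⱼ cos (2π kⱼ)`; `AddCircle.toCircle k = exp (2π i k)`. -/
def kineticEnergy (k : Torus3) : ℝ :=
  3 - ∑ i : Fin 3, ((AddCircle.toCircle (k i) : Circle) : ℂ).re

theorem kineticEnergy_toTorus (x : R3) :
    kineticEnergy (toTorus x) = 3 - ∑ i : Fin 3, Real.cos (2 * Real.pi * x i) := by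
  have h : ∀ y : ℝ, (Complex.exp (2 * Real.pi * y * I)).re = Real.cos (2 * Real.pi * y) :=
    fun y => by
      have := Complex.exp_ofReal_mul_I_re (2 * Real.pi * y)
      push_cast at this
      exact this
  simp [kineticEnergy, toTorus, AddCircle.toCircle_apply_mk, Circle.coe_exp, h]

/-- The orthonormal basis `k ↦ exp (-2π i k · x)`, `x ∈ ℤ³`, of `L²(𝕋³)`. -/
def planeWaveBasis : HilbertBasis (Fin 3 → ℤ) ℂ (Lp ℂ 2 torusMeasure) :=
  HilbertBasis.mk (v := fun x : Fin 3 → ℤ => UnitAddTorus.mFourierLp 2 (-x))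
    (UnitAddTorus.orthonormal_mFourier.comp _ neg_injective)
    (by
      have h := UnitAddTorus.span_mFourierLp_closure_eq_top (d := Fin 3) (p := 2) (by simp)
      have hr := (Equiv.neg (Fin 3 → ℤ)).surjective.range_comp
        (UnitAddTorus.mFourierLp (d := Fin 3) 2)
      rw [← hr] at h
      exact h.ge)

/-- The Fourier transform `ℓ²(ℤ³) → L²(𝕋³)`, the unitary extension of
`ψ ↦ ∑ₓ ψ(x) exp (-2π i k · x)`. -/
def latticeFourier : LatticeL2 ≃ₗᵢ[ℂ] Lp ℂ 2 torusMeasure := planeWaveBasis.repr.symm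

/-- `J` is a Schwartz function on `ℝ³ × 𝕋³`: its lift to `ℝ³ × ℝ³` (periodic in the second
variable) is smooth, and all its derivatives decay faster than any power of `‖x‖`. -/
def IsSchwartz (J : R3 → Torus3 → ℂ) : Prop :=
  ContDiff ℝ ∞ (fun z : R3 × R3 => J z.1 (toTorus z.2)) ∧
  ∀ m n : ℕ, ∃ C : ℝ, ∀ x v : R3,
    ‖x‖ ^ m * ‖iteratedFDeriv ℝ n (fun z : R3 × R3 => J z.1 (toTorus z.2)) (x, v)‖ ≤ C

/-- `Ĵ_η(ξ, v) = η⁻³ Ĵ(ξ/η, v)`, where `Ĵ` is the Fourier transform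
`∫ J(x, v) exp (-2π i ξ · x) dx` in the first variable. -/
def JHat (J : R3 → Torus3 → ℂ) (η : ℝ) (ξ : R3) (v : Torus3) : ℂ :=
  ((η ^ 3)⁻¹ : ℝ) * 𝓕 (fun x : R3 => J x v) (η⁻¹ • ξ)

/-! ### Contours -/

/-- Line integral over the segment from `z` to `w`. -/
def segmentIntegral (z w : ℂ) (f : ℂ → ℂ) : ℂ :=
  ∫ s in (0 : ℝ)..1, (w - z) * f (z + s * (w - z))

/-- Integral over the contour `I`: the edges of the rectangle with vertices
`-1, 7, 7 - i, -1 - i`, run through clockwise. -/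
def contourI (f : ℂ → ℂ) : ℂ :=
  segmentIntegral (-1) 7 f + segmentIntegral 7 (7 - I) f
    + segmentIntegral (7 - I) (-1 - I) f + segmentIntegral (-1 - I) (-1) f

/-- Integral over the complex conjugate contour of `I`, run through counterclockwise. -/
def contourIbar (f : ℂ → ℂ) : ℂ :=
  segmentIntegral (-1) 7 f + segmentIntegral 7 (7 + I) f
    + segmentIntegral (7 + I) (-1 + I) f + segmentIntegral (-1 + I) (-1) f

/-! ### Pairings -/

/-- The interactions ("bullets"). `(0, i)` and `(1, i)` are the `i`-th interaction from the left on
the first and on the second one-particle line; each line carries `n₁ + n₂` of them. -/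
abbrev Bullet (n₁ n₂ : ℕ) : Type := Fin 2 × Fin (n₁ + n₂)

/-- The number `l` such that the `i`-th interaction of a line sits between its momenta `k_l` and
`k_{l+1}`: the first `n₁` interactions have `l = 0, …, n₁ - 1`, the others
`l = n₁ + 1, …, n₁ + n₂` (no interaction sits between `k_{n₁}` and `k_{n₁+1}`). -/
def pos (n₁ : ℕ) {n : ℕ} (i : Fin n) : ℕ := if (i : ℕ) < n₁ then i else i + 1

/-- A pairing (perfect matching) of all the interactions. -/
structure Pairing (n₁ n₂ : ℕ) where
  /-- The other interaction of the same contraction. -/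
  partner : Bullet n₁ n₂ → Bullet n₁ n₂
  partner_partner : ∀ b, partner (partner b) = b
  partner_ne : ∀ b, partner b ≠ b

namespace Pairing

variable {n₁ n₂ : ℕ}

/-- Some contraction joins the two one-particle lines (a transfer contraction). -/
def IsConnected (P : Pairing n₁ n₂) : Prop :=
  ∃ a b, P.partner (0, a) = (1, b)

/-- A generalized crossing on the line `j`: two crossing internal contractions, or the end of a
transfer contraction between the two ends of an internal contraction. -/
def HasGeneralizedCrossing (P : Pairing n₁ n₂) (j : Fin 2) : Prop :=
  (∃ a b c d : Fin (n₁ + n₂), a < b ∧ b < c ∧ c < d ∧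
    P.partner (j, a) = (j, c) ∧ P.partner (j, b) = (j, d)) ∨
  (∃ a b c : Fin (n₁ + n₂), a < b ∧ b < c ∧
    P.partner (j, a) = (j, c) ∧ (P.partner (j, b)).1 ≠ j)

/-- The ends of the transfer contractions come in the same order on both lines. -/
def HasParallelTransfers (P : Pairing n₁ n₂) : Prop :=
  ∀ a b a' b', P.partner (0, a) = (1, a') → P.partner (0, b) = (1, b') → a < b → a' < b'

/-- The ends of the transfer contractions come in opposite orders on the two lines. -/
def HasAntiparallelTransfers (P : Pairing n₁ n₂) : Prop :=
  ∀ a b a' b', P.partner (0, a) = (1, a') → P.partner (0, b) = (1, b') → a < b → b' < a'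

/-! ### The momenta allowed by the delta distributions

The product of all the delta distributions restricts the momenta `k^{(j)}_l`,
`j = 0, 1`, `0 ≤ l ≤ n₁ + n₂ + 1`, to the solutions of

* `(k^{(j)}_{l+1} - k^{(j)}_l) + (k^{(j)}_{l'+1} - k^{(j)}_{l'}) = 0` for an internal contraction,
* `(k^{(0)}_{l+1} - k^{(0)}_l) - (k^{(1)}_{l'+1} - k^{(1)}_{l'}) = 0` for a transfer contraction,
* `k^{(j)}_{n₁+1} - k^{(j)}_{n₁} - ξ^{(j)} = 0`.

In the coordinates `k^{(j)}_0` and `k^{(j)}_{l+1} - k^{(j)}_l` (a change of variables on the torus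
with integer coefficients and determinant one) each of them fixes one coordinate, so that
integrating against the deltas is integrating over `k^{(0)}_0`, `k^{(1)}_0` and, for every
contraction, the jump `q` of the momentum at one of its two ends. -/

/-- Of the two ends of a contraction, the one that comes first (the first line counts before the
second one). It carries the integration variable of the contraction. -/
def IsOpening (P : Pairing n₁ n₂) (b : Bullet n₁ n₂) : Prop :=
  b.1 < (P.partner b).1 ∨ (b.1 = (P.partner b).1 ∧ b.2 < (P.partner b).2)

instance (P : Pairing n₁ n₂) : DecidablePred P.IsOpening := fun b => by
  unfold IsOpening
  infer_instance

/-- The contractions, each represented by its first end. -/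
abbrev Opening (P : Pairing n₁ n₂) : Type := {b : Bullet n₁ n₂ // P.IsOpening b}

theorem isOpening_partner (P : Pairing n₁ n₂) {b : Bullet n₁ n₂} (h : ¬ P.IsOpening b) :
    P.IsOpening (P.partner b) := by
  have hne := P.partner_ne b
  unfold IsOpening at *
  rw [P.partner_partner]
  push Not at h
  obtain ⟨h1, h2⟩ := h
  rcases h1.lt_or_eq with h3 | h3
  · exact Or.inl h3
  · refine Or.inr ⟨h3, lt_of_le_of_ne (h2 h3.symm) fun h4 => hne (Prod.ext h3 h4)⟩

/-- The jump of the momentum at an interaction. -/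
def jump (P : Pairing n₁ n₂) (q : P.Opening → Torus3) (b : Bullet n₁ n₂) : Torus3 :=
  if h : P.IsOpening b then q ⟨b, h⟩
  else if b.1 = (P.partner b).1 then -q ⟨P.partner b, P.isOpening_partner h⟩
  else q ⟨P.partner b, P.isOpening_partner h⟩

/-- The momentum `k^{(j)}_l`: the initial momentum `p j = k^{(j)}_0`, plus all the jumps to the left
of `k^{(j)}_l`, plus the jump `ξ^{(j)}` between `k^{(j)}_{n₁}` and `k^{(j)}_{n₁+1}`. -/
def momentum (P : Pairing n₁ n₂) (p : Fin 2 → Torus3) (q : P.Opening → Torus3) (ξ : Fin 2 → R3)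
    (j : Fin 2) (l : ℕ) : Torus3 :=
  p j + ∑ i : Fin (n₁ + n₂), (if pos n₁ i < l then P.jump q (j, i) else 0)
    + (if n₁ < l then toTorus (ξ j) else 0)

/-- The system of equations given by all the delta distributions. -/
def DeltaSupport (P : Pairing n₁ n₂) (ξ : Fin 2 → R3) (k : Fin 2 → ℕ → Torus3) : Prop :=
  (∀ j a c, P.partner (j, a) = (j, c) →
    (k j (pos n₁ a + 1) - k j (pos n₁ a)) + (k j (pos n₁ c + 1) - k j (pos n₁ c)) = 0) ∧
  (∀ a b, P.partner (0, a) = (1, b) →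
    (k 0 (pos n₁ a + 1) - k 0 (pos n₁ a)) - (k 1 (pos n₁ b + 1) - k 1 (pos n₁ b)) = 0) ∧
  (∀ j, k j (n₁ + 1) - k j n₁ - toTorus (ξ j) = 0)

theorem pos_ne (i : Fin (n₁ + n₂)) : pos n₁ i ≠ n₁ := by
  unfold pos; split_ifs <;> omega

theorem pos_inj {i i' : Fin (n₁ + n₂)} (h : pos n₁ i = pos n₁ i') : i = i' := by
  unfold pos at h; ext; split_ifs at h <;> omega

theorem exists_pos {l : ℕ} (hl : l < n₁ + n₂ + 1) (h : l ≠ n₁) :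
    ∃ i : Fin (n₁ + n₂), pos n₁ i = l := by
  rcases lt_or_gt_of_ne h with h' | h'
  · exact ⟨⟨l, by omega⟩, by simp [pos, h']⟩
  · refine ⟨⟨l - 1, by omega⟩, ?_⟩
    simp only [pos]
    split_ifs <;> omega

theorem momentum_zero (P : Pairing n₁ n₂) (p q ξ j) : P.momentum p q ξ j 0 = p j := by
  simp [momentum]

theorem momentum_pos (P : Pairing n₁ n₂) (p q ξ j) (i : Fin (n₁ + n₂)) :
    P.momentum p q ξ j (pos n₁ i + 1) - P.momentum p q ξ j (pos n₁ i) = P.jump q (j, i) := by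
  have h1 : (n₁ < pos n₁ i + 1) ↔ n₁ < pos n₁ i := by have := pos_ne (n₁ := n₁) i; omega
  have h2 : ∀ a : Fin (n₁ + n₂), (if pos n₁ a < pos n₁ i + 1 then P.jump q (j, a) else 0)
      = (if pos n₁ a < pos n₁ i then P.jump q (j, a) else 0)
        + if a = i then P.jump q (j, a) else 0 := by
    intro a
    by_cases ha : a = i
    · subst ha; simp
    · have : pos n₁ a ≠ pos n₁ i := fun h => ha (pos_inj h)
      have h3 : (pos n₁ a < pos n₁ i + 1) ↔ pos n₁ a < pos n₁ i := by omega
      simp [h3, ha]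
  simp only [momentum, h1, h2, Finset.sum_add_distrib, Finset.sum_ite_eq', Finset.mem_univ, if_true]
  abel

theorem momentum_gap (P : Pairing n₁ n₂) (p q ξ j) :
    P.momentum p q ξ j (n₁ + 1) - P.momentum p q ξ j n₁ = toTorus (ξ j) := by
  have h2 : ∀ a : Fin (n₁ + n₂), (pos n₁ a < n₁ + 1) ↔ pos n₁ a < n₁ := by
    intro a; have := pos_ne (n₁ := n₁) a; omega
  simp only [momentum, h2]
  simp

theorem not_isOpening_partner (P : Pairing n₁ n₂) {b : Bullet n₁ n₂} (h : P.IsOpening b) :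
    ¬ P.IsOpening (P.partner b) := by
  unfold IsOpening at *
  rw [P.partner_partner]
  omega

theorem jump_partner (P : Pairing n₁ n₂) (q) (b : Bullet n₁ n₂) :
    P.jump q (P.partner b) = if b.1 = (P.partner b).1 then -P.jump q b else P.jump q b := by
  have key : ∀ b, P.IsOpening b → P.jump q (P.partner b)
      = if b.1 = (P.partner b).1 then -P.jump q b else P.jump q b := by
    intro b h
    have h' := P.not_isOpening_partner h
    simp only [jump, h, h', dif_pos, dif_neg, not_false_eq_true, P.partner_partner, eq_comm]
  by_cases h : P.IsOpening b
  · exact key b h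
  · have := key _ (P.isOpening_partner h)
    rw [P.partner_partner] at this
    rw [this]
    by_cases h1 : b.1 = (P.partner b).1
    · simp [← h1]
    · simp [h1, Ne.symm h1]

/-- The deltas hold exactly for the momenta parametrized by `momentum`, and the parameters are
determined by the momenta. -/
theorem deltaSupport_iff (P : Pairing n₁ n₂) (ξ : Fin 2 → R3) (k : Fin 2 → ℕ → Torus3) :
    P.DeltaSupport ξ k ↔ ∃! pq : (Fin 2 → Torus3) × (P.Opening → Torus3),
      ∀ j l, l ≤ n₁ + n₂ + 1 → k j l = P.momentum pq.1 pq.2 ξ j l := by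
  have hlt : ∀ i : Fin (n₁ + n₂), pos n₁ i + 1 ≤ n₁ + n₂ + 1 := by
    intro i; unfold pos; split_ifs <;> omega
  constructor
  · rintro ⟨h1, h2, h3⟩
    set d : Bullet n₁ n₂ → Torus3 := fun b => k b.1 (pos n₁ b.2 + 1) - k b.1 (pos n₁ b.2) with hd
    have hjump : ∀ b, P.jump (fun o => d o.1) b = d b := by
      rintro ⟨j, a⟩
      unfold jump
      split_ifs with ho hs
      · rfl
      · obtain ⟨c, hc⟩ : ∃ c, P.partner (j, a) = (j, c) :=
          ⟨(P.partner (j, a)).2, Prod.ext hs.symm rfl⟩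
        have := h1 j a c hc
        simp only [hd, hc]
        exact neg_eq_of_add_eq_zero_left this
      · have hne : (P.partner (j, a)).1 ≠ j := fun h => hs h.symm
        have hpp := P.partner_partner (j, a)
        change d (P.partner (j, a)) = d (j, a)
        clear hs ho
        generalize hb : P.partner (j, a) = b at hne hpp ⊢
        obtain ⟨j', c⟩ := b
        simp only at hne
        fin_cases j <;> fin_cases j' <;> simp at hne
        · exact (sub_eq_zero.1 (h2 a c hb)).symm
        · exact sub_eq_zero.1 (h2 c a hpp)
    refine ⟨⟨fun j => k j 0, fun o => d o.1⟩, ?_, ?_⟩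
    · intro j l
      induction l with
      | zero => intro _; simp [momentum_zero]
      | succ l ih =>
        intro hl
        have ih := ih (by omega)
        by_cases hln : l = n₁
        · subst hln
          have e1 := P.momentum_gap (fun j => k j 0) (fun o => d o.1) ξ j
          rw [← sub_eq_zero.1 (h3 j), ← ih] at e1
          exact (sub_left_inj.1 e1).symm
        · obtain ⟨i, rfl⟩ := exists_pos (n₁ := n₁) (n₂ := n₂) (by omega) hln
          have e1 := P.momentum_pos (fun j => k j 0) (fun o => d o.1) ξ j i
          rw [hjump, ← ih] at e1
          exact (sub_left_inj.1 e1).symm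
    · rintro ⟨p, q⟩ h
      refine Prod.ext (funext fun j => ?_) (funext fun o => ?_)
      · simpa [momentum_zero] using (h j 0 (by omega)).symm
      · have e1 := P.momentum_pos p q ξ o.1.1 o.1.2
        rw [← h _ _ (hlt _), ← h _ _ (by have := hlt o.1.2; omega)] at e1
        have : P.jump q (o.1.1, o.1.2) = q o := by simp [jump, o.2]
        exact this.symm.trans e1.symm
  · rintro ⟨⟨p, q⟩, h, -⟩
    have hs : ∀ j i, k j (pos n₁ i + 1) - k j (pos n₁ i) = P.jump q (j, i) := by
      intro j i
      rw [h _ _ (hlt i), h _ _ (by have := hlt i; omega)]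
      exact P.momentum_pos p q ξ j i
    refine ⟨fun j a c hac => ?_, fun a b hab => ?_, fun j => ?_⟩
    · have := P.jump_partner q (j, a)
      rw [hs, hs, ← hac, this]
      simp [hac]
    · have := P.jump_partner q (0, a)
      rw [hs, hs, ← hab, this]
      simp [hab]
    · rw [h _ _ (by omega), h _ _ (by omega), P.momentum_gap, sub_self]

end Pairing

/-! ### The amplitude -/

/-- `K(k, α, β, ε) = ∏_{l ≤ n₁} (e(k_l) - α + iε)⁻¹ ∏_{n₁ < l ≤ n₁+n₂+1} (e(k_l) - β - iε)⁻¹`, with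
the sign of `ε` still to be chosen. -/
def resolvents (n₁ n₂ : ℕ) (k : ℕ → Torus3) (α β : ℂ) (ε : ℝ) : ℂ :=
  (∏ l ∈ Finset.range (n₁ + 1), ((kineticEnergy (k l) : ℂ) - α + I * ε)⁻¹) *
  ∏ l ∈ Finset.Ico (n₁ + 1) (n₁ + n₂ + 2), ((kineticEnergy (k l) : ℂ) - β - I * ε)⁻¹

/-- The part of the amplitude's integrand that depends on the momenta. Line `0` has `ε₁ = -ε`, line
`1` has `ε₂ = ε`; the velocity argument `(k_{n₁} + k_{n₁+1}) / 2` of `Ĵ_η` is `k_{n₁} + ξ / 2`. -/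
def integrand (n₁ n₂ : ℕ) (J : R3 → Torus3 → ℂ) (φ₀ : LatticeL2) (η ε : ℝ) (α₁ β₁ α₂ β₂ : ℂ)
    (ξ₁ ξ₂ : R3) (k : Fin 2 → ℕ → Torus3) : ℂ :=
  JHat J η ξ₁ (k 0 n₁ + toTorus ((1 / 2 : ℝ) • ξ₁)) *
  conj (JHat J η ξ₂ (k 1 n₁ + toTorus ((1 / 2 : ℝ) • ξ₂))) *
  resolvents n₁ n₂ (k 0) α₁ β₁ (-ε) * resolvents n₁ n₂ (k 1) α₂ β₂ ε *
  latticeFourier φ₀ (k 0 0) * conj (latticeFourier φ₀ (k 0 (n₁ + n₂ + 1))) *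
  conj (latticeFourier φ₀ (k 1 0)) * latticeFourier φ₀ (k 1 (n₁ + n₂ + 1))

/-- The amplitude `Amp(π)` of a pairing at coupling `lam`, time `t`, regularization `ε`, with
`η = lam²`. -/
def amplitude {n₁ n₂ : ℕ} (P : Pairing n₁ n₂) (J : R3 → Torus3 → ℂ) (φ₀ : LatticeL2)
    (lam t ε : ℝ) : ℂ :=
  ((Real.exp (4 * ε * t) * lam ^ (2 * (n₁ + n₂)) / (2 * Real.pi) ^ 4 : ℝ) : ℂ) *
  contourI fun α₁ => contourIbar fun β₁ => contourIbar fun α₂ => contourI fun β₂ =>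
    Complex.exp (-I * t * (α₁ - β₁ - α₂ + β₂)) *
    ∫ p : Fin 2 → Torus3, (∫ q : P.Opening → Torus3, (∫ ξ₁ : R3, (∫ ξ₂ : R3,
      integrand n₁ n₂ J φ₀ (lam ^ 2) ε α₁ β₁ α₂ β₂ ξ₁ ξ₂ (P.momentum p q ![ξ₁, ξ₂])))
      ∂(Measure.pi fun _ => torusMeasure)) ∂(Measure.pi fun _ => torusMeasure)

end

end KineticGraphs

/-! Write n for n₁ + n₂. After absolute values are taken there are 2n + 4 resolvents, each at most
of order 1/ε. Besides the two initial momenta there are n + 4 variables: four energies on the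
contours and one momentum per contraction. Ordered along the lines, each variable makes its first
appearance in a resolvent of its own, whose average over that variable is O(|log ε|). The n
resolvents left over cost ε⁻ⁿ. The additional ε^(1/5) has to come from the transfer contractions.

No transfer end lies inside an internal contraction, so to the left of the first transfer end of a
line the internal jumps cancel. The momentum just after this end is therefore the starting momentum
plus the transfer variable, up to a sign and the jump ξ. If the transfers are parallel, the first
transfer ends of the two lines belong to the same contraction, so two resolvents share its variable,
with energies e(k) and e(k + w), where w depends only on the starting momenta and ξ. Anti-parallel
transfers become parallel when one line is read backwards. The average of the product of the two
resolvents is O(ε^(-4/5)) up to logarithms (`lintegral_cutoffInv_mul_cutoffInv_le`), unless all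
coordinates of w are within δ = ε^(2/5) of 0, or all are within δ of 1/2; at these two points e(k +
w) is e(k) or 6 - e(k). This gives `Diagram.lintegral_prod_res_le_of_isFar`.

For w near these points nothing is gained from the starting momenta, because the initial data are
merely square integrable. However, the four factors of the initial data can be grouped in two ways
before applying ab ≤ a² + b². The other grouping amounts to reversing one line, and relative to the
new starting momenta w is a constant plus or minus the total momentum transfer. Being near then
confines the total transfer to a set of measure O(δ³). The variable of the last transfer contraction
translates the total transfer, so it yields δ³ instead of integrating a resolvent: δ³ ε^(-n-1) =
ε^(1/5-n) (`Diagram.lintegral_prod_res_mul_indicator_le`). The two cases are combined in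
`mul_le_far_add_near` and `Pairing.lintegral_boundary_mul_resProd_le`. -/

namespace KineticGraphs

/-! ### Decay of the Bessel function J₀ -/

/-- First derivative test for the phase `r cos (2π x)` away from its critical point `0`. -/
theorem norm_integral_exp_cos_le_of_pos {r d : ℝ} (hr : r ≠ 0) (hd : 0 < d) (hd4 : d ≤ 1 / 4) :
    ‖∫ x in d..(1 / 4 : ℝ), Complex.exp (I * (r * Real.cos (2 * Real.pi * x) : ℝ))‖
      ≤ 1 / (4 * |r| * d) := by
  have hpi := Real.pi_pos
  have hr' : 0 < |r| := abs_pos.2 hr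
  have hs : ∀ x ∈ Set.uIcc d (1 / 4 : ℝ), 0 < Real.sin (2 * Real.pi * x) := by
    intro x hx
    rw [Set.uIcc_of_le hd4] at hx
    apply Real.sin_pos_of_pos_of_lt_pi
    · have : 0 < x := hd.trans_le hx.1
      positivity
    · nlinarith [hx.2]
  set S : ℝ → ℝ := fun x => Real.sin (2 * Real.pi * x) with hS
  set Co : ℝ → ℝ := fun x => Real.cos (2 * Real.pi * x) with hCo
  have hSd : ∀ x, HasDerivAt S (2 * Real.pi * Co x) x := by
    intro x
    have := ((hasDerivAt_id x).const_mul (2 * Real.pi)).sin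
    simpa [hS, hCo, mul_comm] using this
  have hCd : ∀ x, HasDerivAt Co (-(2 * Real.pi * S x)) x := by
    intro x
    have := ((hasDerivAt_id x).const_mul (2 * Real.pi)).cos
    simpa [hS, hCo, mul_comm] using this
  set u : ℝ → ℂ := fun x => Complex.exp (I * (r * Co x : ℝ)) with hu
  have hud : ∀ x, HasDerivAt u (u x * (I * (r * -(2 * Real.pi * S x) : ℝ))) x := by
    intro x
    exact ((((hCd x).const_mul r).ofReal_comp).const_mul I).cexp
  set V : ℝ → ℝ := fun x => (S x)⁻¹ with hV
  have hVd : ∀ x ∈ Set.uIcc d (1 / 4 : ℝ), HasDerivAt V (-(2 * Real.pi * Co x) / (S x) ^ 2) x := by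
    intro x hx
    exact (hSd x).inv (hs x hx).ne'
  set c : ℂ := I / (2 * Real.pi * r) with hc
  have hcn : ‖c‖ = 1 / (2 * Real.pi * |r|) := by
    simp [hc, abs_of_pos hpi]
  have hSc : Continuous S := by fun_prop
  have hCc : Continuous Co := by fun_prop
  have hV'c : ContinuousOn (fun x => -(2 * Real.pi * Co x) / (S x) ^ 2)
      (Set.uIcc d (1 / 4 : ℝ)) := by
    apply ContinuousOn.div (by fun_prop) (by fun_prop)
    intro x hx
    exact pow_ne_zero _ (hs x hx).ne'
  have hV'i : IntervalIntegrable (fun x => -(2 * Real.pi * Co x) / (S x) ^ 2) volume d (1 / 4) :=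
    hV'c.intervalIntegrable
  -- The derivative of `u` is -2πi r S u, so with c = i/(2πr) and V = 1/S the integrand `u` equals c
  -- V u'.
  have hparts := intervalIntegral.integral_mul_deriv_eq_deriv_mul (a := d) (b := 1 / 4)
    (u := fun x => c * (V x : ℂ)) (v := u)
    (u' := fun x => c * ((-(2 * Real.pi * Co x) / (S x) ^ 2 : ℝ) : ℂ))
    (v' := fun x => u x * (I * (r * -(2 * Real.pi * S x) : ℝ)))
    (fun x hx => ((hVd x hx).ofReal_comp).const_mul c) (fun x _ => hud x)
    ((Complex.continuous_ofReal.comp_continuousOn hV'c).intervalIntegrable.const_mul c) (by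
      apply Continuous.intervalIntegrable
      fun_prop)
  have hlhs : (∫ x in d..(1 / 4 : ℝ), u x)
      = ∫ x in d..(1 / 4 : ℝ), c * (V x : ℂ) * (u x * (I * (r * -(2 * Real.pi * S x) : ℝ))) := by
    apply intervalIntegral.integral_congr
    intro x hx
    have h1 : (S x : ℂ) ≠ 0 := by exact_mod_cast (hs x hx).ne'
    have h2 : (r : ℂ) ≠ 0 := by exact_mod_cast hr
    have h3 : (Real.pi : ℂ) ≠ 0 := by exact_mod_cast hpi.ne'
    simp only [hc, hV]
    push_cast
    field_simp
    rw [I_sq]; ring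
  have hun : ∀ x, ‖u x‖ = 1 := by
    intro x
    simp only [hu]
    rw [mul_comm, Complex.norm_exp_ofReal_mul_I]
  have hVpos : ∀ x ∈ Set.uIcc d (1 / 4 : ℝ), 0 < V x := fun x hx => inv_pos.2 (hs x hx)
  have hV14 : V (1 / 4) = 1 := by
    simp only [hV, hS]
    rw [show 2 * Real.pi * (1 / 4) = Real.pi / 2 by ring, Real.sin_pi_div_two, inv_one]
  have hsec : ‖∫ x in d..(1 / 4 : ℝ), c * ((-(2 * Real.pi * Co x) / (S x) ^ 2 : ℝ) : ℂ) * u x‖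
      ≤ ‖c‖ * (V d - 1) := by
    have hint : ∫ x in d..(1 / 4 : ℝ), ‖c‖ * -(-(2 * Real.pi * Co x) / (S x) ^ 2)
        = ‖c‖ * (V d - 1) := by
      rw [intervalIntegral.integral_const_mul, intervalIntegral.integral_neg,
        intervalIntegral.integral_eq_sub_of_hasDerivAt hVd hV'i, hV14]
      ring
    rw [← hint]
    apply intervalIntegral.norm_integral_le_of_norm_le hd4
    · refine Filter.Eventually.of_forall fun x hx => ?_
      have hx' : x ∈ Set.Icc d (1 / 4 : ℝ) := ⟨hx.1.le, hx.2⟩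
      have hco : 0 ≤ Co x := by
        apply Real.cos_nonneg_of_mem_Icc
        constructor
        · have := hd.trans hx.1
          have : 0 < 2 * Real.pi * x := by positivity
          linarith
        · nlinarith [hx.2]
      rw [norm_mul, norm_mul, hun, mul_one, Complex.norm_real, Real.norm_eq_abs, neg_div,
        abs_neg, neg_neg, abs_of_nonneg (by positivity)]
    · exact hV'i.neg.const_mul _
  have hVd' : V d ≤ 1 / (4 * d) := by
    have h1 : 4 * d ≤ S d := by
      have := Real.mul_le_sin (x := 2 * Real.pi * d) (by positivity) (by nlinarith)
      calc 4 * d = 2 / Real.pi * (2 * Real.pi * d) := by field_simp; ring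
        _ ≤ _ := this
    rw [one_div]
    exact inv_anti₀ (by positivity) h1
  change ‖∫ x in d..(1 / 4 : ℝ), u x‖ ≤ _
  rw [hlhs, hparts]
  have hb : ∀ x ∈ Set.uIcc d (1 / 4 : ℝ), ‖c * (V x : ℂ) * u x‖ = ‖c‖ * V x := by
    intro x hx
    rw [norm_mul, norm_mul, hun, mul_one, Complex.norm_real, Real.norm_of_nonneg (hVpos x hx).le]
  -- V decreases from V d to V (1/4) = 1, so its variation V d - 1 and the two boundary terms add up
  -- to 2 V d.
  calc _ ≤ ‖c‖ * V (1 / 4) + ‖c‖ * V d + ‖c‖ * (V d - 1) := by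
        refine (norm_sub_le _ _).trans (add_le_add ((norm_sub_le _ _).trans ?_) hsec)
        rw [hb _ (by simp), hb _ (by simp)]
    _ = 2 * ‖c‖ * V d := by rw [hV14]; ring
    _ ≤ 2 * ‖c‖ * (1 / (4 * d)) := by gcongr
    _ = (1 / Real.pi) * (1 / (4 * |r| * d)) := by rw [hcn]; field_simp; 
    _ ≤ 1 * (1 / (4 * |r| * d)) := by
        gcongr
        rw [div_le_one hpi]; linarith [Real.pi_gt_three]
    _ = _ := one_mul _

/-- Within |r|^(-1/2)/4 of the critical point the integrand is bounded by 1; beyond it the first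
derivative test gives |r|^(-1/2). Together this is the factor 5/4. -/
theorem norm_integral_exp_cos_quarter_le {r : ℝ} (hr : 1 ≤ |r|) :
    ‖∫ x in (0 : ℝ)..(1 / 4 : ℝ), Complex.exp (I * (r * Real.cos (2 * Real.pi * x) : ℝ))‖
      ≤ 5 / 4 * |r| ^ (-(1 / 2) : ℝ) := by
  have hr0 : 0 < |r| := by linarith
  set s : ℝ := |r| ^ (-(1 / 2) : ℝ) with hs
  have hs0 : 0 < s := Real.rpow_pos_of_pos hr0 _
  have hs1 : s ≤ 1 := Real.rpow_le_one_of_one_le_of_nonpos hr (by norm_num)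
  have hss : |r| * s * s = 1 := by
    rw [hs, mul_assoc, ← Real.rpow_add hr0]
    norm_num
    rw [Real.rpow_neg_one, mul_inv_cancel₀ hr0.ne']
  have hcont : Continuous fun x : ℝ => Complex.exp (I * (r * Real.cos (2 * Real.pi * x) : ℝ)) := by
    fun_prop
  rw [← intervalIntegral.integral_add_adjacent_intervals (b := s / 4)
    (hcont.intervalIntegrable _ _) (hcont.intervalIntegrable _ _)]
  refine (norm_add_le _ _).trans ?_
  have h1 : ‖∫ x in (0 : ℝ)..(s / 4), Complex.exp (I * (r * Real.cos (2 * Real.pi * x) : ℝ))‖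
      ≤ 1 * |s / 4 - 0| := by
    apply intervalIntegral.norm_integral_le_of_norm_le_const
    intro x _
    rw [mul_comm, Complex.norm_exp_ofReal_mul_I]
  have h2 := norm_integral_exp_cos_le_of_pos (r := r) (d := s / 4) (abs_pos.1 hr0)
    (by positivity) (by linarith)
  have h3 : 1 / (4 * |r| * (s / 4)) = s := by
    rw [div_eq_iff (by positivity)]; linarith
  rw [sub_zero, abs_of_pos (by positivity)] at h1
  rw [h3] at h2
  linarith

/-- `J₀`, as an integral over the circle. -/
noncomputable def bessel (r : ℝ) : ℂ :=
  ∫ x : UnitAddCircle, Complex.exp (I * (r * ((AddCircle.toCircle x : Circle) : ℂ).re : ℝ))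
    ∂AddCircle.haarAddCircle

theorem volume_unitAddCircle_eq_haar :
    (volume : Measure UnitAddCircle) = AddCircle.haarAddCircle := by
  rw [AddCircle.volume_eq_smul_haarAddCircle]; simp

theorem re_toCircle_coe (x : ℝ) :
    ((AddCircle.toCircle (x : UnitAddCircle) : Circle) : ℂ).re = Real.cos (2 * Real.pi * x) := by
  rw [AddCircle.toCircle_apply_mk, Circle.coe_exp, Complex.exp_ofReal_mul_I_re]; simp

theorem bessel_eq (r : ℝ) : bessel r =
    ∫ x in (0 : ℝ)..1, Complex.exp (I * (r * Real.cos (2 * Real.pi * x) : ℝ)) := by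
  have h := UnitAddCircle.intervalIntegral_preimage 0
    (fun x : UnitAddCircle =>
      Complex.exp (I * (r * ((AddCircle.toCircle x : Circle) : ℂ).re : ℝ)))
  rw [zero_add] at h
  rw [bessel, ← volume_unitAddCircle_eq_haar, ← h]
  simp only [re_toCircle_coe]

theorem norm_bessel_le_one (r : ℝ) : ‖bessel r‖ ≤ 1 := by
  rw [bessel_eq]
  refine (intervalIntegral.norm_integral_le_of_norm_le_const (C := 1) ?_).trans (by simp)
  intro x _
  rw [mul_comm, Complex.norm_exp_ofReal_mul_I]

/-- The symmetries of the cosine cut the period into four quarters with phase r or -r, each of size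
5/4 |r|^(-1/2). The factor 10 instead of 5 pays for replacing |r| by 1 + |r|, and for small r the
trivial bound suffices. -/
theorem norm_bessel_le (r : ℝ) : ‖bessel r‖ ≤ 10 * (1 + |r|) ^ (-(1 / 2) : ℝ) := by
  have hcomp : (2 : ℝ) ^ (-(1 / 2) : ℝ) = 1 / Real.sqrt 2 := by
    rw [Real.rpow_neg (by norm_num), ← Real.sqrt_eq_rpow, one_div]
  have hs2 : Real.sqrt 2 ≤ 2 := by
    rw [Real.sqrt_le_left (by norm_num)]; norm_num
  have hs2' : 0 < Real.sqrt 2 := by positivity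
  have h2 : (1 / 2 : ℝ) ≤ (2 : ℝ) ^ (-(1 / 2) : ℝ) := by
    rw [hcomp]; exact one_div_le_one_div_of_le hs2' hs2
  rcases le_total |r| 1 with hr | hr
  · refine (norm_bessel_le_one r).trans ?_
    have : (2 : ℝ) ^ (-(1 / 2) : ℝ) ≤ (1 + |r|) ^ (-(1 / 2) : ℝ) :=
      Real.rpow_le_rpow_of_nonpos (by positivity) (by linarith) (by norm_num)
    linarith
  · have key : ‖bessel r‖ ≤ 5 * |r| ^ (-(1 / 2) : ℝ) := by
      rw [bessel_eq]
      set f : ℝ → ℝ → ℂ := fun r x => Complex.exp (I * (r * Real.cos (2 * Real.pi * x) : ℝ))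
      have hc : ∀ r, Continuous (f r) := by intro r; fun_prop
      have e1 : ∫ x in (1 / 2 : ℝ)..1, f r x = ∫ x in (0 : ℝ)..(1 / 2), f r x := by
        have := intervalIntegral.integral_comp_sub_left (a := 0) (b := 1 / 2) (f r) 1
        rw [show (1 : ℝ) - 1 / 2 = 1 / 2 by norm_num, sub_zero] at this
        rw [← this]
        congr 1; funext x
        simp only [f]
        rw [show 2 * Real.pi * (1 - x) = 2 * Real.pi - 2 * Real.pi * x by ring,
          Real.cos_two_pi_sub]
      have e2 : ∫ x in (1 / 4 : ℝ)..(1 / 2), f r x = ∫ x in (0 : ℝ)..(1 / 4), f (-r) x := by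
        have := intervalIntegral.integral_comp_sub_left (a := 0) (b := 1 / 4) (f r) (1 / 2)
        rw [show (1 / 2 : ℝ) - 1 / 4 = 1 / 4 by norm_num, sub_zero] at this
        rw [← this]
        congr 1; funext x
        simp only [f]
        rw [show 2 * Real.pi * (1 / 2 - x) = Real.pi - 2 * Real.pi * x by ring,
          Real.cos_pi_sub, neg_mul, mul_neg]
      have e3 : ∫ x in (0 : ℝ)..1, f r x
          = 2 * ((∫ x in (0 : ℝ)..(1 / 4), f r x) + ∫ x in (0 : ℝ)..(1 / 4), f (-r) x) := by
        rw [← intervalIntegral.integral_add_adjacent_intervals (b := 1 / 2)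
          ((hc r).intervalIntegrable _ _) ((hc r).intervalIntegrable _ _), e1,
          ← intervalIntegral.integral_add_adjacent_intervals (b := 1 / 4) (c := 1 / 2)
          ((hc r).intervalIntegrable _ _) ((hc r).intervalIntegrable _ _), e2]
        ring
      change ‖∫ x in (0 : ℝ)..1, f r x‖ ≤ _
      have q1 : ‖∫ x in (0 : ℝ)..(1 / 4), f r x‖ ≤ _ := norm_integral_exp_cos_quarter_le hr
      have q2 : ‖∫ x in (0 : ℝ)..(1 / 4), f (-r) x‖ ≤ _ :=
        norm_integral_exp_cos_quarter_le (r := -r) (by rwa [abs_neg])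
      rw [abs_neg] at q2
      rw [e3, norm_mul]
      have := norm_add_le (∫ x in (0 : ℝ)..(1 / 4), f r x) (∫ x in (0 : ℝ)..(1 / 4), f (-r) x)
      rw [show ‖(2 : ℂ)‖ = 2 by simp]
      linarith
    have h3 : (2 * |r|) ^ (-(1 / 2) : ℝ) ≤ (1 + |r|) ^ (-(1 / 2) : ℝ) :=
      Real.rpow_le_rpow_of_nonpos (by positivity) (by linarith) (by norm_num)
    rw [Real.mul_rpow (by norm_num) (abs_nonneg r)] at h3
    have h4 : 0 ≤ |r| ^ (-(1 / 2) : ℝ) := by positivity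
    nlinarith

/-! ### Oscillatory averages of two shifted energies -/

theorem two_mul_norm_le_abs_sin (x : ℝ) :
    2 * ‖(x : UnitAddCircle)‖ ≤ |Real.sin (Real.pi * x)| := by
  have hpi := Real.pi_pos
  rw [UnitAddCircle.norm_eq]
  have h1 : |Real.sin (Real.pi * x)| = |Real.sin (Real.pi * (x - round x))| := by
    rw [mul_sub, mul_comm Real.pi (round x : ℝ), Real.sin_sub_int_mul_pi, abs_mul, abs_zpow]
    simp
  have h2 := abs_sub_round x
  have h3 := Real.mul_abs_le_abs_sin (x := Real.pi * (x - round x))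
    (by rw [abs_mul, abs_of_pos hpi]; nlinarith)
  rw [h1]
  refine le_trans (le_of_eq ?_) h3
  rw [abs_mul, abs_of_pos hpi]
  field_simp

/-- The half period of the circle. -/
noncomputable def halfPeriod : UnitAddCircle := ((1 / 2 : ℝ) : UnitAddCircle)

/-- Take the cosine and sine of πx for a representative x of w; since w determines them only up to a
common sign, they are merely asserted to exist. The half-angle identity separates the directions s₁
+ s₂ and s₁ - s₂, whose weights degenerate only at the half period and at 0. -/
theorem exists_half_angle (w : UnitAddCircle) : ∃ c s : ℝ, c ^ 2 + s ^ 2 = 1 ∧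
    2 * ‖w‖ ≤ |s| ∧ 2 * ‖w - halfPeriod‖ ≤ |c| ∧
    ∀ s₁ s₂ : ℝ, ‖(s₁ + s₂ * ((AddCircle.toCircle w : Circle) : ℂ) : ℂ)‖ ^ 2
      = (s₁ + s₂) ^ 2 * c ^ 2 + (s₁ - s₂) ^ 2 * s ^ 2 := by
  obtain ⟨x, rfl⟩ := QuotientAddGroup.mk_surjective w
  refine ⟨Real.cos (Real.pi * x), Real.sin (Real.pi * x), Real.cos_sq_add_sin_sq _,
    two_mul_norm_le_abs_sin x, ?_, ?_⟩
  · have := two_mul_norm_le_abs_sin (x - 1 / 2)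
    rw [show Real.pi * (x - 1 / 2) = Real.pi * x - Real.pi / 2 by ring,
      Real.sin_sub_pi_div_two, abs_neg] at this
    exact this
  · intro s₁ s₂
    rw [AddCircle.toCircle_apply_mk, Circle.coe_exp]
    have e : (s₁ + s₂ * Complex.exp ((2 * Real.pi / 1 * x : ℝ) * I) : ℂ)
        = ((s₁ + s₂ * Real.cos (2 * (Real.pi * x)) : ℝ) : ℂ)
          + ((s₂ * Real.sin (2 * (Real.pi * x)) : ℝ) : ℂ) * I := by
      rw [Complex.exp_mul_I, show 2 * Real.pi / 1 * x = 2 * (Real.pi * x) by ring]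
      push_cast; ring
    rw [e, ← Complex.normSq_eq_norm_sq, Complex.normSq_add_mul_I, Real.cos_two_mul,
      Real.sin_two_mul]
    have := Real.sin_sq_add_cos_sq (Real.pi * x)
    set c := Real.cos (Real.pi * x)
    set s := Real.sin (Real.pi * x)
    have hs : s ^ 2 = 1 - c ^ 2 := by linarith
    have : s ^ 2 * s ^ 2 = (1 - c ^ 2) ^ 2 := by rw [hs]; ring
    linear_combination (4 * s₂ ^ 2 * c ^ 2 - (s₁ - s₂) ^ 2) * hs

/-- A translation of the circle absorbs the argument of z. -/
theorem norm_integral_exp_re_mul (z : ℂ) :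
    ‖∫ x : UnitAddCircle, Complex.exp
      (I * ((((AddCircle.toCircle x : Circle) : ℂ) * z).re : ℝ)) ∂AddCircle.haarAddCircle‖
      = ‖bessel ‖z‖‖ := by
  have hz : z = ‖z‖ * ((AddCircle.toCircle
      ((z.arg / (2 * Real.pi) : ℝ) : UnitAddCircle) : Circle) : ℂ) := by
    rw [AddCircle.toCircle_apply_mk, Circle.coe_exp]
    conv_lhs => rw [← Complex.norm_mul_exp_arg_mul_I z]
    congr 3
    have := Real.pi_pos.ne'
    push_cast
    field_simp
  set c : UnitAddCircle := ((z.arg / (2 * Real.pi) : ℝ) : UnitAddCircle)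
  rw [bessel, ← integral_add_right_eq_self (fun x : UnitAddCircle => Complex.exp
    (I * (‖z‖ * ((AddCircle.toCircle x : Circle) : ℂ).re : ℝ))) c]
  congr 2
  funext x
  congr 3
  conv_lhs => rw [hz]
  rw [AddCircle.toCircle_add, Circle.coe_mul,
    show (AddCircle.toCircle x : ℂ) * (‖z‖ * (AddCircle.toCircle c : ℂ))
      = (‖z‖ : ℂ) * ((AddCircle.toCircle x : ℂ) * (AddCircle.toCircle c : ℂ)) by ring,
    Complex.re_ofReal_mul]

/-- In each coordinate s₁ cos(2πk) + s₂ cos(2π(k + w)) is the real part of e^(2πik) (s₁ + s₂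
e^(2πiw)). The exponential thus factorizes over the coordinates, up to a constant phase. -/
theorem norm_integral_exp_energies (s₁ s₂ a b : ℝ) (w : Torus3) :
    ‖∫ k : Torus3, Complex.exp (I * (s₁ * (kineticEnergy k - a)
        + s₂ * (kineticEnergy (k + w) - b) : ℝ)) ∂torusMeasure‖
      = ∏ j, ‖bessel ‖(s₁ + s₂ * ((AddCircle.toCircle (w j) : Circle) : ℂ) : ℂ)‖‖ := by
  have h : ∀ k : Torus3, Complex.exp (I * (s₁ * (kineticEnergy k - a)
        + s₂ * (kineticEnergy (k + w) - b) : ℝ))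
      = Complex.exp ((s₁ * (3 - a) + s₂ * (3 - b) : ℝ) * I) * ∏ j : Fin 3, Complex.exp
        (I * ((((AddCircle.toCircle (k j) : Circle) : ℂ)
          * -(s₁ + s₂ * ((AddCircle.toCircle (w j) : Circle) : ℂ))).re : ℝ)) := by
    intro k
    rw [← Complex.exp_sum, ← Complex.exp_add]
    congr 1
    rw [← Finset.mul_sum, mul_comm _ I, ← mul_add]
    congr 1
    rw [← Complex.ofReal_sum, ← Complex.ofReal_add]
    congr 1
    have : ∀ j : Fin 3, ((((AddCircle.toCircle (k j) : Circle) : ℂ)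
          * -(s₁ + s₂ * ((AddCircle.toCircle (w j) : Circle) : ℂ))).re : ℝ)
        = -(s₁ * ((AddCircle.toCircle (k j) : Circle) : ℂ).re)
          - s₂ * ((AddCircle.toCircle ((k + w) j) : Circle) : ℂ).re := by
      intro j
      rw [Pi.add_apply, AddCircle.toCircle_add, Circle.coe_mul]
      simp only [Complex.mul_re, Complex.neg_re, Complex.add_re, Complex.neg_im, Complex.add_im,
        Complex.ofReal_re, Complex.ofReal_im, Complex.mul_im]
      ring
    simp only [this, Finset.sum_sub_distrib, Finset.sum_neg_distrib, ← Finset.mul_sum,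
      kineticEnergy]
    ring
  simp only [h]
  rw [integral_const_mul, norm_mul, Complex.norm_exp_ofReal_mul_I, one_mul,
    integral_fintype_prod_eq_prod (fun j (x : UnitAddCircle) => Complex.exp
        (I * ((((AddCircle.toCircle x : Circle) : ℂ)
          * -(s₁ + s₂ * ((AddCircle.toCircle (w j) : Circle) : ℂ))).re : ℝ))), norm_prod]
  refine Finset.prod_congr rfl fun j _ => ?_
  rw [norm_integral_exp_re_mul, norm_neg]

theorem continuous_kineticEnergy : Continuous kineticEnergy := by
  unfold kineticEnergy
  refine continuous_const.sub (continuous_finsetSum _ fun i _ => ?_)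
  exact Complex.continuous_re.comp (continuous_subtype_val.comp
    (AddCircle.continuous_toCircle.comp (continuous_apply i)))

theorem kineticEnergy_neg (k : Torus3) : kineticEnergy (-k) = kineticEnergy k := by
  simp [kineticEnergy, AddCircle.toCircle_neg]

theorem kineticEnergy_nonneg (k : Torus3) : 0 ≤ kineticEnergy k := by
  have : ∀ i : Fin 3, ((AddCircle.toCircle (k i) : Circle) : ℂ).re ≤ 1 := fun i =>
    (Complex.re_le_norm _).trans (Circle.norm_coe _).le
  have := Finset.sum_le_sum fun i (_ : i ∈ Finset.univ) => this i
  simp at this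
  unfold kineticEnergy; linarith

theorem kineticEnergy_le (k : Torus3) : kineticEnergy k ≤ 6 := by
  have : ∀ i : Fin 3, -1 ≤ ((AddCircle.toCircle (k i) : Circle) : ℂ).re := fun i =>
    (abs_le.1 ((Complex.abs_re_le_norm _).trans (Circle.norm_coe _).le)).1
  have := Finset.sum_le_sum fun i (_ : i ∈ Finset.univ) => this i
  simp at this
  unfold kineticEnergy; linarith

/-! ### Lorentzians and resolvents -/

theorem integrable_comp_abs {f : ℝ → ℝ} (hf : IntegrableOn f (Set.Ioi 0)) :
    Integrable fun x => f |x| := by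
  have h1 : IntegrableOn (fun x => f |x|) (Set.Ioi 0) :=
    hf.congr_fun (fun x hx => by
      have hx : 0 < x := hx
      simp only [abs_of_pos hx]) measurableSet_Ioi
  have h2 : IntegrableOn (fun x => f |x|) (Set.Iic 0) := by
    rw [← Measure.map_neg_eq_self (volume : Measure ℝ)]
    have m : MeasurableEmbedding fun x : ℝ => -x := (Homeomorph.neg ℝ).measurableEmbedding
    rw [m.integrableOn_map_iff]
    simp_rw [Function.comp_def, abs_neg, Set.neg_preimage, Set.neg_Iic, neg_zero]
    exact Iff.mpr integrableOn_Ici_iff_integrableOn_Ioi h1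
  have := h2.union h1
  rwa [Set.Iic_union_Ioi, integrableOn_univ] at this

/-- Fourier representation of the Lorentzian. -/
theorem integral_exp_neg_abs_mul_exp {ρ : ℝ} (hρ : 0 < ρ) (x : ℝ) :
    ∫ s : ℝ, (Real.exp (-ρ * |s|) : ℂ) * Complex.exp (I * (s * x : ℝ))
      = ((2 * ρ / (x ^ 2 + ρ ^ 2) : ℝ) : ℂ) := by
  have key : ∀ y : ℝ, ∫ s in Set.Ioi (0 : ℝ),
      (Real.exp (-ρ * |s|) : ℂ) * Complex.exp (I * (s * y : ℝ)) = 1 / (ρ - I * y) := by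
    intro y
    have h1 : ∫ s in Set.Ioi (0 : ℝ),
      (Real.exp (-ρ * |s|) : ℂ) * Complex.exp (I * (s * y : ℝ))
        = ∫ s in Set.Ioi (0 : ℝ), Complex.exp ((-ρ + I * y) * s) := by
      apply setIntegral_congr_fun measurableSet_Ioi
      intro s hs
      have hs : 0 < s := hs
      simp only [abs_of_pos hs]
      rw [Complex.ofReal_exp, ← Complex.exp_add]
      congr 1; push_cast; ring
    rw [h1, integral_exp_mul_complex_Ioi (by simpa using hρ)]
    simp only [Complex.ofReal_zero, mul_zero, Complex.exp_zero]
    rw [← neg_div_neg_eq, neg_neg, neg_add, neg_neg, sub_eq_add_neg]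
  have hne : ∀ y : ℝ, (ρ - I * y : ℂ) ≠ 0 := by
    intro y h
    have := congrArg Complex.re h
    simp at this
    exact hρ.ne' this
  have hint : Integrable fun s : ℝ => (Real.exp (-ρ * |s|) : ℂ) * Complex.exp (I * (s * x : ℝ)) := by
    have h0 : Integrable fun s : ℝ => Real.exp (-ρ * |s|) := by
      exact integrable_comp_abs (f := fun s => Real.exp (-ρ * s)) (exp_neg_integrableOn_Ioi 0 hρ)
    refine (h0.ofReal (𝕜 := ℂ)).mul_bdd (c := 1) (by
      apply Continuous.aestronglyMeasurable; fun_prop) (Filter.Eventually.of_forall fun s => ?_)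
    rw [mul_comm, Complex.norm_exp_ofReal_mul_I]
  rw [← setIntegral_univ, ← Set.Iic_union_Ioi (a := (0 : ℝ)), setIntegral_union
    (Set.Iic_disjoint_Ioi le_rfl) measurableSet_Ioi hint.integrableOn hint.integrableOn, key]
  have h2 := integral_comp_neg_Ioi (0 : ℝ) fun s : ℝ =>
    (Real.exp (-ρ * |s|) : ℂ) * Complex.exp (I * (s * x : ℝ))
  rw [neg_zero] at h2
  rw [← h2]
  have h3 := key (-x)
  have h6 : (fun s : ℝ => (Real.exp (-ρ * |-s|) : ℂ) * Complex.exp (I * (-s * x : ℝ)))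
      = fun s : ℝ => (Real.exp (-ρ * |s|) : ℂ) * Complex.exp (I * (s * -x : ℝ)) := by
    funext s; rw [abs_neg, neg_mul s x, mul_neg s x]
  rw [h6, h3]
  have := hne x
  have h4 := hne (-x)
  have h5 : ((x : ℂ) ^ 2 + ρ ^ 2) ≠ 0 := by
    have : 0 < x ^ 2 + ρ ^ 2 := by positivity
    exact_mod_cast this.ne'
  push_cast at h4 ⊢
  rw [mul_neg, sub_neg_eq_add] at h4 ⊢
  field_simp
  ring_nf
  simp only [I_sq]
  ring

/-- `1 / max |x| ε`, the size of a resolvent at distance `x` from the energy shell. -/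
noncomputable def cutoffInv (ε x : ℝ) : ℝ≥0∞ := ENNReal.ofReal (1 / max |x| ε)

/-- The Lorentzian `ρ / (x² + ρ²)`. -/
noncomputable def lorentz (ρ x : ℝ) : ℝ := ρ / (x ^ 2 + ρ ^ 2)

theorem lorentz_nonneg {ρ : ℝ} (hρ : 0 ≤ ρ) (x : ℝ) : 0 ≤ lorentz ρ x := by
  unfold lorentz; positivity

theorem measurable_cutoffInv (ε : ℝ) : Measurable (cutoffInv ε) := by
  unfold cutoffInv
  fun_prop

theorem measurable_lorentz : Measurable (Function.uncurry lorentz) := by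
  unfold lorentz Function.uncurry
  fun_prop

theorem cutoffInv_le_one_div {ε : ℝ} (hε : 0 < ε) (x : ℝ) :
    cutoffInv ε x ≤ ENNReal.ofReal (1 / ε) :=
  ENNReal.ofReal_le_ofReal (one_div_le_one_div_of_le hε (le_max_right _ _))

/-- With m = max |x| ε, the integrand 1/(x² + ρ²) is at least 1/(5m²) on [m, 2m], an interval of
length m. The upper limit 14 is twice the bound 7 for m. -/
theorem cutoffInv_le_lintegral {ε x : ℝ} (hε : 0 < ε) (hε1 : ε ≤ 1) (hx : |x| ≤ 7) :
    cutoffInv ε x ≤ 5 * ∫⁻ ρ in Set.Icc ε 14,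
      ENNReal.ofReal (1 / ρ) * ENNReal.ofReal (lorentz ρ x) := by
  set m := max |x| ε with hm
  have hm0 : 0 < m := lt_max_of_lt_right hε
  have hm7 : m ≤ 7 := max_le hx (by linarith)
  have h1 : ∫⁻ ρ in Set.Icc m (2 * m), ENNReal.ofReal (1 / (5 * m ^ 2)) ≤
      ∫⁻ ρ in Set.Icc ε 14, ENNReal.ofReal (1 / ρ) * ENNReal.ofReal (lorentz ρ x) := by
    refine (setLIntegral_mono' measurableSet_Icc fun ρ hρ => ?_).trans
      (lintegral_mono_set (Set.Icc_subset_Icc (le_max_right _ _) (by linarith)))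
    have hρ0 : 0 < ρ := hm0.trans_le hρ.1
    rw [← ENNReal.ofReal_mul (by positivity)]
    apply ENNReal.ofReal_le_ofReal
    have : 1 / ρ * lorentz ρ x = 1 / (x ^ 2 + ρ ^ 2) := by
      unfold lorentz; field_simp
    rw [this]
    apply one_div_le_one_div_of_le (by positivity)
    have h2 : x ^ 2 ≤ m ^ 2 := by
      rw [← sq_abs x]; exact pow_le_pow_left₀ (abs_nonneg _) (le_max_left _ _) 2
    have h3 : ρ ^ 2 ≤ (2 * m) ^ 2 := pow_le_pow_left₀ hρ0.le hρ.2 2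
    nlinarith
  refine le_trans ?_ (mul_le_mul_right h1 5)
  rw [setLIntegral_const, Real.volume_Icc, ← ENNReal.ofReal_mul (by positivity),
    show (5 : ℝ≥0∞) = ENNReal.ofReal 5 by simp, ← ENNReal.ofReal_mul (by norm_num)]
  apply ENNReal.ofReal_le_ofReal
  rw [← hm]
  apply le_of_eq
  field_simp
  ring

theorem one_le_abs_log {ε : ℝ} (hε : 0 < ε) (hε3 : ε ≤ 1 / 3) : 1 ≤ |Real.log ε| := by
  have h1 : Real.log ε ≤ -1 := by
    rw [Real.log_le_iff_le_exp hε]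
    refine hε3.trans ?_
    rw [Real.exp_neg, one_div]
    exact inv_anti₀ (Real.exp_pos _) (Real.exp_one_lt_d9.le.trans (by norm_num))
  rw [abs_of_neg (by linarith)]; linarith

theorem lintegral_one_div_le {ε : ℝ} (hε : 0 < ε) (hε3 : ε ≤ 1 / 3) :
    ∫⁻ ρ in Set.Icc ε 14, ENNReal.ofReal (1 / ρ) ≤ ENNReal.ofReal (4 * |Real.log ε|) := by
  have hle : ε ≤ 14 := by linarith
  have h0 : IntervalIntegrable (fun ρ : ℝ => 1 / ρ) volume ε 14 := by
    apply ContinuousOn.intervalIntegrable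
    apply ContinuousOn.div continuousOn_const continuousOn_id
    intro x hx
    rw [Set.uIcc_of_le hle] at hx
    exact (hε.trans_le hx.1).ne'
  have hl := one_le_abs_log hε hε3
  have hneg : Real.log ε < 0 := Real.log_neg hε (by linarith)
  rw [← Measure.restrict_congr_set Ioc_ae_eq_Icc, ← ofReal_integral_eq_lintegral_ofReal h0.1]
  · apply ENNReal.ofReal_le_ofReal
    rw [← intervalIntegral.integral_of_le hle, integral_one_div_of_pos hε (by norm_num),
      Real.log_div (by norm_num) hε.ne']
    have : Real.log 14 ≤ 3 := by
      rw [Real.log_le_iff_le_exp (by norm_num)]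
      have := Real.exp_one_gt_d9
      calc (14 : ℝ) ≤ 2.7 ^ 3 := by norm_num
        _ ≤ Real.exp 1 ^ 3 := by gcongr; linarith
        _ = Real.exp 3 := by rw [← Real.exp_nat_mul]; norm_num
    rw [abs_of_neg hneg] at hl ⊢
    linarith
  · filter_upwards [self_mem_ae_restrict measurableSet_Ioc] with ρ hρ
    have := hε.trans hρ.1
    positivity

/-- Resolvents are superpositions of Lorentzians of width at least `ε`. -/
theorem lintegral_cutoffInv_mul_le {Y : Type*} [MeasurableSpace Y] {μ : Measure Y} [SFinite μ]
    {ε : ℝ} (hε : 0 < ε) (hε3 : ε ≤ 1 / 3) {f : Y → ℝ} (hf : Measurable f)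
    (hf7 : ∀ y, |f y| ≤ 7) {W : Y → ℝ≥0∞} (hW : Measurable W) {B : ℝ≥0∞}
    (hB : ∀ ρ, ε ≤ ρ → ∫⁻ y, ENNReal.ofReal (lorentz ρ (f y)) * W y ∂μ ≤ B) :
    ∫⁻ y, cutoffInv ε (f y) * W y ∂μ ≤ ENNReal.ofReal (20 * |Real.log ε|) * B := by
  have hlm : Measurable fun z : Y × ℝ =>
      ENNReal.ofReal (1 / z.2) * ENNReal.ofReal (lorentz z.2 (f z.1)) := by
    have : Measurable fun z : Y × ℝ => lorentz z.2 (f z.1) :=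
      measurable_lorentz.comp (measurable_snd.prodMk (hf.comp measurable_fst))
    fun_prop
  calc ∫⁻ y, cutoffInv ε (f y) * W y ∂μ
      ≤ ∫⁻ y, (5 * ∫⁻ ρ in Set.Icc ε 14, ENNReal.ofReal (1 / ρ) *
          ENNReal.ofReal (lorentz ρ (f y)) * W y) ∂μ := by
        refine lintegral_mono fun y => ?_
        have hm : Measurable fun ρ : ℝ =>
            ENNReal.ofReal (1 / ρ) * ENNReal.ofReal (lorentz ρ (f y)) :=
          hlm.comp measurable_prodMk_left
        rw [lintegral_mul_const _ hm, ← mul_assoc]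
        exact mul_le_mul_left (cutoffInv_le_lintegral hε (by linarith) (hf7 y)) _
    _ = 5 * ∫⁻ ρ : ℝ in Set.Icc ε 14, ∫⁻ y, ENNReal.ofReal (1 / ρ) *
          ENNReal.ofReal (lorentz ρ (f y)) * W y ∂μ := by
        have hm : Measurable fun z : Y × ℝ =>
            ENNReal.ofReal (1 / z.2) * ENNReal.ofReal (lorentz z.2 (f z.1)) * W z.1 :=
          hlm.mul (hW.comp measurable_fst)
        rw [lintegral_const_mul _ hm.lintegral_prod_right', lintegral_lintegral_swap]
        exact hm.aemeasurable
    _ ≤ 5 * ∫⁻ ρ : ℝ in Set.Icc ε 14, ENNReal.ofReal (1 / ρ) * B := by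
        gcongr 5 * ?_
        refine setLIntegral_mono' measurableSet_Icc fun ρ hρ => ?_
        simp only [mul_assoc]
        rw [lintegral_const_mul']
        · exact mul_le_mul_right (hB ρ hρ.1) _
        · exact ENNReal.ofReal_ne_top
    _ ≤ 5 * (ENNReal.ofReal (4 * |Real.log ε|) * B) := by
        rw [lintegral_mul_const _ (by fun_prop)]
        gcongr
        exact lintegral_one_div_le hε hε3
    _ = _ := by
        rw [← mul_assoc, show (5 : ℝ≥0∞) = ENNReal.ofReal 5 by simp,
          ← ENNReal.ofReal_mul (by norm_num)]
        congr 2; ring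

theorem lintegral_cutoffInv_le {Y : Type*} [MeasurableSpace Y] {μ : Measure Y} [SFinite μ]
    {ε : ℝ} (hε : 0 < ε) (hε3 : ε ≤ 1 / 3) {f : Y → ℝ} (hf : Measurable f)
    (hf7 : ∀ y, |f y| ≤ 7) {B : ℝ≥0∞}
    (hB : ∀ ρ, ε ≤ ρ → ∫⁻ y, ENNReal.ofReal (lorentz ρ (f y)) ∂μ ≤ B) :
    ∫⁻ y, cutoffInv ε (f y) ∂μ ≤ ENNReal.ofReal (20 * |Real.log ε|) * B := by
  have := lintegral_cutoffInv_mul_le (μ := μ) hε hε3 hf hf7 (W := fun _ => 1) measurable_const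
    (B := B) (by simpa using hB)
  simpa using this

/-- Projection of the energies to `[-1, 7]` brings them closer to the spectrum `[0, 6]`. -/
theorem cutoffInv_le_clamp {ε e : ℝ} (hε : 0 < ε) (h0 : 0 ≤ e) (h6 : e ≤ 6) (a : ℝ) :
    cutoffInv ε (e - a) ≤ cutoffInv ε (e - max (-1) (min a 7)) := by
  apply ENNReal.ofReal_le_ofReal
  apply one_div_le_one_div_of_le (lt_max_of_lt_right hε)
  apply max_le_max _ le_rfl
  rw [abs_le]
  have h1 := neg_abs_le (e - a)
  have h2 := le_abs_self (e - a)
  rcases min_cases a 7 with ⟨h, h'⟩ | ⟨h, h'⟩ <;>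
    rcases max_cases (-1) (min a 7) with ⟨h3, h4⟩ | ⟨h3, h4⟩ <;> constructor <;> linarith

theorem abs_sub_clamp_le {e : ℝ} (h0 : 0 ≤ e) (h6 : e ≤ 6) (a : ℝ) :
    |e - max (-1) (min a 7)| ≤ 7 := by
  have h1 : max (-1) (min a 7) ≤ 7 := max_le (by norm_num) (min_le_right _ _)
  have h2 : -1 ≤ max (-1) (min a 7) := le_max_left _ _
  rw [abs_le]; constructor <;> linarith

/-- The primitive is an arctangent divided by the speed 8, so the integral stays below π/8,
uniformly in ρ and x. -/
theorem lintegral_lorentz_interval_le {ρ : ℝ} (hρ : 0 < ρ) (x : ℝ) :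
    ∫⁻ s in Set.Ioc (0 : ℝ) 1, ENNReal.ofReal (lorentz ρ (x - (-1 + 8 * s))) ≤ 1 := by
  have hd : ∀ s ∈ Set.uIcc (0 : ℝ) 1,
      HasDerivAt (fun s => (1 / 8) * Real.arctan ((8 * s - 1 - x) / ρ))
        (lorentz ρ (x - (-1 + 8 * s))) s := by
    intro s _
    have h1 : HasDerivAt (fun s : ℝ => (8 * s - 1 - x) / ρ) (8 / ρ) s := by
      have := ((((hasDerivAt_id s).const_mul 8).sub_const 1).sub_const x).div_const ρ
      simpa using this
    have := (h1.arctan).const_mul (1 / 8 : ℝ)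
    refine this.congr_deriv ?_
    unfold lorentz
    have : 0 < (x - (-1 + 8 * s)) ^ 2 + ρ ^ 2 := by positivity
    have h3 : 0 < 1 + ((8 * s - 1 - x) / ρ) ^ 2 := by positivity
    field_simp
    ring
  have hc : Continuous fun s : ℝ => lorentz ρ (x - (-1 + 8 * s)) := by
    unfold lorentz
    refine Continuous.div (by fun_prop) (by fun_prop) fun s => ?_
    positivity
  have hi := hc.intervalIntegrable (μ := volume) 0 1
  rw [← ofReal_integral_eq_lintegral_ofReal hi.1
    (Filter.Eventually.of_forall fun s => lorentz_nonneg hρ.le _),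
    ← intervalIntegral.integral_of_le zero_le_one,
    intervalIntegral.integral_eq_sub_of_hasDerivAt hd hi]
  rw [← ENNReal.ofReal_one]
  apply ENNReal.ofReal_le_ofReal
  have h1 := Real.arctan_lt_pi_div_two ((8 * 1 - 1 - x) / ρ)
  have h2 := Real.neg_pi_div_two_lt_arctan ((8 * 0 - 1 - x) / ρ)
  have := Real.pi_lt_four
  linarith

/-- Oscillatory representation of an average, followed by the triangle inequality. -/
theorem lintegral_ofReal_le_of_eq_integral_exp {T : Type*} [MeasurableSpace T] {ν : Measure T}
    [SFinite ν] {w : T → ℝ} (hw : Integrable w ν) (hw0 : ∀ t, 0 ≤ w t)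
    {θ : Torus3 × T → ℝ} (hθ : Measurable θ) {f : Torus3 → ℝ} (hf0 : ∀ k, 0 ≤ f k)
    (hf : ∀ k, (f k : ℂ) = ∫ t, (w t : ℂ) * Complex.exp (I * (θ (k, t) : ℝ)) ∂ν) :
    ∫⁻ k, ENNReal.ofReal (f k) ∂torusMeasure ≤
      ∫⁻ t, ENNReal.ofReal (w t) *
        ‖∫ k, Complex.exp (I * (θ (k, t) : ℝ)) ∂torusMeasure‖ₑ ∂ν := by
  have hint : Integrable (Function.uncurry fun (k : Torus3) (t : T) =>
      (w t : ℂ) * Complex.exp (I * (θ (k, t) : ℝ))) (torusMeasure.prod ν) := by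
    have h1 : Integrable (fun z : Torus3 × T => (w z.2 : ℂ)) (torusMeasure.prod ν) :=
      (hw.ofReal (𝕜 := ℂ)).comp_snd _
    refine h1.mul_bdd (c := 1) ?_ (Filter.Eventually.of_forall fun z => ?_)
    · apply Measurable.aestronglyMeasurable
      fun_prop
    · rw [mul_comm, Complex.norm_exp_ofReal_mul_I]
  have hfi : Integrable (fun k => (f k : ℂ)) torusMeasure := by
    simp only [hf]
    exact hint.integral_prod_left
  have hfi' : Integrable f torusMeasure := by
    have := hfi.re
    simpa using this
  rw [← ofReal_integral_eq_lintegral_ofReal hfi' (Filter.Eventually.of_forall hf0)]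
  have h2 : ENNReal.ofReal (∫ k, f k ∂torusMeasure) = ‖∫ k, (f k : ℂ) ∂torusMeasure‖ₑ := by
    have h4 : ∫ k, (f k : ℂ) ∂torusMeasure = ((∫ k, f k ∂torusMeasure : ℝ) : ℂ) :=
      integral_ofReal
    have h5 : 0 ≤ ∫ k, f k ∂torusMeasure := integral_nonneg hf0
    rw [h4, ← ofReal_norm, Complex.norm_real, Real.norm_of_nonneg h5]
  rw [h2]
  simp only [hf]
  rw [integral_integral_swap hint]
  refine (enorm_integral_le_lintegral_enorm _).trans (lintegral_mono fun t => ?_)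
  simp only
  rw [integral_const_mul, enorm_mul, ← ofReal_norm (w t : ℂ), Complex.norm_real,
    Real.norm_of_nonneg (hw0 t)]

/-! ### Averages of one and of two resolvents -/

/-- The decay is weakened to (κ|x|)^(-a) with a < 1, which turns the integral into a Gamma integral.
Allowing a < b replaces the logarithm of the borderline case b = 1 by a small power of ε. -/
theorem lintegral_exp_mul_rpow_le {ε κ a b : ℝ} (hε : 0 < ε) (hκ : 0 < κ) (ha : 0 < a)
    (ha1 : a < 1) (hab : a ≤ b) :
    ∫⁻ x : ℝ, ENNReal.ofReal (Real.exp (-(ε / 2) * |x|) * (1 + κ * |x|) ^ (-b)) ≤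
      ENNReal.ofReal (2 * κ ^ (-a) * (2 / ε) ^ (1 - a) * Real.Gamma (1 - a)) := by
  have hG : 0 < Real.Gamma (1 - a) := Real.Gamma_pos_of_pos (by linarith)
  have hI := Real.integral_rpow_mul_exp_neg_mul_Ioi (a := 1 - a) (r := ε / 2) (by linarith)
    (by positivity)
  set g : ℝ → ℝ := fun t => t ^ ((1 - a) - 1) * Real.exp (-(ε / 2 * t)) with hg
  have hpos : 0 < (1 / (ε / 2)) ^ (1 - a) * Real.Gamma (1 - a) := by positivity
  have hgi : IntegrableOn g (Set.Ioi 0) := by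
    -- The integral of a nonintegrable function is 0 by convention, whereas the Gamma formula gives
    -- a positive value.
    by_contra h
    rw [integral_undef h] at hI
    exact hpos.ne hI
  have hgi' := (integrable_comp_abs hgi).const_mul (κ ^ (-a))
  calc _ ≤ ∫⁻ x : ℝ, ENNReal.ofReal (κ ^ (-a) * g |x|) := by
        apply lintegral_mono_ae
        have : ∀ᵐ x : ℝ, x ≠ 0 := by
          rw [ae_iff]; simp
        filter_upwards [this] with x hx
        apply ENNReal.ofReal_le_ofReal
        have hx' : 0 < |x| := abs_pos.2 hx
        have h1 : (1 + κ * |x|) ^ (-b) ≤ κ ^ (-a) * |x| ^ (-a) := by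
          rw [← Real.mul_rpow hκ.le hx'.le]
          calc (1 + κ * |x|) ^ (-b) ≤ (1 + κ * |x|) ^ (-a) :=
                Real.rpow_le_rpow_of_exponent_le (by nlinarith) (by linarith)
            _ ≤ (κ * |x|) ^ (-a) :=
                Real.rpow_le_rpow_of_nonpos (by positivity) (by linarith) (by linarith)
        simp only [hg]
        rw [show (1 - a) - 1 = -a by ring, neg_mul]
        nlinarith [Real.exp_pos (-(ε / 2 * |x|))]
    _ = ENNReal.ofReal (∫ x : ℝ, κ ^ (-a) * g |x|) := by
        rw [ofReal_integral_eq_lintegral_ofReal hgi'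
          (Filter.Eventually.of_forall fun x => ?_)]
        simp only [hg]; positivity
    _ = _ := by
        rw [integral_const_mul, integral_comp_abs, hI, one_div_div]
        congr 1; ring

/-- Rotation of the plane by 45 degrees, for functions that decrease away from the origin. -/
theorem lintegral_add_sub_le {U V : ℝ → ℝ≥0∞} (hU : Measurable U) (hV : Measurable V)
    (hV2 : ∀ x, V (2 * x) ≤ V x) :
    ∫⁻ z : ℝ × ℝ, U (z.1 + z.2) * V (z.1 - z.2) ≤ (∫⁻ x, U x) * ∫⁻ x, V x := by
  have hm : Measurable fun z : ℝ × ℝ => U (z.1 + z.2) * V (z.1 - z.2) := by fun_prop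
  rw [Measure.volume_eq_prod, lintegral_prod _ hm.aemeasurable]
  -- Replacing t by t - s turns s - t into 2 (s - t/2). After a translation in s the factor 2 is
  -- discarded by `hV2`, which takes the place of the Jacobian.
  have h1 : ∀ s : ℝ, ∫⁻ t : ℝ, U (s + t) * V (s - t) = ∫⁻ t : ℝ, U t * V (2 * (s - t / 2)) := by
    intro s
    rw [← lintegral_add_left_eq_self (fun t => U t * V (2 * (s - t / 2))) s]
    congr 1; funext t; congr 2; ring
  simp only [h1]
  rw [lintegral_lintegral_swap (by
    apply Measurable.aemeasurable
    unfold Function.uncurry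
    fun_prop), ← lintegral_mul_const _ hU]
  refine lintegral_mono fun t => ?_
  simp only
  rw [lintegral_const_mul _ (by fun_prop)]
  gcongr U t * ?_
  rw [lintegral_sub_right_eq_self (fun s => V (2 * s)) (t / 2)]
  exact lintegral_mono hV2

theorem integrable_exp_neg_abs {ρ : ℝ} (hρ : 0 < ρ) :
    Integrable fun s : ℝ => Real.exp (-ρ * |s|) :=
  integrable_comp_abs (f := fun s => Real.exp (-ρ * s)) (exp_neg_integrableOn_Ioi 0 hρ)

theorem measurable_kineticEnergy : Measurable kineticEnergy := continuous_kineticEnergy.measurable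

theorem lorentz_eq_integral {ρ : ℝ} (hρ : 0 < ρ) (x : ℝ) :
    (lorentz ρ x : ℂ)
      = ∫ s : ℝ, ((Real.exp (-ρ * |s|) / 2 : ℝ) : ℂ) * Complex.exp (I * (s * x : ℝ)) := by
  have h := integral_exp_neg_abs_mul_exp hρ x
  have h2 : ∀ s : ℝ, ((Real.exp (-ρ * |s|) / 2 : ℝ) : ℂ) * Complex.exp (I * (s * x : ℝ))
      = (1 / 2 : ℂ) * ((Real.exp (-ρ * |s|) : ℂ) * Complex.exp (I * (s * x : ℝ))) := by
    intro s; push_cast; ring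
  simp only [h2]
  rw [integral_const_mul, h]
  unfold lorentz
  push_cast
  ring

theorem norm_bessel_le_of_le {r x : ℝ} (hx : 0 ≤ x) (hr : x ≤ |r|) :
    ‖bessel r‖ ≤ 10 * (1 + x) ^ (-(1 / 2) : ℝ) := by
  refine (norm_bessel_le r).trans ?_
  gcongr ?_ * ?_
  exact Real.rpow_le_rpow_of_nonpos (by positivity) (by linarith) (by norm_num)

/-- In three dimensions the Fourier transform of the distribution of the energy is bounded by
|J₀(s)|³, hence by a multiple of (1 + |s|)^(-3/2). This is integrable, so the bound survives for
arbitrarily small width ρ. -/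
theorem lintegral_lorentz_kineticEnergy_le : ∃ B : ℝ, 0 < B ∧ ∀ (ρ a : ℝ), 0 < ρ →
    ∫⁻ k, ENNReal.ofReal (lorentz ρ (kineticEnergy k - a)) ∂torusMeasure ≤ ENNReal.ofReal B := by
  have hi : Integrable fun s : ℝ => (1 + ‖s‖) ^ (-(3 / 2) : ℝ) :=
    integrable_one_add_norm (by simp; norm_num)
  set M : ℝ := ∫ s : ℝ, (1 + ‖s‖) ^ (-(3 / 2) : ℝ) with hM
  have hM0 : 0 ≤ M := integral_nonneg fun s => by positivity
  refine ⟨1000 * M + 1, by positivity, fun ρ a hρ => ?_⟩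
  have hθ : Measurable fun z : Torus3 × ℝ => z.2 * (kineticEnergy z.1 - a) :=
    measurable_snd.mul ((measurable_kineticEnergy.comp measurable_fst).sub_const a)
  have h1 := lintegral_ofReal_le_of_eq_integral_exp (ν := (volume : Measure ℝ))
    (w := fun s => Real.exp (-ρ * |s|) / 2) ((integrable_exp_neg_abs hρ).div_const 2)
    (fun s => by positivity) hθ (f := fun k => lorentz ρ (kineticEnergy k - a))
    (fun k => lorentz_nonneg hρ.le _) (fun k => lorentz_eq_integral hρ _)
  refine h1.trans ?_
  have h2 : ∀ s : ℝ, ENNReal.ofReal (Real.exp (-ρ * |s|) / 2) *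
      ‖∫ k, Complex.exp (I * (s * (kineticEnergy k - a) : ℝ)) ∂torusMeasure‖ₑ
      ≤ ENNReal.ofReal (1000 * (1 + ‖s‖) ^ (-(3 / 2) : ℝ)) := by
    intro s
    have h3 := norm_integral_exp_energies s 0 a 0 0
    simp only [zero_mul, add_zero, Complex.ofReal_zero] at h3
    rw [← ofReal_norm, h3, ← ENNReal.ofReal_mul (by positivity)]
    apply ENNReal.ofReal_le_ofReal
    rw [Finset.prod_const, Finset.card_univ, Fintype.card_fin, Complex.norm_real]
    have h4 : ‖bessel ‖s‖‖ ≤ 10 * (1 + ‖s‖) ^ (-(1 / 2) : ℝ) :=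
      norm_bessel_le_of_le (norm_nonneg s) (by rw [abs_norm])
    have h5 : (10 * (1 + ‖s‖) ^ (-(1 / 2) : ℝ)) ^ 3 = 1000 * (1 + ‖s‖) ^ (-(3 / 2) : ℝ) := by
      rw [mul_pow, ← Real.rpow_natCast ((1 + ‖s‖) ^ (-(1 / 2) : ℝ)), ← Real.rpow_mul (by positivity)]
      norm_num
    have h6 : Real.exp (-ρ * |s|) / 2 ≤ 1 := by
      have : Real.exp (-ρ * |s|) ≤ 1 := Real.exp_le_one_iff.2 (by
        have := abs_nonneg s; nlinarith)
      linarith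
    calc Real.exp (-ρ * |s|) / 2 * ‖bessel ‖s‖‖ ^ 3
        ≤ 1 * (10 * (1 + ‖s‖) ^ (-(1 / 2) : ℝ)) ^ 3 := by gcongr
      _ = _ := by rw [one_mul, h5]
  refine (lintegral_mono h2).trans ?_
  rw [← ofReal_integral_eq_lintegral_ofReal (hi.const_mul 1000)
    (Filter.Eventually.of_forall fun s => by positivity), integral_const_mul]
  exact ENNReal.ofReal_le_ofReal (by linarith)

/-- Averages of a resolvent over the momentum are logarithmic, uniformly in the energy. -/
theorem lintegral_cutoffInv_kineticEnergy_le : ∃ K : ℝ, 0 < K ∧ ∀ (ε a : ℝ), 0 < ε → ε ≤ 1 / 3 →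
    ∫⁻ k, cutoffInv ε (kineticEnergy k - a) ∂torusMeasure
      ≤ ENNReal.ofReal (K * |Real.log ε|) := by
  obtain ⟨B, hB, h⟩ := lintegral_lorentz_kineticEnergy_le
  refine ⟨20 * B, by positivity, fun ε a hε hε3 => ?_⟩
  refine (lintegral_mono fun k => cutoffInv_le_clamp hε (kineticEnergy_nonneg k)
    (kineticEnergy_le k) a).trans ?_
  refine (lintegral_cutoffInv_le hε hε3 (measurable_kineticEnergy.sub_const _)
    (fun k => abs_sub_clamp_le (kineticEnergy_nonneg k) (kineticEnergy_le k) a)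
    (fun ρ hρ => h ρ _ (hε.trans_le hρ))).trans ?_
  rw [← ENNReal.ofReal_mul (by positivity)]
  exact ENNReal.ofReal_le_ofReal (by linarith)

/-- The shift `w` is not close to one of the two shifts that preserve the family of level sets. -/
def IsFar (δ : ℝ) (w : Torus3) : Prop :=
  (∃ j, δ ≤ ‖w j‖) ∧ ∃ j, δ ≤ ‖w j - halfPeriod‖

/-- Among three coordinates, P holds at two of them or Q does. If P holds at two, the third
satisfies Q, hence q, or else P holds at all three and any coordinate with q can be singled out. The
other case is symmetric. -/
theorem exists_distinguished_coordinate {p q P Q : Fin 3 → Prop} (hpq : ∀ j, P j ∨ Q j)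
    (hP : ∀ j, P j → p j) (hQ : ∀ j, Q j → q j) (hp : ∃ j, p j) (hq : ∃ j, q j) :
    ∃ i, (q i ∧ ∀ j, j ≠ i → P j) ∨ (p i ∧ ∀ j, j ≠ i → Q j) := by
  simp only [Fin.exists_fin_succ, Fin.forall_fin_succ, Fin.forall_fin_zero,
    Fin.exists_fin_zero] at *
  simp only [Fin.succ_zero_eq_one, Fin.succ_one_eq_two] at *
  grind

theorem prod_norm_bessel_le {r : Fin 3 → ℝ} {x y : ℝ} (hx : 0 ≤ x) (hy : 0 ≤ y) (i : Fin 3)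
    (hi : y ≤ |r i|) (hj : ∀ j, j ≠ i → x ≤ |r j|) :
    ∏ j, ‖bessel (r j)‖ ≤ 1000 * (1 + y) ^ (-(1 / 2) : ℝ) * (1 + x) ^ (-1 : ℝ) := by
  have h1 : ∀ j, ‖bessel (r j)‖ ≤
      if j = i then 10 * (1 + y) ^ (-(1 / 2) : ℝ) else 10 * (1 + x) ^ (-(1 / 2) : ℝ) := by
    intro j
    split_ifs with h
    · exact norm_bessel_le_of_le hy (h ▸ hi)
    · exact norm_bessel_le_of_le hx (hj j h)
  refine (Finset.prod_le_prod (fun j _ => norm_nonneg _) fun j _ => h1 j).trans (le_of_eq ?_)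
  have h2 : ((1 + x) ^ (-(1 / 2) : ℝ)) ^ 2 = (1 + x) ^ (-1 : ℝ) := by
    rw [← Real.rpow_natCast, ← Real.rpow_mul (by positivity)]
    norm_num
  rw [← h2, ← Finset.mul_prod_erase _ _ (Finset.mem_univ i), if_pos rfl,
    Finset.prod_congr rfl (g := fun _ => 10 * (1 + x) ^ (-(1 / 2) : ℝ))
      (fun j hj => if_neg (Finset.ne_of_mem_erase hj)), Finset.prod_const,
    Finset.card_erase_of_mem (Finset.mem_univ i)]
  simp only [Finset.card_univ, Fintype.card_fin]
  ring

/-- Since c² + s² = 1, in each coordinate the Bessel argument dominates half of |s₁ + s₂| or half of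
|s₁ - s₂|. As w is far, neither direction is missed by all coordinates: two coordinates give decay
in one direction, and the remaining one gives decay in the other with weight at least δ/2. Which
direction is the good one depends on w, hence the disjunction. -/
theorem prod_norm_bessel_shift_le {δ : ℝ} (hδ : 0 < δ) (hδ1 : δ ≤ 1) {w : Torus3}
    (hw : IsFar δ w) :
    (∀ s₁ s₂ : ℝ, ∏ j, ‖bessel ‖(s₁ + s₂ * ((AddCircle.toCircle (w j) : Circle) : ℂ) : ℂ)‖‖
      ≤ 1000 * (1 + δ / 2 * |s₁ - s₂|) ^ (-(1 / 2) : ℝ) * (1 + 1 / 2 * |s₁ + s₂|) ^ (-1 : ℝ)) ∨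
    (∀ s₁ s₂ : ℝ, ∏ j, ‖bessel ‖(s₁ + s₂ * ((AddCircle.toCircle (w j) : Circle) : ℂ) : ℂ)‖‖
      ≤ 1000 * (1 + δ / 2 * |s₁ + s₂|) ^ (-(1 / 2) : ℝ) * (1 + 1 / 2 * |s₁ - s₂|) ^ (-1 : ℝ)) := by
  choose c s hcs hs hc hr using fun j => exists_half_angle (w j)
  have hr1 : ∀ j (κ : ℝ), 0 ≤ κ → κ ≤ |c j| → ∀ s₁ s₂ : ℝ,
      κ * |s₁ + s₂| ≤ |‖(s₁ + s₂ * ((AddCircle.toCircle (w j) : Circle) : ℂ) : ℂ)‖| := by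
    intro j κ h0 hκ s₁ s₂
    rw [abs_norm]
    apply le_of_sq_le_sq _ (norm_nonneg _)
    rw [hr, mul_pow, sq_abs]
    have : κ ^ 2 ≤ c j ^ 2 := by rw [← sq_abs (c j)]; exact pow_le_pow_left₀ h0 hκ 2
    nlinarith [mul_nonneg (sq_nonneg (s₁ - s₂)) (sq_nonneg (s j)), sq_nonneg (s₁ + s₂)]
  have hr2 : ∀ j (κ : ℝ), 0 ≤ κ → κ ≤ |s j| → ∀ s₁ s₂ : ℝ,
      κ * |s₁ - s₂| ≤ |‖(s₁ + s₂ * ((AddCircle.toCircle (w j) : Circle) : ℂ) : ℂ)‖| := by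
    intro j κ h0 hκ s₁ s₂
    rw [abs_norm]
    apply le_of_sq_le_sq _ (norm_nonneg _)
    rw [hr, mul_pow, sq_abs]
    have : κ ^ 2 ≤ s j ^ 2 := by rw [← sq_abs (s j)]; exact pow_le_pow_left₀ h0 hκ 2
    nlinarith [mul_nonneg (sq_nonneg (s₁ + s₂)) (sq_nonneg (c j)), sq_nonneg (s₁ - s₂)]
  obtain ⟨i, ⟨hi, hj⟩ | ⟨hi, hj⟩⟩ := exists_distinguished_coordinate
    (P := fun j => 1 / 2 ≤ |c j|) (Q := fun j => 1 / 2 ≤ |s j|)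
    (p := fun j => δ / 2 ≤ |c j|) (q := fun j => δ / 2 ≤ |s j|)
    (fun j => by
      by_contra! h
      have h1 : c j ^ 2 < (1 / 2) ^ 2 := by
        rw [← sq_abs]; exact pow_lt_pow_left₀ h.1 (abs_nonneg _) two_ne_zero
      have h2 : s j ^ 2 < (1 / 2) ^ 2 := by
        rw [← sq_abs]; exact pow_lt_pow_left₀ h.2 (abs_nonneg _) two_ne_zero
      nlinarith [hcs j])
    (fun j h => by linarith) (fun j h => by linarith)
    (hw.2.imp fun j h => by linarith [hc j]) (hw.1.imp fun j h => by linarith [hs j])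
  · exact Or.inl fun s₁ s₂ => prod_norm_bessel_le (by positivity) (by positivity) i
      (hr2 i _ (by positivity) hi s₁ s₂)
      fun j hji => hr1 j _ (by norm_num) (hj j hji) s₁ s₂
  · exact Or.inr fun s₁ s₂ => prod_norm_bessel_le (by positivity) (by positivity) i
      (hr1 i _ (by positivity) hi s₁ s₂)
      fun j hji => hr2 j _ (by norm_num) (hj j hji) s₁ s₂

/-- In the variables s₁ + s₂ and s₁ - s₂ the decay (1 + |x|)^(-1) of one direction costs ε^(-1/10)
(a crude substitute for a logarithm), and the decay (1 + δ|x|)^(-1/2) of the other costs δ^(-1/2)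
ε^(-1/2) = ε^(-7/10). The product is ε^(-4/5). -/
theorem lintegral_lorentz_mul_lorentz_le : ∃ B : ℝ, 0 < B ∧ ∀ (ε ρ₁ ρ₂ a b : ℝ) (w : Torus3),
    0 < ε → ε ≤ 1 → ε ≤ ρ₁ → ε ≤ ρ₂ → IsFar (ε ^ (2 / 5 : ℝ)) w →
    ∫⁻ k, ENNReal.ofReal (lorentz ρ₁ (kineticEnergy k - a))
      * ENNReal.ofReal (lorentz ρ₂ (kineticEnergy (k + w) - b)) ∂torusMeasure
      ≤ ENNReal.ofReal (B * ε ^ (-(4 / 5) : ℝ)) := by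
  set G₁ : ℝ := 2 * (1 / 2) ^ (-(9 / 10) : ℝ) * 2 ^ (1 - 9 / 10 : ℝ) * Real.Gamma (1 - 9 / 10) with hG₁
  set G₂ : ℝ := 2 * (1 / 2) ^ (-(1 / 2) : ℝ) * 2 ^ (1 - 1 / 2 : ℝ) * Real.Gamma (1 - 1 / 2) with hG₂
  have hG1 : 0 < G₁ := by
    have := Real.Gamma_pos_of_pos (show (0 : ℝ) < 1 - 9 / 10 by norm_num)
    positivity
  have hG2 : 0 < G₂ := by
    have := Real.Gamma_pos_of_pos (show (0 : ℝ) < 1 - 1 / 2 by norm_num)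
    positivity
  refine ⟨1000 * (G₁ * G₂), by positivity, fun ε ρ₁ ρ₂ a b w hε hε1 hρ₁ hρ₂ hw => ?_⟩
  have h1 : 0 < ρ₁ := hε.trans_le hρ₁
  have h2 : 0 < ρ₂ := hε.trans_le hρ₂
  set δ : ℝ := ε ^ (2 / 5 : ℝ) with hδ
  have hδ0 : 0 < δ := Real.rpow_pos_of_pos hε _
  have hδ1 : δ ≤ 1 := Real.rpow_le_one hε.le hε1 (by norm_num)
  have hθ : Measurable fun z : Torus3 × (ℝ × ℝ) =>
      z.2.1 * (kineticEnergy z.1 - a) + z.2.2 * (kineticEnergy (z.1 + w) - b) := by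
    have m1 := measurable_kineticEnergy.comp (measurable_fst : Measurable (Prod.fst : Torus3 × (ℝ × ℝ) → _))
    have m2 : Measurable fun z : Torus3 × (ℝ × ℝ) => kineticEnergy (z.1 + w) :=
      measurable_kineticEnergy.comp (measurable_fst.add_const w)
    exact (measurable_snd.fst.mul (m1.sub_const a)).add
      (measurable_snd.snd.mul (m2.sub_const b))
  set W : ℝ × ℝ → ℝ := fun t => (Real.exp (-ρ₁ * |t.1|) / 2) * (Real.exp (-ρ₂ * |t.2|) / 2) with hW
  have hW0 : ∀ t, 0 ≤ W t := fun t => by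
    simp only [hW]; positivity
  have hWi : Integrable W := by
    have := ((integrable_exp_neg_abs h1).div_const 2).mul_prod
      ((integrable_exp_neg_abs h2).div_const 2)
    exact this
  have e1 := lintegral_ofReal_le_of_eq_integral_exp (ν := (volume : Measure (ℝ × ℝ)))
    (w := W) hWi hW0 hθ
    (f := fun k => lorentz ρ₁ (kineticEnergy k - a) * lorentz ρ₂ (kineticEnergy (k + w) - b))
    (fun k => mul_nonneg (lorentz_nonneg h1.le _) (lorentz_nonneg h2.le _)) (fun k => by
      rw [Complex.ofReal_mul, lorentz_eq_integral h1, lorentz_eq_integral h2, ← integral_prod_mul]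
      congr 1
      funext t
      simp only [hW]
      rw [mul_mul_mul_comm, ← Complex.exp_add, ← mul_add, ← Complex.ofReal_add,
        ← Complex.ofReal_mul])
  have e2 : ∫⁻ k, ENNReal.ofReal (lorentz ρ₁ (kineticEnergy k - a))
      * ENNReal.ofReal (lorentz ρ₂ (kineticEnergy (k + w) - b)) ∂torusMeasure
      = ∫⁻ k, ENNReal.ofReal (lorentz ρ₁ (kineticEnergy k - a)
        * lorentz ρ₂ (kineticEnergy (k + w) - b)) ∂torusMeasure := by
    congr 1; funext k
    rw [ENNReal.ofReal_mul (lorentz_nonneg h1.le _)]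
  rw [e2]
  refine e1.trans ?_
  simp only [← ofReal_norm, norm_integral_exp_energies]
  set U : ℝ → ℝ≥0∞ := fun x =>
    ENNReal.ofReal (Real.exp (-(ε / 2) * |x|) * (1 + 1 / 2 * |x|) ^ (-1 : ℝ)) with hU
  set V : ℝ → ℝ≥0∞ := fun x =>
    ENNReal.ofReal (Real.exp (-(ε / 2) * |x|) * (1 + δ / 2 * |x|) ^ (-(1 / 2) : ℝ)) with hV
  have hUm : Measurable U := by
    simp only [hU]
    fun_prop
  have hVm : Measurable V := by
    simp only [hV]
    fun_prop
  have hanti : ∀ (κ b x : ℝ), 0 < κ → 0 ≤ b →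
      ENNReal.ofReal (Real.exp (-(ε / 2) * |2 * x|) * (1 + κ * |2 * x|) ^ (-b))
        ≤ ENNReal.ofReal (Real.exp (-(ε / 2) * |x|) * (1 + κ * |x|) ^ (-b)) := by
    intro κ b x hκ hb
    apply ENNReal.ofReal_le_ofReal
    have hx : |x| ≤ |2 * x| := by
      rw [abs_mul, abs_two]; linarith [abs_nonneg x]
    apply mul_le_mul _ _ (by positivity) (by positivity)
    · apply Real.exp_le_exp.2
      nlinarith
    · apply Real.rpow_le_rpow_of_nonpos (by positivity) _ (by linarith)
      gcongr
  -- The rate ε/2 comes from |t₁ + t₂| + |t₁ - t₂| ≤ 2 (|t₁| + |t₂|).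
  have hexp : ∀ t : ℝ × ℝ, W t ≤
      Real.exp (-(ε / 2) * |t.1 + t.2|) * Real.exp (-(ε / 2) * |t.1 - t.2|) := by
    intro t
    have q1 : Real.exp (-ρ₁ * |t.1|) ≤ Real.exp (-ε * |t.1|) :=
      Real.exp_le_exp.2 (by nlinarith [abs_nonneg t.1])
    have q2 : Real.exp (-ρ₂ * |t.2|) ≤ Real.exp (-ε * |t.2|) :=
      Real.exp_le_exp.2 (by nlinarith [abs_nonneg t.2])
    calc W t ≤ Real.exp (-ρ₁ * |t.1|) * Real.exp (-ρ₂ * |t.2|) := by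
          simp only [hW]
          have := Real.exp_pos (-ρ₁ * |t.1|)
          have := Real.exp_pos (-ρ₂ * |t.2|)
          apply mul_le_mul <;> linarith
      _ ≤ Real.exp (-ε * |t.1|) * Real.exp (-ε * |t.2|) := by gcongr
      _ ≤ _ := by
          rw [← Real.exp_add, ← Real.exp_add]
          apply Real.exp_le_exp.2
          have := abs_add_le t.1 t.2
          have := abs_sub t.1 t.2
          nlinarith
  have hδ12 : δ ^ (-(1 / 2) : ℝ) = ε ^ (-(1 / 5) : ℝ) := by
    rw [hδ, ← Real.rpow_mul hε.le]; norm_num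
  have hUi : ∫⁻ x, U x ≤ ENNReal.ofReal (G₁ * ε ^ (-(1 / 10) : ℝ)) := by
    refine (lintegral_exp_mul_rpow_le (a := 9 / 10) (b := 1) hε (by norm_num) (by norm_num)
      (by norm_num) (by norm_num)).trans (ENNReal.ofReal_le_ofReal (le_of_eq ?_))
    rw [hG₁, Real.div_rpow (by norm_num) hε.le, div_eq_mul_inv _ (ε ^ _), ← Real.rpow_neg hε.le]
    norm_num
    ring
  have hVi : ∫⁻ x, V x ≤ ENNReal.ofReal (G₂ * ε ^ (-(7 / 10) : ℝ)) := by
    refine (lintegral_exp_mul_rpow_le (a := 1 / 2) (b := 1 / 2) hε (by positivity) (by norm_num)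
      (by norm_num) (by norm_num)).trans (ENNReal.ofReal_le_ofReal (le_of_eq ?_))
    rw [hG₂, Real.div_rpow (by norm_num) hε.le, div_eq_mul_inv _ (ε ^ _), ← Real.rpow_neg hε.le,
      show δ / 2 = δ * (1 / 2) by ring, Real.mul_rpow hδ0.le (by norm_num), hδ12]
    have : ε ^ (-(7 / 10) : ℝ) = ε ^ (-(1 / 5) : ℝ) * ε ^ (-(1 - 1 / 2) : ℝ) := by
      rw [← Real.rpow_add hε]; norm_num
    rw [this]
    ring
  have hprod : 1000 * (ENNReal.ofReal (G₁ * ε ^ (-(1 / 10) : ℝ))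
      * ENNReal.ofReal (G₂ * ε ^ (-(7 / 10) : ℝ)))
      = ENNReal.ofReal (1000 * (G₁ * G₂) * ε ^ (-(4 / 5) : ℝ)) := by
    rw [← ENNReal.ofReal_mul (by positivity),
      show (1000 : ℝ≥0∞) = ENNReal.ofReal 1000 by simp, ← ENNReal.ofReal_mul (by norm_num)]
    congr 1
    have : ε ^ (-(4 / 5) : ℝ) = ε ^ (-(1 / 10) : ℝ) * ε ^ (-(7 / 10) : ℝ) := by
      rw [← Real.rpow_add hε]; norm_num
    rw [this]; ring
  rw [← hprod]
  rcases prod_norm_bessel_shift_le hδ0 hδ1 hw with h | h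
  · calc _ ≤ ∫⁻ t : ℝ × ℝ, 1000 * (U (t.1 + t.2) * V (t.1 - t.2)) := by
          refine lintegral_mono fun t => ?_
          have hb := h t.1 t.2
          change ENNReal.ofReal (W t) * ENNReal.ofReal _ ≤
            1000 * (ENNReal.ofReal _ * ENNReal.ofReal _)
          rw [← ENNReal.ofReal_mul (hW0 t), ← ENNReal.ofReal_mul (by positivity), show (1000 : ℝ≥0∞) = ENNReal.ofReal 1000 by simp,
            ← ENNReal.ofReal_mul (by norm_num)]
          apply ENNReal.ofReal_le_ofReal
          refine (mul_le_mul (hexp t) hb (Finset.prod_nonneg fun _ _ => norm_nonneg _)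
            (by positivity)).trans (le_of_eq ?_)
          ring
      _ ≤ _ := by
          rw [lintegral_const_mul' _ _ (by simp)]
          gcongr
          exact (lintegral_add_sub_le hUm hVm fun x => hanti _ _ x (by positivity)
            (by norm_num)).trans (mul_le_mul' hUi hVi)
  · calc _ ≤ ∫⁻ t : ℝ × ℝ, 1000 * (V (t.1 + t.2) * U (t.1 - t.2)) := by
          refine lintegral_mono fun t => ?_
          have hb := h t.1 t.2
          change ENNReal.ofReal (W t) * ENNReal.ofReal _ ≤
            1000 * (ENNReal.ofReal _ * ENNReal.ofReal _)
          rw [← ENNReal.ofReal_mul (hW0 t), ← ENNReal.ofReal_mul (by positivity), show (1000 : ℝ≥0∞) = ENNReal.ofReal 1000 by simp,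
            ← ENNReal.ofReal_mul (by norm_num)]
          apply ENNReal.ofReal_le_ofReal
          refine (mul_le_mul (hexp t) hb (Finset.prod_nonneg fun _ _ => norm_nonneg _)
            (by positivity)).trans (le_of_eq ?_)
          ring
      _ ≤ _ := by
          rw [lintegral_const_mul' _ _ (by simp), mul_comm (ENNReal.ofReal (G₁ * _))]
          gcongr
          exact (lintegral_add_sub_le hVm hUm fun x => hanti _ _ x (by positivity)
            (by norm_num)).trans (mul_le_mul' hVi hUi)

/-- Two resolvents whose momenta differ by a generic shift. -/
theorem lintegral_cutoffInv_mul_cutoffInv_le : ∃ K : ℝ, 0 < K ∧ ∀ (ε a b : ℝ) (w : Torus3),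
    0 < ε → ε ≤ 1 / 3 → IsFar (ε ^ (2 / 5 : ℝ)) w →
    ∫⁻ k, cutoffInv ε (kineticEnergy k - a) * cutoffInv ε (kineticEnergy (k + w) - b)
      ∂torusMeasure ≤ ENNReal.ofReal (K * |Real.log ε| ^ 2 * ε ^ (-(4 / 5) : ℝ)) := by
  obtain ⟨B, hB, h⟩ := lintegral_lorentz_mul_lorentz_le
  refine ⟨400 * B, by positivity, fun ε a b w hε hε3 hw => ?_⟩
  set a' := max (-1) (min a 7)
  set b' := max (-1) (min b 7)
  have m1 : Measurable fun k => kineticEnergy k - a' := measurable_kineticEnergy.sub_const _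
  have m2 : Measurable fun k => kineticEnergy (k + w) - b' :=
    (measurable_kineticEnergy.comp (measurable_id.add_const w)).sub_const _
  have m3 : ∀ ρ, Measurable fun k => ENNReal.ofReal (lorentz ρ (kineticEnergy k - a')) := by
    intro ρ
    exact (measurable_lorentz.comp (measurable_const.prodMk m1)).ennreal_ofReal
  calc _ ≤ ∫⁻ k, cutoffInv ε (kineticEnergy k - a') * cutoffInv ε (kineticEnergy (k + w) - b')
        ∂torusMeasure := lintegral_mono fun k => mul_le_mul'
          (cutoffInv_le_clamp hε (kineticEnergy_nonneg _) (kineticEnergy_le _) _)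
          (cutoffInv_le_clamp hε (kineticEnergy_nonneg _) (kineticEnergy_le _) _)
    _ ≤ ENNReal.ofReal (20 * |Real.log ε|) * (ENNReal.ofReal (20 * |Real.log ε|)
        * ENNReal.ofReal (B * ε ^ (-(4 / 5) : ℝ))) := by
        -- The resolvents are replaced by Lorentzians one at a time, the other factor serving as the
        -- weight `W`.
        refine lintegral_cutoffInv_mul_le hε hε3 m1
          (fun k => abs_sub_clamp_le (kineticEnergy_nonneg _) (kineticEnergy_le _) a)
          ((measurable_cutoffInv ε).comp m2) fun ρ hρ => ?_
        simp only [Function.comp]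
        have := lintegral_cutoffInv_mul_le (μ := torusMeasure) hε hε3 m2
          (fun k => abs_sub_clamp_le (kineticEnergy_nonneg _) (kineticEnergy_le _) b)
          (W := fun k => ENNReal.ofReal (lorentz ρ (kineticEnergy k - a'))) (m3 ρ)
          (B := ENNReal.ofReal (B * ε ^ (-(4 / 5) : ℝ))) (fun ρ' hρ' => by
            refine le_trans (le_of_eq ?_) (h ε ρ ρ' a' b' w hε (by linarith) hρ hρ' hw)
            congr 1; funext k; rw [mul_comm])
        refine le_trans (le_of_eq ?_) this
        congr 1; funext k; rw [mul_comm]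
    _ = _ := by
        rw [← ENNReal.ofReal_mul (by positivity), ← ENNReal.ofReal_mul (by positivity)]
        congr 1; ring

/-! ### Energies on the torus, small cubes, successive integration -/

theorem lintegral_add_units_smul (F : Torus3 → ℝ≥0∞) (c : Torus3) (s : ℤˣ) :
    ∫⁻ t, F (c + (s : ℤ) • t) ∂torusMeasure = ∫⁻ t, F t ∂torusMeasure := by
  rcases Int.units_eq_one_or s with rfl | rfl
  · simpa using lintegral_add_left_eq_self (μ := torusMeasure) F c
  · have : torusMeasure.IsNegInvariant :=
      ⟨(measurePreserving_pi _ _ fun _ : Fin 3 =>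
        Measure.measurePreserving_neg AddCircle.haarAddCircle).map_eq⟩
    simpa [← sub_eq_add_neg] using lintegral_sub_left_eq_self (μ := torusMeasure) F c

/-- The energies in `[-1, 7]`, parametrized by the torus. -/
noncomputable def energyOf (y : Torus3) : ℝ :=
  -1 + 8 * (AddCircle.measurableEquivIoc 1 0 (y 0) : ℝ)

/-- The energies are integrated over the same probability space as the momenta, so that all
variables together form one power of the torus. Only the first coordinate of the torus matters for
an energy. -/
theorem measurePreserving_unitRep : MeasurePreserving
    (fun y : Torus3 => (AddCircle.measurableEquivIoc 1 0 (y 0) : ℝ)) torusMeasure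
    (volume.restrict (Set.Ioc (0 : ℝ) 1)) := by
  have h1 : MeasurePreserving (fun y : Torus3 => y 0) torusMeasure
      (volume : Measure UnitAddCircle) := by
    rw [volume_unitAddCircle_eq_haar]
    exact measurePreserving_eval _ 0
  have h2 := AddCircle.measurePreserving_equivIoc 1 (a := 0)
  have h3 := measurePreserving_subtype_coe (μa := (volume : Measure ℝ))
    (measurableSet_Ioc (a := (0 : ℝ)) (b := 0 + 1))
  have h4 : (volume : Measure ℝ).restrict (Set.Ioc 0 1) = volume.restrict (Set.Ioc 0 (0 + 1)) := by
    rw [zero_add]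
  rw [h4]
  exact h3.comp (h2.comp h1)

theorem measurable_energyOf : Measurable energyOf :=
  (measurePreserving_unitRep.measurable.const_mul 8).const_add (-1)

theorem lintegral_comp_energyOf {F : ℝ → ℝ≥0∞} (hF : Measurable F) :
    ∫⁻ y, F (energyOf y) ∂torusMeasure = ∫⁻ s in Set.Ioc (0 : ℝ) 1, F (-1 + 8 * s) :=
  measurePreserving_unitRep.lintegral_comp (f := fun s => F (-1 + 8 * s)) (by fun_prop)

theorem energyOf_mem (y : Torus3) : -1 ≤ energyOf y ∧ energyOf y ≤ 7 := by
  have h := (AddCircle.measurableEquivIoc 1 0 (y 0)).2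
  have h1 := h.1
  have h2 := h.2
  unfold energyOf
  constructor <;> linarith

theorem lintegral_cutoffInv_energyOf_le {ε x : ℝ} (hε : 0 < ε) (hε3 : ε ≤ 1 / 3) (h0 : 0 ≤ x)
    (h6 : x ≤ 6) : ∫⁻ y, cutoffInv ε (x - energyOf y) ∂torusMeasure
      ≤ ENNReal.ofReal (20 * |Real.log ε|) := by
  have := lintegral_cutoffInv_le (μ := torusMeasure) hε hε3 (f := fun y => x - energyOf y)
    (measurable_energyOf.const_sub x) (fun y => by
      have := energyOf_mem y
      rw [abs_le]; constructor <;> linarith) (B := 1) (fun ρ hρ => by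
      rw [lintegral_comp_energyOf (F := fun a => ENNReal.ofReal (lorentz ρ (x - a)))]
      · exact lintegral_lorentz_interval_le (hε.trans_le hρ) x
      · exact (measurable_lorentz.comp
          (measurable_const.prodMk (measurable_id.const_sub x))).ennreal_ofReal)
  simpa using this

/-- A cube in the torus. -/
def cube (c : Torus3) (δ : ℝ) : Set Torus3 := {k | ∀ j, ‖k j - c j‖ < δ}

theorem cube_eq (c : Torus3) (δ : ℝ) : cube c δ = Set.univ.pi fun j => Metric.ball (c j) δ := by
  ext k; simp [cube, Set.mem_pi, dist_eq_norm]

theorem torusMeasure_cube_le (c : Torus3) {δ : ℝ} (hδ : 0 ≤ δ) :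
    torusMeasure (cube c δ) ≤ ENNReal.ofReal (8 * δ ^ 3) := by
  rw [cube_eq, Measure.pi_pi]
  have : ∀ j : Fin 3, AddCircle.haarAddCircle (Metric.ball (c j) δ) ≤ ENNReal.ofReal (2 * δ) := by
    intro j
    refine (measure_mono Metric.ball_subset_closedBall).trans ?_
    rw [← volume_unitAddCircle_eq_haar, AddCircle.volume_closedBall]
    exact ENNReal.ofReal_le_ofReal (min_le_right _ _)
  refine (Finset.prod_le_prod' fun j _ => this j).trans (le_of_eq ?_)
  rw [Finset.prod_const, ← ENNReal.ofReal_pow (by positivity)]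
  simp only [Finset.card_univ, Fintype.card_fin]
  congr 1; ring

/-- Variables are integrated out one after the other, in decreasing order of the rank. -/
theorem lmarginal_prod_le {ι X : Type*} [DecidableEq ι] [MeasurableSpace X]
    {μ : Measure X} [IsProbabilityMeasure μ] (rk : ι → ℕ) (hrk : Function.Injective rk)
    (f : ι → (ι → X) → ℝ≥0∞) (hf : ∀ i, Measurable (f i))
    (hdep : ∀ i, DependsOn (f i) {j | rk j ≤ rk i}) (C : ι → ℝ≥0∞)
    (hC : ∀ i y, ∫⁻ t, f i (Function.update y i t) ∂μ ≤ C i) (s : Finset ι) (y : ι → X) :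
    lmarginal (fun _ => μ) s (fun y => ∏ i ∈ s, f i y) y ≤ ∏ i ∈ s, C i := by
  induction s using Finset.induction_on_max_value rk generalizing y with
  | empty => simp
  | insert a s ha hmax ih =>
    have hm : Measurable fun y => ∏ i ∈ insert a s, f i y :=
      Finset.measurable_fun_prod _ fun i _ => hf i
    rw [lmarginal_insert' _ hm ha, Finset.prod_insert ha]
    have h1 : ∀ y : ι → X, ∫⁻ t, ∏ i ∈ insert a s, f i (Function.update y a t) ∂μ
        ≤ C a * ∏ i ∈ s, f i y := by
      intro y
      have h2 : ∀ t, ∏ i ∈ insert a s, f i (Function.update y a t)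
          = f a (Function.update y a t) * ∏ i ∈ s, f i y := by
        intro t
        rw [Finset.prod_insert ha]
        congr 1
        refine Finset.prod_congr rfl fun i hi => ?_
        refine hdep i fun j hj => ?_
        have hja : j ≠ a := by
          rintro rfl
          have h3 : rk j ≤ rk i := hj
          exact ha (hrk (le_antisymm h3 (hmax i hi)) ▸ hi)
        rw [Function.update_of_ne hja]
      simp only [h2]
      have hma : Measurable fun t => f a (Function.update y a t) :=
        (hf a).comp (measurable_update y)
      rw [lintegral_mul_const _ hma]
      exact mul_le_mul_left (hC a y) _
    have hm2 : Measurable fun y => ∏ i ∈ s, f i y := Finset.measurable_fun_prod _ fun i _ => hf i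
    calc _ ≤ lmarginal (fun _ => μ) s (fun y => C a * ∏ i ∈ s, f i y) y :=
          lmarginal_mono h1 y
      _ = C a * lmarginal (fun _ => μ) s (fun y => ∏ i ∈ s, f i y) y := by
          simp only [lmarginal]
          rw [lintegral_const_mul]
          exact hm2.comp measurable_updateFinset
      _ ≤ _ := by gcongr; exact ih y

theorem lintegral_prod_le {ι X : Type*} [Fintype ι] [MeasurableSpace X]
    {μ : Measure X} [IsProbabilityMeasure μ] (rk : ι → ℕ) (hrk : Function.Injective rk)
    (f : ι → (ι → X) → ℝ≥0∞) (hf : ∀ i, Measurable (f i))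
    (hdep : ∀ i, DependsOn (f i) {j | rk j ≤ rk i}) (C : ι → ℝ≥0∞)
    (hC : ∀ i (y : ι → X) [DecidableEq ι], ∫⁻ t, f i (Function.update y i t) ∂μ ≤ C i) :
    ∫⁻ y, ∏ i, f i y ∂(Measure.pi fun _ => μ) ≤ ∏ i, C i := by
  classical
  by_cases hX : Nonempty (ι → X)
  · obtain ⟨y⟩ := hX
    rw [lintegral_eq_lmarginal_univ y]
    exact lmarginal_prod_le rk hrk f hf hdep C (fun i y => hC i y) _ y
  · have : IsEmpty (ι → X) := not_nonempty_iff.1 hX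
    rw [lintegral_of_isEmpty]
    exact zero_le

/-! ### Diagrams and the triangular dependence of their resolvents -/

theorem pos_lt_pos {g n : ℕ} {i i' : Fin n} : pos g i < pos g i' ↔ i < i' := by
  unfold pos
  rw [Fin.lt_def]
  split_ifs <;> omega

theorem pos_lt {g n : ℕ} (i : Fin n) : pos g i < n + 1 := by
  unfold pos; split_ifs <;> omega

theorem pos_ne_gap {g n : ℕ} (i : Fin n) : pos g i ≠ g := by
  unfold pos; split_ifs <;> omega

/-- Two lines with paired interactions, each line read in one of its two directions. The line `j`
has its gap after `gap j` interactions; the interaction `b` changes the momentum by `sign b` times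
the variable `edge b`; `flip j` records the direction. -/
structure Diagram (n : ℕ) (C : Type*) where
  /-- Number of interactions before the gap. -/
  gap : Fin 2 → ℕ
  gap_le : ∀ j, gap j ≤ n
  /-- Whether the line is read backwards. -/
  flip : Fin 2 → Bool
  /-- The contraction to which an interaction belongs. -/
  edge : Fin 2 × Fin n → C
  /-- The sign with which the variable of the contraction enters. -/
  sign : Fin 2 × Fin n → ℤˣ
  /-- The other end of the contraction. -/
  partner : Fin 2 × Fin n → Fin 2 × Fin n
  partner_partner : ∀ b, partner (partner b) = b
  partner_ne : ∀ b, partner b ≠ b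
  edge_eq : ∀ b b', edge b = edge b' ↔ b' = b ∨ b' = partner b
  edge_surj : Function.Surjective edge
  sign_partner : ∀ b, (partner b).1 = b.1 → sign (partner b) = -sign b
  no_transfer_inside : ∀ (j : Fin 2) (a b c : Fin n), a < b → b < c →
    partner (j, a) = (j, c) → (partner (j, b)).1 = j

namespace Diagram

variable {n : ℕ} {C : Type*} (D : Diagram n C)

/-- The integration variables: four energies, and one momentum for each contraction. -/
abbrev Var (C : Type*) : Type _ := (Fin 2 × Bool) ⊕ C

/-- The resolvents of a diagram. -/
abbrev Slot (n : ℕ) : Type := Fin 2 × Fin (n + 2)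

/-- The momentum transferred at an interaction. -/
noncomputable def jump (y : Var C → Torus3) (b : Fin 2 × Fin n) : Torus3 :=
  (D.sign b : ℤ) • y (Sum.inr (D.edge b))

/-- The momentum in position `l` of the line `j`. -/
noncomputable def mom (x ζ : Fin 2 → Torus3) (y : Var C → Torus3) (j : Fin 2) (l : ℕ) : Torus3 :=
  x j + ∑ i : Fin n, (if pos (D.gap j) i < l then D.jump y (j, i) else 0)
    + (if D.gap j < l then ζ j else 0)

/-- The energy in position `l` of the line `j`. -/
noncomputable def energy (y : Var C → Torus3) (j : Fin 2) (l : ℕ) : ℝ :=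
  energyOf (y (Sum.inl (j, xor (D.flip j) (decide (D.gap j < l)))))

/-- The size of a resolvent. -/
noncomputable def res (ε : ℝ) (x ζ : Fin 2 → Torus3) (y : Var C → Torus3) (s : Slot n) : ℝ≥0∞ :=
  cutoffInv ε (kineticEnergy (D.mom x ζ y s.1 s.2) - D.energy y s.1 s.2)

theorem mom_congr (x ζ : Fin 2 → Torus3) {y y' : Var C → Torus3} {j : Fin 2} {l : ℕ}
    (h : ∀ i, pos (D.gap j) i < l →
      y (Sum.inr (D.edge (j, i))) = y' (Sum.inr (D.edge (j, i)))) :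
    D.mom x ζ y j l = D.mom x ζ y' j l := by
  unfold mom
  congr 2
  refine Finset.sum_congr rfl fun i _ => ?_
  split_ifs with h3
  · rw [jump, jump, h i h3]
  · rfl

theorem res_congr (ε : ℝ) (x ζ : Fin 2 → Torus3) {y y' : Var C → Torus3} {s : Slot n}
    (h : ∀ i, pos (D.gap s.1) i < s.2 →
      y (Sum.inr (D.edge (s.1, i))) = y' (Sum.inr (D.edge (s.1, i))))
    (hE : y (Sum.inl (s.1, xor (D.flip s.1) (decide (D.gap s.1 < s.2))))
      = y' (Sum.inl (s.1, xor (D.flip s.1) (decide (D.gap s.1 < s.2))))) :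
    D.res ε x ζ y s = D.res ε x ζ y' s := by
  rw [res, res, D.mom_congr x ζ h, energy, energy, hE]

theorem jump_partner (y : Var C → Torus3) {b : Fin 2 × Fin n} (h : (D.partner b).1 = b.1) :
    D.jump y (D.partner b) = -D.jump y b := by
  have h1 : D.edge (D.partner b) = D.edge b := ((D.edge_eq _ _).2 (Or.inr rfl)).symm
  rw [jump, jump, D.sign_partner b h, h1]
  push_cast
  rw [neg_smul]

/-- The two ends of an internal contraction carry opposite jumps, so passing to the partner is a
sign-reversing involution without fixed points. -/
theorem sum_jump_eq_zero_of_closed (y : Var C → Torus3) (j : Fin 2) (s : Finset (Fin n))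
    (hs : ∀ i ∈ s, ∃ c ∈ s, D.partner (j, i) = (j, c)) : ∑ i ∈ s, D.jump y (j, i) = 0 := by
  have hi : ∀ i ∈ s, D.partner (j, i) = (j, (D.partner (j, i)).2) := by
    intro i h
    obtain ⟨c, -, hc⟩ := hs i h
    rw [hc]
  refine Finset.sum_involution (fun i _ => (D.partner (j, i)).2) ?_ ?_ ?_ ?_
  · intro i h
    have h1 := D.jump_partner y (b := (j, i)) (by rw [hi i h])
    rw [hi i h] at h1
    rw [h1, add_neg_cancel]
  · intro i h _ h2
    have h3 := hi i h
    rw [h2] at h3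
    exact D.partner_ne _ h3
  · intro i h
    obtain ⟨c, hc, hc'⟩ := hs i h
    rw [hc']
    exact hc
  · intro i h
    have h3 := D.partner_partner (j, i)
    rw [hi i h] at h3
    simp only [h3]

/-- An internal contraction with one end to the left of `a` has its other end there too, as it may
not enclose the transfer end `a`. The interactions to the left of `a` therefore cancel in pairs. -/
theorem sum_jump_before_eq_zero (y : Var C → Torus3) (j : Fin 2) {a : Fin n}
    (ha : (D.partner (j, a)).1 ≠ j) (hlt : ∀ i < a, (D.partner (j, i)).1 = j) :
    ∑ i, (if i < a then D.jump y (j, i) else 0) = 0 := by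
  rw [← Finset.sum_filter]
  apply D.sum_jump_eq_zero_of_closed
  intro i hi
  rw [Finset.mem_filter] at hi
  have h1 : D.partner (j, i) = (j, (D.partner (j, i)).2) := Prod.ext (hlt i hi.2) rfl
  refine ⟨_, ?_, h1⟩
  rw [Finset.mem_filter]
  refine ⟨Finset.mem_univ _, ?_⟩
  by_contra h
  rcases (not_lt.1 h).lt_or_eq with h2 | h2
  · exact ha (D.no_transfer_inside j i a _ hi.2 h2 h1)
  · have h3 := D.partner_partner (j, i)
    rw [h1, ← h2] at h3
    exact ha (congrArg Prod.fst h3)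

theorem sum_jump_after_eq_zero (y : Var C → Torus3) (j : Fin 2) {a : Fin n}
    (ha : (D.partner (j, a)).1 ≠ j) (hgt : ∀ i, a < i → (D.partner (j, i)).1 = j) :
    ∑ i, (if a < i then D.jump y (j, i) else 0) = 0 := by
  rw [← Finset.sum_filter]
  apply D.sum_jump_eq_zero_of_closed
  intro i hi
  rw [Finset.mem_filter] at hi
  have h1 : D.partner (j, i) = (j, (D.partner (j, i)).2) := Prod.ext (hgt i hi.2) rfl
  refine ⟨_, ?_, h1⟩
  rw [Finset.mem_filter]
  refine ⟨Finset.mem_univ _, ?_⟩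
  have h3 := D.partner_partner (j, i)
  rw [h1] at h3
  by_contra h
  rcases (not_lt.1 h).lt_or_eq with h2 | h2
  · exact ha (D.no_transfer_inside j _ a i h2 hi.2 h3)
  · rw [h2] at h3
    exact ha (congrArg Prod.fst h3)

theorem continuous_jump (b : Fin 2 × Fin n) : Continuous fun y : Var C → Torus3 => D.jump y b := by
  unfold jump
  exact (continuous_apply (Sum.inr (D.edge b))).const_smul (D.sign b : ℤ)

theorem continuous_mom (x ζ : Fin 2 → Torus3) (j : Fin 2) (l : ℕ) :
    Continuous fun y : Var C → Torus3 => D.mom x ζ y j l := by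
  unfold mom
  refine (continuous_const.add (continuous_finsetSum _ fun i _ => ?_)).add continuous_const
  split_ifs
  · exact D.continuous_jump _
  · exact continuous_const

theorem measurable_res [Finite C] (ε : ℝ) (x ζ : Fin 2 → Torus3) (s : Slot n) :
    Measurable fun y : Var C → Torus3 => D.res ε x ζ y s := by
  refine (measurable_cutoffInv ε).comp (Measurable.sub ?_ ?_)
  · exact measurable_kineticEnergy.comp (D.continuous_mom x ζ s.1 s.2).measurable
  · exact measurable_energyOf.comp (measurable_pi_apply _)

/-- The slot to the right of an interaction. -/
def after (b : Fin 2 × Fin n) : Slot n :=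
  (b.1, ⟨pos (D.gap b.1) b.2 + 1, by have := pos_lt (g := D.gap b.1) b.2; omega⟩)

theorem after_injective : Function.Injective D.after := by
  rintro ⟨j, i⟩ ⟨j', i'⟩ h
  simp only [after, Prod.mk.injEq, Fin.mk.injEq] at h
  obtain ⟨rfl, h⟩ := h
  have h1 := @pos_lt_pos (D.gap j) n i i'
  have h2 := @pos_lt_pos (D.gap j) n i' i
  rw [Prod.mk.injEq]
  refine ⟨rfl, le_antisymm ?_ ?_⟩
  · by_contra h3; have := h2.2 (not_le.1 h3); omega
  · by_contra h3; have := h1.2 (not_le.1 h3); omega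

/-- The slot by which a variable is integrated out, given one end of each contraction. -/
def slot (first : C → Fin 2 × Fin n) : Var C → Slot n
  -- The energy labelled `flip j` is the one in force at the start of the line as it is read; the
  -- other one first appears right after the gap.
  | Sum.inl (j, b) => (j, if b = D.flip j then 0 else ⟨D.gap j + 1, by have := D.gap_le j; omega⟩)
  | Sum.inr c => D.after (first c)

/-- `rk` orders the slots compatibly with the order on each line, and `first` selects the end of a
contraction that comes first. -/
structure IsOrdered (rk : Slot n → ℕ) (first : C → Fin 2 × Fin n) : Prop where
  inj : Function.Injective rk
  mono : ∀ (j : Fin 2) (l l' : Fin (n + 2)), l < l' → rk (j, l) < rk (j, l')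
  edge_first : ∀ c, D.edge (first c) = c
  first_le : ∀ b, rk (D.after (first (D.edge b))) ≤ rk (D.after b)

theorem exists_isOrdered (rk : Slot n → ℕ) (inj : Function.Injective rk)
    (mono : ∀ (j : Fin 2) (l l' : Fin (n + 2)), l < l' → rk (j, l) < rk (j, l')) :
    ∃ first, D.IsOrdered rk first := by
  classical
  have h : ∀ c, ∃ b, D.edge b = c ∧ ∀ b', D.edge b' = c → rk (D.after b) ≤ rk (D.after b') := by
    intro c
    obtain ⟨b₀, hb₀⟩ := D.edge_surj c
    obtain ⟨b, hb, hmin⟩ := Finset.exists_min_image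
      (Finset.univ.filter fun b => D.edge b = c) (fun b => rk (D.after b))
      ⟨b₀, by simp [hb₀]⟩
    refine ⟨b, by simpa using hb, fun b' hb' => hmin b' (by simp [hb'])⟩
  choose first h1 h2 using h
  exact ⟨first, inj, mono, h1, fun b => h2 _ b rfl⟩

/-- The energies occupy slot 0 and the slot after the gap, and neither lies directly to the right of
an interaction. -/
theorem slot_inl_ne_after (first : C → Fin 2 × Fin n) (e : Fin 2 × Bool) (b : Fin 2 × Fin n) :
    D.slot first (Sum.inl e) ≠ D.after b := by
  obtain ⟨j, e⟩ := e
  intro heq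
  simp only [slot, after, Prod.mk.injEq] at heq
  obtain ⟨rfl, heq⟩ := heq
  have := pos_ne_gap (g := D.gap b.1) b.2
  split_ifs at heq <;> simp [Fin.ext_iff] at heq
  omega

namespace IsOrdered

variable {D} {rk : Slot n → ℕ} {first : C → Fin 2 × Fin n}

theorem mono_le (h : D.IsOrdered rk first) (j : Fin 2) {l l' : Fin (n + 2)} (hl : l ≤ l') : rk (j, l) ≤ rk (j, l') := by
  rcases hl.lt_or_eq with h1 | rfl
  · exact (h.mono j l l' h1).le
  · exact le_rfl

theorem slot_injective (h : D.IsOrdered rk first) : Function.Injective (D.slot first) := by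
  rintro (⟨j, b⟩ | c) (⟨j', b'⟩ | c') heq
  · simp only [slot, Prod.mk.injEq] at heq
    obtain ⟨rfl, heq⟩ := heq
    congr 2
    split_ifs at heq with h1 h2 h2
    · rw [h1, h2]
    · simp [Fin.ext_iff] at heq
    · simp [Fin.ext_iff] at heq
    · cases b <;> cases b' <;> cases hf : D.flip j <;> simp_all
  · exact absurd heq (D.slot_inl_ne_after first _ _)
  · exact absurd heq.symm (D.slot_inl_ne_after first _ _)
  · have h1 := D.after_injective heq
    rw [← h.edge_first c, ← h.edge_first c', h1]

theorem rk_slot_edge_le (h : D.IsOrdered rk first) {j : Fin 2} {i : Fin n} {l : Fin (n + 2)}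
    (hl : pos (D.gap j) i < l) : rk (D.slot first (Sum.inr (D.edge (j, i)))) ≤ rk (j, l) :=
  (h.first_le (j, i)).trans (h.mono_le j (by
    rw [Fin.le_def]
    exact hl))

theorem rk_slot_energy_le (h : D.IsOrdered rk first) (j : Fin 2) (l : Fin (n + 2)) :
    rk (D.slot first (Sum.inl (j, xor (D.flip j) (decide (D.gap j < l))))) ≤ rk (j, l) := by
  simp only [slot]
  split_ifs with h1
  · exact h.mono_le j (Fin.zero_le _)
  · apply h.mono_le j
    rw [Fin.le_def]
    have : D.gap j < l := by
      by_contra h2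
      simp [h2] at h1
    exact this

theorem dependsOn_mom (h : D.IsOrdered rk first) (x ζ : Fin 2 → Torus3) (s : Slot n) :
    DependsOn (fun y => D.mom x ζ y s.1 s.2) {v | rk (D.slot first v) ≤ rk s} :=
  fun _ _ hy => D.mom_congr x ζ fun _ hi => hy _ (h.rk_slot_edge_le hi)

/-- This is the triangular structure needed for `lintegral_prod_le`: the momentum in a slot involves
only jumps to its left, and its energy has been introduced no later than this slot. -/
theorem dependsOn_res (h : D.IsOrdered rk first) (ε : ℝ) (x ζ : Fin 2 → Torus3) (s : Slot n) :
    DependsOn (fun y => D.res ε x ζ y s) {v | rk (D.slot first v) ≤ rk s} :=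
  fun _ _ hy => D.res_congr ε x ζ (fun _ hi => hy _ (h.rk_slot_edge_le hi))
    (hy _ (h.rk_slot_energy_le s.1 s.2))

/-- As a function of the variable of a contraction, the momentum in the slot of this contraction is
a translation, possibly composed with the inversion. -/
theorem mom_update [DecidableEq (Var C)] (h : D.IsOrdered rk first) (x ζ : Fin 2 → Torus3)
    (y : Var C → Torus3) (c : C) : ∃ k : Torus3, ∀ t,
    D.mom x ζ (Function.update y (Sum.inr c) t) (first c).1 (D.after (first c)).2
      = k + (D.sign (first c) : ℤ) • t := by
  obtain ⟨⟨j, i⟩, hf⟩ : ∃ b, first c = b := ⟨_, rfl⟩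
  rw [hf]
  have hc : D.edge (j, i) = c := by rw [← hf]; exact h.edge_first c
  refine ⟨x j + ∑ i' ∈ Finset.univ.erase i, (if pos (D.gap j) i' < pos (D.gap j) i + 1
    then D.jump y (j, i') else 0) + (if D.gap j < pos (D.gap j) i + 1 then ζ j else 0), fun t => ?_⟩
  change x j + ∑ i' : Fin n, (if pos (D.gap j) i' < pos (D.gap j) i + 1
    then D.jump (Function.update y (Sum.inr c) t) (j, i') else 0)
      + (if D.gap j < pos (D.gap j) i + 1 then ζ j else 0) = _
  rw [← Finset.add_sum_erase _ _ (Finset.mem_univ i), if_pos (Nat.lt_succ_self _)]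
  have h1 : D.jump (Function.update y (Sum.inr c) t) (j, i) = (D.sign (j, i) : ℤ) • t := by
    rw [jump, hc, Function.update_self]
  have h2 : ∀ i' ∈ Finset.univ.erase i, (if pos (D.gap j) i' < pos (D.gap j) i + 1
      then D.jump (Function.update y (Sum.inr c) t) (j, i') else 0)
      = if pos (D.gap j) i' < pos (D.gap j) i + 1 then D.jump y (j, i') else 0 := by
    intro i' hi'
    split_ifs with h3
    · have hne : i' ≠ i := Finset.ne_of_mem_erase hi'
      have hlt : i' < i := by
        rcases lt_or_gt_of_ne hne with h4 | h4
        · exact h4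
        · have := (pos_lt_pos (g := D.gap j)).2 h4
          omega
      -- An end of the same contraction further to the left would contradict the choice of `first`.
      have h5 : D.edge (j, i') ≠ c := by
        intro h6
        have h7 := h.first_le (j, i')
        rw [h6, hf] at h7
        have h8 := h.mono j (D.after (j, i')).2 (D.after (j, i)).2 (by
          have := (pos_lt_pos (g := D.gap j)).2 hlt
          simp only [after, Fin.mk_lt_mk]
          omega)
        exact absurd h7 (not_le.2 h8)
      rw [jump, jump, Function.update_of_ne (by simpa using h5)]
    · rfl
  rw [h1, Finset.sum_congr rfl h2]
  abel

/-- In its own slot, an energy variable moves the energy at fixed momentum, and a contraction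
variable translates the momentum at fixed energy, up to inversion. The two averages are controlled
by `hen` and `hmom`. -/
theorem lintegral_res_update_le [DecidableEq (Var C)] (h : D.IsOrdered rk first) {ε : ℝ}
    {Λ : ℝ≥0∞}
    (hmom : ∀ a, ∫⁻ k, cutoffInv ε (kineticEnergy k - a) ∂torusMeasure ≤ Λ)
    (hen : ∀ a, 0 ≤ a → a ≤ 6 → ∫⁻ y, cutoffInv ε (a - energyOf y) ∂torusMeasure ≤ Λ)
    (x ζ : Fin 2 → Torus3) (y : Var C → Torus3) (v : Var C) :
    ∫⁻ t, D.res ε x ζ (Function.update y v t) (D.slot first v) ∂torusMeasure ≤ Λ := by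
  rcases v with ⟨j, b⟩ | c
  · set l : Fin (n + 2) := (D.slot first (Sum.inl (j, b))).2 with hl
    have h1 : D.slot first (Sum.inl (j, b)) = (j, l) := rfl
    have h2 : ∀ t, D.energy (Function.update y (Sum.inl (j, b)) t) j l = energyOf t := by
      intro t
      have : xor (D.flip j) (decide (D.gap j < l)) = b := by
        simp only [hl, slot]
        split_ifs with hb
        · simp [hb]
        · cases b <;> cases hf : D.flip j <;> simp_all
      rw [energy, this, Function.update_self]
    have h3 : ∀ t, D.mom x ζ (Function.update y (Sum.inl (j, b)) t) j l = D.mom x ζ y j l := by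
      intro t
      simp only [mom, jump, Function.update_of_ne (Sum.inr_ne_inl)]
    rw [h1]
    simp only [res, h2, h3]
    exact hen _ (kineticEnergy_nonneg _) (kineticEnergy_le _)
  · obtain ⟨k, hk⟩ := h.mom_update x ζ y c
    have h1 : ∀ t j l, D.energy (Function.update y (Sum.inr c) t) j l = D.energy y j l := by
      intro t j l
      rw [energy, energy, Function.update_of_ne (Sum.inl_ne_inr)]
    have h2 : ∀ t, D.res ε x ζ (Function.update y (Sum.inr c) t) (D.slot first (Sum.inr c))
        = cutoffInv ε (kineticEnergy (k + (D.sign (first c) : ℤ) • t)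
          - D.energy y (first c).1 (D.after (first c)).2) := by
      intro t
      rw [← h1 t, ← hk]
      rfl
    simp only [h2]
    exact (lintegral_add_units_smul (fun k => cutoffInv ε (kineticEnergy k - _)) _ _).trans_le
      (hmom _)

/-- All variables but one are integrated out by their resolvents, and the last one by `g`. -/
theorem lintegral_prod_res_mul_le [Fintype C] [DecidableEq (Var C)] (h : D.IsOrdered rk first)
    {ε : ℝ} {Λ : ℝ≥0∞}
    (hmom : ∀ a, ∫⁻ k, cutoffInv ε (kineticEnergy k - a) ∂torusMeasure ≤ Λ)
    (hen : ∀ a, 0 ≤ a → a ≤ 6 → ∫⁻ y, cutoffInv ε (a - energyOf y) ∂torusMeasure ≤ Λ)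
    (x ζ : Fin 2 → Torus3) (c : C) {g : (Var C → Torus3) → ℝ≥0∞} (hg : Measurable g)
    (hdep : DependsOn g {v | rk (D.slot first v) ≤ rk (D.slot first (Sum.inr c))}) {B : ℝ≥0∞}
    (hB : ∀ y, ∫⁻ t, g (Function.update y (Sum.inr c) t) ∂torusMeasure ≤ B) :
    ∫⁻ y, (∏ v ∈ Finset.univ.erase (Sum.inr c), D.res ε x ζ y (D.slot first v)) * g y
      ∂(Measure.pi fun _ => torusMeasure) ≤ Λ ^ (Fintype.card C + 3) * B := by
  classical
  set f : Var C → (Var C → Torus3) → ℝ≥0∞ := fun v =>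
    if v = Sum.inr c then g else fun y => D.res ε x ζ y (D.slot first v) with hf
  have hfc : f (Sum.inr c) = g := if_pos rfl
  have hfv : ∀ v, v ≠ Sum.inr c → f v = fun y => D.res ε x ζ y (D.slot first v) :=
    fun v hv => if_neg hv
  have key := lintegral_prod_le (μ := torusMeasure) (fun v => rk (D.slot first v))
    (h.inj.comp h.slot_injective) f (fun v => by
      by_cases hv : v = Sum.inr c
      · rw [hv, hfc]; exact hg
      · rw [hfv v hv]; exact D.measurable_res ε x ζ _) (fun v => by
      by_cases hv : v = Sum.inr c
      · rw [hv, hfc]; exact hdep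
      · rw [hfv v hv]; exact h.dependsOn_res ε x ζ _)
    (fun v => if v = Sum.inr c then B else Λ) (fun v y _ => by
      by_cases hv : v = Sum.inr c
      · subst hv
        rw [hfc, if_pos rfl]
        convert hB y
      · rw [hfv v hv, if_neg hv]
        exact h.lintegral_res_update_le hmom hen x ζ y v)
  refine le_trans (le_of_eq ?_) (key.trans (le_of_eq ?_))
  · congr 1; funext y
    rw [← Finset.mul_prod_erase _ _ (Finset.mem_univ (Sum.inr c)), hfc, mul_comm]
    congr 1
    exact Finset.prod_congr rfl fun v hv => by rw [hfv v (Finset.ne_of_mem_erase hv)]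
  · rw [← Finset.mul_prod_erase _ _ (Finset.mem_univ (Sum.inr c)), if_pos rfl, mul_comm,
      Finset.prod_congr rfl (g := fun _ => Λ) fun v hv => if_neg (Finset.ne_of_mem_erase hv),
      Finset.prod_const, Finset.card_erase_of_mem (Finset.mem_univ _)]
    congr 2
    simp [Fintype.card_sum]
    omega

end IsOrdered

theorem prod_res_le (ε : ℝ) (hε : 0 < ε) (x ζ : Fin 2 → Torus3) (y : Var C → Torus3)
    (S : Finset (Slot n)) {m : ℕ} (hm : S.card + m = 2 * (n + 2)) :
    ∏ s, D.res ε x ζ y s ≤ ENNReal.ofReal (1 / ε) ^ m * ∏ s ∈ S, D.res ε x ζ y s := by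
  rw [← Finset.prod_compl_mul_prod S]
  gcongr
  refine (Finset.prod_le_prod' fun s _ => cutoffInv_le_one_div hε _).trans (le_of_eq ?_)
  rw [Finset.prod_const, Finset.card_compl]
  congr 1
  simp
  omega

end Diagram

/-! ### The near and the far estimate for a diagram -/

namespace Diagram

variable {n : ℕ} {C : Type*} (D : Diagram n C)

/-- An order of the slots: the first `θ` slots of the second line, then the first line, then the
rest of the second line. -/
def rank (θ : ℕ) (s : Slot n) : ℕ :=
  if s.1 = 0 then s.2 + (n + 2) else if (s.2 : ℕ) < θ then s.2 else s.2 + 2 * (n + 2)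

theorem rank_injective (θ : ℕ) : Function.Injective (rank θ : Slot n → ℕ) := by
  rintro ⟨j, l⟩ ⟨j', l'⟩ h
  have h1 := l.2
  have h2 := l'.2
  fin_cases j <;> fin_cases j' <;> simp [rank] at h ⊢ <;> (try split_ifs at h) <;>
    first | (exfalso; omega) | (ext; omega)

theorem rank_lt_rank (θ : ℕ) (j : Fin 2) (l l' : Fin (n + 2)) (h : l < l') :
    rank θ (j, l) < rank θ (j, l') := by
  have h1 := l.2
  have h2 := l'.2
  rw [Fin.lt_def] at h
  fin_cases j <;> simp [rank] <;> (try split_ifs) <;> omega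

variable {D} in
/-- The end of a transfer contraction on the first line comes first if the other one comes late. -/
theorem IsOrdered.first_edge {θ : ℕ} {first : C → Fin 2 × Fin n}
    (h : D.IsOrdered (rank θ) first) {a a' : Fin n} (haa : D.partner (0, a) = (1, a'))
    (hθ : θ ≤ pos (D.gap 1) a' + 1) : first (D.edge (0, a)) = (0, a) := by
  have h1 := h.edge_first (D.edge (0, a))
  rcases (D.edge_eq _ _).1 h1.symm with h2 | h2
  · exact h2
  · exfalso
    rw [haa] at h2
    have h3 := h.first_le (0, a)
    rw [h2] at h3
    have e1 : rank θ (D.after (1, a')) = pos (D.gap 1) a' + 1 + 2 * (n + 2) := by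
      rw [rank, if_neg (show (D.after (1, a')).1 ≠ 0 from one_ne_zero),
        if_neg (show ¬ ((D.after (1, a')).2 : ℕ) < θ from not_lt.2 hθ)]
      rfl
    have e0 : rank θ (D.after (0, a)) = pos (D.gap 0) a + 1 + (n + 2) := rfl
    have := pos_lt (g := D.gap 0) a
    rw [e0, e1] at h3
    omega

/-- The jumps after the last transfer end of the first line cancel, so the total jump is the
momentum right after this end for zero starting momentum and zero gap jump. The variable of that
contraction acts on it by translation, up to inversion, and integrates the indicator instead of a
resolvent. Hence n + 1 resolvents, one more than usual, are bounded by 1/ε. The order `rank 0` lists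
the first line entirely before the second, so that the variable belongs to the end on the first
line. -/
theorem lintegral_prod_res_mul_indicator_le [Fintype C] (hcard : Fintype.card C = n) {ε : ℝ}
    (hε : 0 < ε) {Λ : ℝ≥0∞}
    (hmom : ∀ a, ∫⁻ k, cutoffInv ε (kineticEnergy k - a) ∂torusMeasure ≤ Λ)
    (hen : ∀ a, 0 ≤ a → a ≤ 6 → ∫⁻ y, cutoffInv ε (a - energyOf y) ∂torusMeasure ≤ Λ)
    (hconn : ∃ a b, D.partner (0, a) = (1, b)) (x ζ : Fin 2 → Torus3) {A : Set Torus3}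
    (hA : MeasurableSet A) :
    ∫⁻ y, (∏ s, D.res ε x ζ y s) * A.indicator 1 (∑ i, D.jump y (0, i))
      ∂(Measure.pi fun _ => torusMeasure)
      ≤ ENNReal.ofReal (1 / ε) ^ (n + 1) * (Λ ^ (n + 3) * torusMeasure A) := by
  classical
  obtain ⟨first, h⟩ := D.exists_isOrdered (rank 0) (rank_injective 0) (rank_lt_rank 0)
  obtain ⟨a, ha, hmax⟩ := Finset.exists_max_image
    (Finset.univ.filter fun a => (D.partner (0, a)).1 ≠ 0) id (by
      obtain ⟨a, b, hab⟩ := hconn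
      exact ⟨a, by simp [hab]⟩)
  rw [Finset.mem_filter] at ha
  obtain ⟨a', haa⟩ : ∃ a', D.partner (0, a) = (1, a') :=
    ⟨(D.partner (0, a)).2, Prod.ext (by have := ha.2; simp only; omega) rfl⟩
  have hf : first (D.edge (0, a)) = (0, a) := h.first_edge haa (Nat.zero_le _)
  set l : Fin (n + 2) := (D.after (0, a)).2
  have hl : (l : ℕ) = pos (D.gap 0) a + 1 := rfl
  have hsum : ∀ y, ∑ i, D.jump y (0, i) = D.mom 0 0 y 0 l := by
    intro y
    have h1 := D.sum_jump_after_eq_zero y 0 (a := a) ha.2 (fun i hi => by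
      by_contra h2
      have := hmax i (by simp [h2])
      exact absurd hi (not_lt.2 this))
    have h2 : ∀ i, D.jump y (0, i) = (if pos (D.gap 0) i < l then D.jump y (0, i) else 0)
        + if a < i then D.jump y (0, i) else 0 := by
      intro i
      have h3 := pos_lt_pos (g := D.gap 0) (i := a) (i' := i)
      by_cases h4 : a < i
      · have := h3.2 h4
        rw [if_neg (by omega), if_pos h4, zero_add]
      · have : ¬ pos (D.gap 0) a < pos (D.gap 0) i := fun h5 => h4 (h3.1 h5)
        rw [if_pos (by omega), if_neg h4, add_zero]
    rw [Finset.sum_congr rfl fun i _ => h2 i, Finset.sum_add_distrib, h1]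
    simp [mom]
  set g : (Var C → Torus3) → ℝ≥0∞ := fun y => A.indicator 1 (D.mom 0 0 y 0 l) with hg
  have key := h.lintegral_prod_res_mul_le hmom hen x ζ (D.edge (0, a)) (g := g)
    ((measurable_one.indicator hA).comp (D.continuous_mom 0 0 0 l).measurable) (by
      have h1 := h.dependsOn_mom 0 0 (D.after (0, a))
      have h2 : D.slot first (Sum.inr (D.edge (0, a))) = D.after (0, a) := by
        rw [slot, hf]
      rw [h2]
      intro y y' hy
      have := h1 hy
      simp only [hg]
      exact congrArg _ this) (B := torusMeasure A) (by
      intro y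
      obtain ⟨k, hk⟩ := h.mom_update 0 0 y (D.edge (0, a))
      rw [hf] at hk
      have h1 : ∀ t, g (Function.update y (Sum.inr (D.edge (0, a))) t)
          = A.indicator 1 (k + (D.sign (0, a) : ℤ) • t) := by
        intro t
        rw [← hk]
      simp only [h1]
      rw [lintegral_add_units_smul (A.indicator 1), lintegral_indicator_one hA])
  rw [hcard] at key
  have hsplit : ∀ y, (∏ s, D.res ε x ζ y s) * A.indicator 1 (∑ i, D.jump y (0, i)) ≤
      ENNReal.ofReal (1 / ε) ^ (n + 1) * ((∏ v ∈ Finset.univ.erase (Sum.inr (D.edge (0, a))),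
        D.res ε x ζ y (D.slot first v)) * g y) := by
    intro y
    have h1 := D.prod_res_le ε hε x ζ y
      ((Finset.univ.erase (Sum.inr (D.edge (0, a)))).image (D.slot first)) (m := n + 1) (by
        rw [Finset.card_image_of_injective _ h.slot_injective,
          Finset.card_erase_of_mem (Finset.mem_univ _)]
        simp [Fintype.card_sum, hcard]
        omega)
    rw [Finset.prod_image fun _ _ _ _ h2 => h.slot_injective h2] at h1
    rw [hsum, ← mul_assoc]
    exact mul_le_mul_left h1 _
  refine (lintegral_mono hsplit).trans ?_
  rw [lintegral_const_mul' _ _ (ENNReal.pow_ne_top ENNReal.ofReal_ne_top)]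
  gcongr

/-- Right after the first transfer contraction of a line. -/
theorem mom_first_transfer (x ζ : Fin 2 → Torus3) (y : Var C → Torus3) (j : Fin 2) {a : Fin n}
    (ha : (D.partner (j, a)).1 ≠ j) (hlt : ∀ i < a, (D.partner (j, i)).1 = j) :
    D.mom x ζ y j (pos (D.gap j) a + 1)
      = x j + (if D.gap j < pos (D.gap j) a then ζ j else 0) + D.jump y (j, a) := by
  have h1 := D.sum_jump_before_eq_zero y j ha hlt
  have h2 : ∀ i, (if pos (D.gap j) i < pos (D.gap j) a + 1 then D.jump y (j, i) else 0)
      = (if i < a then D.jump y (j, i) else 0) + if i = a then D.jump y (j, i) else 0 := by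
    intro i
    have h3 := pos_lt_pos (g := D.gap j) (i := i) (i' := a)
    have h4 := pos_lt_pos (g := D.gap j) (i := a) (i' := i)
    rcases lt_trichotomy i a with h5 | h5 | h5
    · have := h3.2 h5
      rw [if_pos (by omega), if_pos h5, if_neg h5.ne, add_zero]
    · subst h5; simp
    · have := h4.2 h5
      rw [if_neg (by omega), if_neg h5.asymm, if_neg h5.ne', add_zero]
  have h3 : (D.gap j < pos (D.gap j) a + 1) ↔ D.gap j < pos (D.gap j) a := by
    have := pos_ne_gap (g := D.gap j) a
    omega
  rw [mom, Finset.sum_congr rfl fun i _ => h2 i, Finset.sum_add_distrib, h1,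
    Finset.sum_ite_eq' Finset.univ a]
  simp only [h3, Finset.mem_univ, if_true]
  abel

theorem kineticEnergy_units_smul (s : ℤˣ) (k : Torus3) :
    kineticEnergy ((s : ℤ) • k) = kineticEnergy k := by
  rcases Int.units_eq_one_or s with rfl | rfl
  · simp
  · simp [kineticEnergy_neg]

theorem units_smul_smul (s : ℤˣ) (k : Torus3) : (s : ℤ) • (s : ℤ) • k = k := by
  rcases Int.units_eq_one_or s with rfl | rfl <;> simp

/-- Only internal contractions precede the first transfer end of either line, and parallelism makes
these two ends partners. The two momenta right after them are, up to sign, translates of one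
variable by amounts that depend only on the starting momenta and the gap jumps. This variable
integrates both resolvents at once, which leaves n - 1 resolvents to be bounded by 1/ε. -/
theorem lintegral_prod_res_le_of_isFar [Fintype C] (hcard : Fintype.card C = n) {ε δ : ℝ}
    (hε : 0 < ε) {Λ Ξ : ℝ≥0∞}
    (hmom : ∀ a, ∫⁻ k, cutoffInv ε (kineticEnergy k - a) ∂torusMeasure ≤ Λ)
    (hen : ∀ a, 0 ≤ a → a ≤ 6 → ∫⁻ y, cutoffInv ε (a - energyOf y) ∂torusMeasure ≤ Λ)
    (hfar : ∀ a b w, IsFar δ w → ∫⁻ k, cutoffInv ε (kineticEnergy k - a)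
      * cutoffInv ε (kineticEnergy (k + w) - b) ∂torusMeasure ≤ Ξ)
    (hconn : ∃ a b, D.partner (0, a) = (1, b))
    (hpar : ∀ a b a' b', D.partner (0, a) = (1, a') → D.partner (0, b) = (1, b') →
      a < b → a' < b') (ζ : Fin 2 → Torus3) :
    ∃ (a a' : Fin n) (κ : Torus3), D.partner (0, a) = (1, a') ∧ ∀ x : Fin 2 → Torus3,
      IsFar δ ((D.sign (1, a') : ℤ) • x 1 - (D.sign (0, a) : ℤ) • x 0 + κ) →
      ∫⁻ y, ∏ s, D.res ε x ζ y s ∂(Measure.pi fun _ => torusMeasure)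
        ≤ ENNReal.ofReal (1 / ε) ^ (n - 1) * (Λ ^ (n + 3) * Ξ) := by
  classical
  obtain ⟨a, ha, hmin⟩ := Finset.exists_min_image
    (Finset.univ.filter fun a => (D.partner (0, a)).1 ≠ 0) id (by
      obtain ⟨a, b, hab⟩ := hconn
      exact ⟨a, by simp [hab]⟩)
  rw [Finset.mem_filter] at ha
  obtain ⟨a', haa⟩ : ∃ a', D.partner (0, a) = (1, a') :=
    ⟨(D.partner (0, a)).2, Prod.ext (by have := ha.2; simp only; omega) rfl⟩
  have haa' : D.partner (1, a') = (0, a) := by rw [← haa, D.partner_partner]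
  have hlt0 : ∀ i < a, (D.partner (0, i)).1 = 0 := by
    intro i hi
    by_contra h2
    exact absurd hi (not_lt.2 (hmin i (by simp [h2])))
  have hlt1 : ∀ i < a', (D.partner (1, i)).1 = 1 := by
    intro i hi
    by_contra h2
    obtain ⟨b, hb⟩ : ∃ b, D.partner (1, i) = (0, b) :=
      ⟨(D.partner (1, i)).2, Prod.ext (by simp only; omega) rfl⟩
    have hb' : D.partner (0, b) = (1, i) := by rw [← hb, D.partner_partner]
    rcases lt_trichotomy a b with h3 | h3 | h3
    · exact absurd hi (hpar a b a' i haa hb' h3).asymm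
    · subst h3
      rw [haa] at hb'
      simp at hb'
      omega
    · have := hlt0 b h3
      rw [hb'] at this
      simp at this
  have h0 : (D.partner (0, a)).1 ≠ 0 := ha.2
  have h1 : (D.partner (1, a')).1 ≠ 1 := by rw [haa']; simp
  -- The slots of the second line strictly before the one after `a'` receive the lowest ranks.
  -- Everything else on which the resolvent after `a'` depends is then still a parameter when the
  -- transfer variable is integrated. The slot after `a'` has index θ and is moved behind the first
  -- line, so the variable is assigned to the slot after `a`.
  set θ := pos (D.gap 1) a' + 1 with hθ
  obtain ⟨first, h⟩ := D.exists_isOrdered (rank θ) (rank_injective θ) (rank_lt_rank θ)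
  have hf : first (D.edge (0, a)) = (0, a) := h.first_edge haa le_rfl
  have hedge : D.edge (1, a') = D.edge (0, a) :=
    ((D.edge_eq (0, a) (1, a')).2 (Or.inr haa.symm)).symm
  have hslot : D.slot first (Sum.inr (D.edge (0, a))) = D.after (0, a) := by rw [slot, hf]
  set κ₀ : Torus3 := if D.gap 0 < pos (D.gap 0) a then ζ 0 else 0 with hκ₀
  set κ₁ : Torus3 := if D.gap 1 < pos (D.gap 1) a' then ζ 1 else 0 with hκ₁
  refine ⟨a, a', (D.sign (1, a') : ℤ) • κ₁ - (D.sign (0, a) : ℤ) • κ₀, haa, fun x hx => ?_⟩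
  set g : (Var C → Torus3) → ℝ≥0∞ := fun y =>
    D.res ε x ζ y (D.after (0, a)) * D.res ε x ζ y (D.after (1, a')) with hg
  have hlow : ∀ l : Fin (n + 2), (l : ℕ) < θ → rank θ ((1 : Fin 2), l) ≤ rank θ (D.after (0, a)) := by
    intro l hl
    have := l.2
    simp [rank, hl, after]
    omega
  have hdep : DependsOn g {v | rank θ (D.slot first v)
      ≤ rank θ (D.slot first (Sum.inr (D.edge (0, a))))} := by
    intro y y' hy
    rw [hslot] at hy
    simp only [hg]
    congr 1
    · exact h.dependsOn_res ε x ζ (D.after (0, a)) hy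
    · apply D.res_congr
      · intro i hi
        have hi' : pos (D.gap 1) i < θ := hi
        change y (Sum.inr (D.edge (1, i))) = y' (Sum.inr (D.edge (1, i)))
        by_cases hia : i = a'
        · rw [hia, hedge]
          apply hy
          rw [Set.mem_ofPred_eq, hslot]
        · apply hy
          refine (h.first_le (1, i)).trans (hlow _ ?_)
          have h3 := pos_lt_pos (g := D.gap 1) (i := a') (i' := i)
          have h4 := pos_lt_pos (g := D.gap 1) (i := i) (i' := a')
          change pos (D.gap 1) i + 1 < pos (D.gap 1) a' + 1
          have : i < a' := by
            rcases lt_trichotomy i a' with h5 | h5 | h5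
            · exact h5
            · exact absurd h5 hia
            · have := h3.2 h5
              omega
          have := h4.2 this
          omega
      · apply hy
        simp only [slot, after, Set.mem_ofPred_eq]
        apply hlow
        split_ifs with h5
        · simp [hθ]
        · have h6 : D.gap 1 < pos (D.gap 1) a' + 1 := by
            by_contra h7
            simp [h7] at h5
          have := pos_ne_gap (g := D.gap 1) a'
          simp only [hθ]
          omega
  have hgm : Measurable g := (D.measurable_res ε x ζ _).mul (D.measurable_res ε x ζ _)
  have hB : ∀ y, ∫⁻ t, g (Function.update y (Sum.inr (D.edge (0, a))) t) ∂torusMeasure ≤ Ξ := by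
    intro y
    have e1 : ∀ t j l, D.energy (Function.update y (Sum.inr (D.edge (0, a))) t) j l
        = D.energy y j l := by
      intro t j l
      rw [energy, energy, Function.update_of_ne (Sum.inl_ne_inr)]
    have e2 : ∀ t, g (Function.update y (Sum.inr (D.edge (0, a))) t)
        = cutoffInv ε (kineticEnergy (t + (D.sign (0, a) : ℤ) • (x 0 + κ₀))
            - D.energy y 0 (D.after (0, a)).2)
          * cutoffInv ε (kineticEnergy (t + (D.sign (1, a') : ℤ) • (x 1 + κ₁))
            - D.energy y 1 (D.after (1, a')).2) := by
      intro t
      simp only [hg, res, e1]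
      congr 3
      · change kineticEnergy (D.mom x ζ _ 0 (pos (D.gap 0) a + 1)) = _
        rw [D.mom_first_transfer x ζ _ 0 h0 hlt0, jump, Function.update_self,
          ← kineticEnergy_units_smul (D.sign (0, a)), smul_add, units_smul_smul, add_comm]
      · change kineticEnergy (D.mom x ζ _ 1 (pos (D.gap 1) a' + 1)) = _
        rw [D.mom_first_transfer x ζ _ 1 h1 hlt1, jump, hedge, Function.update_self,
          ← kineticEnergy_units_smul (D.sign (1, a')), smul_add, units_smul_smul, add_comm]
    simp only [e2]
    -- After this translation the first argument is t, and the second is t plus the shift of `hx`.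
    rw [← lintegral_add_right_eq_self (μ := torusMeasure) _
      (-((D.sign (0, a) : ℤ) • (x 0 + κ₀)))]
    refine le_trans (le_of_eq ?_) (hfar (D.energy y 0 (D.after (0, a)).2)
      (D.energy y 1 (D.after (1, a')).2) _ hx)
    congr 1; funext t
    congr 4
    · abel
    · simp only [smul_add]; abel
  have key := h.lintegral_prod_res_mul_le hmom hen x ζ (D.edge (0, a)) hgm hdep hB
  rw [hcard] at key
  have hnot : D.after (1, a') ∉ Finset.univ.image (D.slot first) := by
    rw [Finset.mem_image]
    rintro ⟨e | c, -, hv⟩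
    · exact D.slot_inl_ne_after first e _ hv
    · have h3 : first c = (1, a') := D.after_injective hv
      have h4 : c = D.edge (0, a) := by rw [← h.edge_first c, h3, hedge]
      rw [h4, hf] at h3
      simp at h3
  have hsplit : ∀ y, ∏ s, D.res ε x ζ y s ≤
      ENNReal.ofReal (1 / ε) ^ (n - 1) * ((∏ v ∈ Finset.univ.erase (Sum.inr (D.edge (0, a))),
        D.res ε x ζ y (D.slot first v)) * g y) := by
    intro y
    have h3 := D.prod_res_le ε hε x ζ y
      (insert (D.after (1, a')) (Finset.univ.image (D.slot first))) (m := n - 1) (by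
        rw [Finset.card_insert_of_notMem hnot,
          Finset.card_image_of_injective _ h.slot_injective]
        have := a.2
        simp [Fintype.card_sum, hcard]
        omega)
    rw [Finset.prod_insert hnot, Finset.prod_image fun _ _ _ _ h2 => h.slot_injective h2,
      ← Finset.mul_prod_erase _ _ (Finset.mem_univ (Sum.inr (D.edge (0, a)))), hslot] at h3
    refine h3.trans (le_of_eq ?_)
    simp only [hg]
    ring
  refine (lintegral_mono hsplit).trans ?_
  rw [lintegral_const_mul' _ _ (ENNReal.pow_ne_top ENNReal.ofReal_ne_top)]
  gcongr

end Diagram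

/-! ### From pairings to diagrams: reading lines in either direction -/

/-- Reversal of the lines `j` with `o j`. -/
def reflect (o : Fin 2 → Bool) {n : ℕ} (b : Fin 2 × Fin n) : Fin 2 × Fin n :=
  (b.1, if o b.1 then b.2.rev else b.2)

theorem reflect_fst (o : Fin 2 → Bool) {n : ℕ} (b : Fin 2 × Fin n) : (reflect o b).1 = b.1 := rfl

theorem reflect_reflect (o : Fin 2 → Bool) {n : ℕ} (b : Fin 2 × Fin n) :
    reflect o (reflect o b) = b := by
  unfold reflect
  ext
  · rfl
  · dsimp only
    split_ifs <;> simp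

/-- Reversal of lines as a bijection. -/
def reflectEquiv (o : Fin 2 → Bool) (n : ℕ) : Fin 2 × Fin n ≃ Fin 2 × Fin n :=
  ⟨reflect o, reflect o, reflect_reflect o, reflect_reflect o⟩

theorem pos_rev {n₁ n₂ : ℕ} (i : Fin (n₁ + n₂)) :
    pos n₂ i.rev = n₁ + n₂ - pos n₁ i := by
  have := i.2
  unfold pos
  rw [Fin.val_rev]
  split_ifs <;> omega

namespace Pairing

variable {n₁ n₂ : ℕ} (P : Pairing n₁ n₂)

/-- The first end of the contraction of an interaction. -/
def openingOf (b : Bullet n₁ n₂) : P.Opening :=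
  if h : P.IsOpening b then ⟨b, h⟩ else ⟨P.partner b, P.isOpening_partner h⟩

/-- The sign of the jump at an interaction relative to the variable of its contraction. -/
def jumpSign (b : Bullet n₁ n₂) : ℤˣ :=
  if P.IsOpening b then 1 else if b.1 = (P.partner b).1 then -1 else 1

theorem jump_eq_jumpSign_smul (q : P.Opening → Torus3) (b : Bullet n₁ n₂) :
    P.jump q b = (P.jumpSign b : ℤ) • q (P.openingOf b) := by
  unfold jump jumpSign openingOf
  split_ifs <;> simp

theorem openingOf_eq_iff (b b' : Bullet n₁ n₂) :
    P.openingOf b = P.openingOf b' ↔ b' = b ∨ b' = P.partner b := by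
  have hpp := P.partner_partner
  have h0 : ∀ b, (P.openingOf b : Bullet n₁ n₂) = b ∨ (P.openingOf b : Bullet n₁ n₂) = P.partner b := by
    intro b
    unfold openingOf
    split_ifs
    · exact Or.inl rfl
    · exact Or.inr rfl
  have h1 : ∀ b, P.openingOf (P.partner b) = P.openingOf b := by
    intro b
    unfold openingOf
    by_cases h : P.IsOpening b
    · rw [dif_pos h, dif_neg (P.not_isOpening_partner h)]
      exact Subtype.ext (hpp b)
    · rw [dif_neg h, dif_pos (P.isOpening_partner h)]
  constructor
  · intro h
    have h2 := h0 b
    rw [h] at h2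
    rcases h2 with h2 | h2 <;> rcases h0 b' with h3 | h3 <;> rw [h2] at h3
    · exact Or.inl h3.symm
    · exact Or.inr (by rw [h3, hpp])
    · exact Or.inr h3.symm
    · exact Or.inl (by rw [← hpp b', ← h3, hpp])
  · rintro (rfl | rfl)
    · rfl
    · exact (h1 b).symm

theorem openingOf_coe (c : P.Opening) : P.openingOf c.1 = c := by
  unfold openingOf
  rw [dif_pos c.2]

theorem jumpSign_partner {b : Bullet n₁ n₂} (h : (P.partner b).1 = b.1) :
    P.jumpSign (P.partner b) = -P.jumpSign b := by
  unfold jumpSign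
  rw [P.partner_partner]
  by_cases h1 : P.IsOpening b
  · simp [h1, P.not_isOpening_partner h1, h]
  · simp [h1, P.isOpening_partner h1, h]

theorem jumpSign_transfer {b : Bullet n₁ n₂} (h : (P.partner b).1 ≠ b.1) : P.jumpSign b = 1 := by
  unfold jumpSign
  split_ifs with h1 h2
  · rfl
  · exact absurd h2.symm h
  · rfl

theorem card_opening : Fintype.card P.Opening = n₁ + n₂ := by
  have e : P.Opening ≃ {b : Bullet n₁ n₂ // ¬ P.IsOpening b} :=
    { toFun := fun b => ⟨P.partner b.1, P.not_isOpening_partner b.2⟩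
      invFun := fun b => ⟨P.partner b.1, P.isOpening_partner b.2⟩
      left_inv := fun b => Subtype.ext (P.partner_partner _)
      right_inv := fun b => Subtype.ext (P.partner_partner _) }
  have h1 := Fintype.card_congr ((Equiv.sumCongr (Equiv.refl P.Opening) e).trans
    (Equiv.sumCompl P.IsOpening))
  rw [Fintype.card_sum, Fintype.card_prod, Fintype.card_fin, Fintype.card_fin] at h1
  omega

/-- Internal contractions cancel within their line and a transfer contraction contributes the same
jump to both, so with opposite signs for the two lines everything cancels in pairs. -/
theorem sum_jump_line (q : P.Opening → Torus3) :
    ∑ i, P.jump q (1, i) = ∑ i, P.jump q (0, i) := by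
  have h : ∑ b : Bullet n₁ n₂, (if b.1 = 0 then P.jump q b else -P.jump q b) = 0 := by
    refine Finset.sum_involution (fun b _ => P.partner b) ?_ ?_ (fun _ _ => Finset.mem_univ _)
      (fun b _ => P.partner_partner b)
    · intro b _
      have h1 := P.jump_partner q b
      rw [h1]
      by_cases h2 : b.1 = (P.partner b).1
      · rw [if_pos h2, ← h2]
        split_ifs <;> abel
      · rw [if_neg h2]
        by_cases h3 : b.1 = 0
        · rw [if_pos h3, if_neg (by rw [← h3]; exact Ne.symm h2), add_neg_cancel]
        · rw [if_neg h3, if_pos (by omega), neg_add_cancel]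
    · exact fun b _ _ => P.partner_ne b
  rw [Fintype.sum_prod_type, Fin.sum_univ_two] at h
  simp only [if_true, one_ne_zero, if_false, Finset.sum_neg_distrib] at h
  exact (sub_eq_zero.1 (by rw [sub_eq_add_neg]; exact h)).symm

/-- The diagram of a pairing, with the lines `j` with `o j` read backwards. -/
def diagram (hP : ∀ j, ¬ P.HasGeneralizedCrossing j) (o : Fin 2 → Bool) :
    Diagram (n₁ + n₂) P.Opening where
  gap j := if o j then n₂ else n₁
  gap_le j := by split_ifs <;> omega
  flip := o
  edge b := P.openingOf (reflect o b)
  sign b := (if o b.1 then -1 else 1) * P.jumpSign (reflect o b)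
  partner b := reflect o (P.partner (reflect o b))
  partner_partner b := by rw [reflect_reflect, P.partner_partner, reflect_reflect]
  partner_ne b h := by
    have h1 := congrArg (reflect o) h
    rw [reflect_reflect] at h1
    exact P.partner_ne _ h1
  edge_eq b b' := by
    rw [openingOf_eq_iff]
    constructor
    · rintro (h | h)
      · exact Or.inl (by rw [← reflect_reflect o b', h, reflect_reflect])
      · exact Or.inr (by rw [← reflect_reflect o b', h])
    · rintro (h | h)
      · exact Or.inl (by rw [h])
      · exact Or.inr (by rw [h, reflect_reflect])
  edge_surj c := ⟨reflect o c.1, by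
    change P.openingOf (reflect o (reflect o c.1)) = c
    rw [reflect_reflect, openingOf_coe]⟩
  sign_partner b h := by
    rw [reflect_reflect, h]
    rw [reflect_fst] at h
    rw [P.jumpSign_partner (by rw [h, reflect_fst]), mul_neg]
  no_transfer_inside j a b c hab hbc hac := by
    by_contra hne
    rw [reflect_fst] at hne
    have hac' := congrArg (reflect o) hac
    rw [reflect_reflect] at hac'
    refine hP j (Or.inr ?_)
    by_cases ho : o j
    · refine ⟨c.rev, b.rev, a.rev, by simpa using hbc, by simpa using hab, ?_, ?_⟩
      · simp only [reflect, ho, if_true] at hac'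
        rw [← hac', P.partner_partner]
      · simpa [reflect, ho] using hne
    · refine ⟨a, b, c, hab, hbc, ?_, ?_⟩
      · simpa [reflect, ho] using hac'
      · simpa [reflect, ho] using hne

variable (hP : ∀ j, ¬ P.HasGeneralizedCrossing j) (o : Fin 2 → Bool)

theorem diagram_jump (y : Diagram.Var P.Opening → Torus3) (j : Fin 2) (i : Fin (n₁ + n₂)) :
    (P.diagram hP o).jump y (j, i)
      = if o j then -P.jump (fun c => y (Sum.inr c)) (j, i.rev)
        else P.jump (fun c => y (Sum.inr c)) (j, i) := by
  rw [jump_eq_jumpSign_smul, jump_eq_jumpSign_smul]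
  simp only [Diagram.jump, diagram, reflect]
  split_ifs <;> simp

theorem diagram_sum_jump (y : Diagram.Var P.Opening → Torus3) (j : Fin 2) :
    ∑ i, (P.diagram hP o).jump y (j, i)
      = if o j then -∑ i, P.jump (fun c => y (Sum.inr c)) (0, i)
        else ∑ i, P.jump (fun c => y (Sum.inr c)) (0, i) := by
  have h : ∀ j : Fin 2, ∑ i, P.jump (fun c => y (Sum.inr c)) (j, i)
      = ∑ i, P.jump (fun c => y (Sum.inr c)) (0, i) := by
    intro j
    fin_cases j
    · rfl
    · exact P.sum_jump_line _
  simp only [diagram_jump]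
  split_ifs with ho
  · rw [Finset.sum_neg_distrib, ← h j]
    congr 1
    exact Equiv.sum_comp Fin.revPerm fun i => P.jump (fun c => y (Sum.inr c)) (j, i)
  · exact h j

/-- The momenta at which the lines start, in the direction in which they are read. -/
noncomputable def start (o : Fin 2 → Bool) (p : Fin 2 → Torus3) (q : P.Opening → Torus3)
    (ξ : Fin 2 → R3) (j : Fin 2) : Torus3 :=
  p j + if o j then ∑ i, P.jump q (0, i) + toTorus (ξ j) else 0

/-- The jump at the gap, in the direction in which the lines are read. -/
noncomputable def gapJump (o : Fin 2 → Bool) (ξ : Fin 2 → R3) (j : Fin 2) : Torus3 :=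
  if o j then -toTorus (ξ j) else toTorus (ξ j)

theorem momentum_last (p : Fin 2 → Torus3) (q : P.Opening → Torus3) (ξ : Fin 2 → R3) (j : Fin 2) :
    P.momentum p q ξ j (n₁ + n₂ + 1) = p j + (∑ i, P.jump q (0, i) + toTorus (ξ j)) := by
  have h : ∑ i, P.jump q (j, i) = ∑ i, P.jump q (0, i) := by
    fin_cases j
    · rfl
    · exact P.sum_jump_line _
  rw [momentum, if_pos (by omega), ← h, add_assoc]
  congr 2
  exact Finset.sum_congr rfl fun i _ => if_pos (pos_lt i)

/-- Read backwards, the sum of the jumps passed is the total minus the sum of the jumps not yet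
passed. The total, which is common to both lines, has been put into `start`; the gap jump is treated
in the same way. -/
theorem diagram_mom (p : Fin 2 → Torus3) (ξ : Fin 2 → R3) (y : Diagram.Var P.Opening → Torus3)
    (j : Fin 2) {l : ℕ} (hl : l ≤ n₁ + n₂ + 1) :
    (P.diagram hP o).mom (P.start o p (fun c => y (Sum.inr c)) ξ) (gapJump o ξ) y j l
      = P.momentum p (fun c => y (Sum.inr c)) ξ j (if o j then n₁ + n₂ + 1 - l else l) := by
  set q : P.Opening → Torus3 := fun c => y (Sum.inr c) with hq
  have hg : (P.diagram hP o).gap j = if o j then n₂ else n₁ := rfl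
  rw [Diagram.mom, hg]
  simp only [diagram_jump, start, gapJump, momentum]
  by_cases ho : o j
  · simp only [ho, if_true]
    have h1 : ∑ i, P.jump q (j, i) = ∑ i, P.jump q (0, i) := by
      fin_cases j
      · rfl
      · exact P.sum_jump_line _
    have h2 : ∑ i : Fin (n₁ + n₂), (if pos n₂ i < l then -P.jump q (j, i.rev) else 0)
        = ∑ i : Fin (n₁ + n₂), (if pos n₂ i.rev < l then -P.jump q (j, i) else 0) := by
      rw [← Equiv.sum_comp Fin.revPerm]
      simp
    have h3 : ∀ i : Fin (n₁ + n₂), (if pos n₂ i.rev < l then -P.jump q (j, i) else 0)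
        = (if pos n₁ i < n₁ + n₂ + 1 - l then P.jump q (j, i) else 0) - P.jump q (j, i) := by
      intro i
      have := pos_lt (g := n₁) i
      rw [pos_rev]
      by_cases h4 : pos n₁ i < n₁ + n₂ + 1 - l
      · rw [if_pos h4, if_neg (by omega), sub_self]
      · rw [if_neg h4, if_pos (by omega), zero_sub]
    rw [h2, Finset.sum_congr rfl fun i _ => h3 i, Finset.sum_sub_distrib, h1]
    by_cases h5 : n₂ < l
    · rw [if_pos h5, if_neg (by omega)]
      abel
    · rw [if_neg h5, if_pos (by omega)]
      abel
  · simp [ho, hq]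

/-- The product of the sizes of all the resolvents. -/
noncomputable def resProd (ε : ℝ) (p : Fin 2 → Torus3) (ξ : Fin 2 → R3)
    (y : Diagram.Var P.Opening → Torus3) : ℝ≥0∞ :=
  ∏ s : Fin 2 × Fin (n₁ + n₂ + 2), cutoffInv ε
    (kineticEnergy (P.momentum p (fun c => y (Sum.inr c)) ξ s.1 s.2)
      - energyOf (y (Sum.inl (s.1, decide (n₁ < (s.2 : ℕ))))))

/-- Reversal merely permutes the resolvents of a line, so all four orientations are available to
estimate one and the same product. -/
theorem prod_diagram_res (ε : ℝ) (p : Fin 2 → Torus3) (ξ : Fin 2 → R3)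
    (y : Diagram.Var P.Opening → Torus3) :
    ∏ s, (P.diagram hP o).res ε (P.start o p (fun c => y (Sum.inr c)) ξ) (gapJump o ξ) y s
      = P.resProd ε p ξ y := by
  rw [resProd]
  refine (Finset.prod_congr rfl fun s _ => ?_).trans (Equiv.prod_comp (reflectEquiv o (n₁ + n₂ + 2)) _)
  obtain ⟨j, l⟩ := s
  have hl := l.2
  have h1 : (((reflectEquiv o (n₁ + n₂ + 2)) (j, l)).2 : ℕ)
      = if o j then n₁ + n₂ + 1 - l else l := by
    simp only [reflectEquiv, reflect, Equiv.coe_fn_mk]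
    split_ifs
    · rw [Fin.val_rev]; omega
    · rfl
  have h2 : ((reflectEquiv o (n₁ + n₂ + 2)) (j, l)).1 = j := rfl
  rw [h1, h2, Diagram.res, P.diagram_mom hP o p ξ y j (by simp only; omega), Diagram.energy]
  congr 5
  change (j, xor (o j) (decide ((if o j then n₂ else n₁) < (l : ℕ)))) = _
  congr 1
  by_cases ho : o j
  · simp only [ho, if_true, Bool.true_xor]
    rw [← decide_not]
    congr 1
    rw [eq_iff_iff]
    omega
  · simp [ho]

theorem diagram_connected (hc : P.IsConnected) :
    ∃ a b, (P.diagram hP o).partner (0, a) = (1, b) := by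
  obtain ⟨a, b, hab⟩ := hc
  refine ⟨if o 0 then a.rev else a, if o 1 then b.rev else b, ?_⟩
  have h1 : reflect o ((0 : Fin 2), if o 0 then a.rev else a) = (0, a) :=
    reflect_reflect o ((0 : Fin 2), a)
  change reflect o (P.partner (reflect o _)) = _
  rw [h1, hab]
  rfl

theorem partner_of_diagram_partner {a b : Fin (n₁ + n₂)}
    (h : (P.diagram hP o).partner (0, a) = (1, b)) :
    P.partner (0, if o 0 then a.rev else a) = (1, if o 1 then b.rev else b) := by
  have h1 := congrArg (reflect o) h
  change reflect o (reflect o (P.partner (reflect o _))) = _ at h1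
  rw [reflect_reflect] at h1
  exact h1

/-- Reversing exactly one line interchanges parallel and anti-parallel transfers, and reversing both
changes neither. -/
theorem diagram_parallel (h : (P.HasParallelTransfers ∧ o 0 = o 1) ∨
    (P.HasAntiparallelTransfers ∧ o 0 ≠ o 1)) (a b a' b' : Fin (n₁ + n₂))
    (ha : (P.diagram hP o).partner (0, a) = (1, a'))
    (hb : (P.diagram hP o).partner (0, b) = (1, b')) (hab : a < b) : a' < b' := by
  have ha1 := P.partner_of_diagram_partner hP o ha
  have hb1 := P.partner_of_diagram_partner hP o hb
  rcases h with ⟨h, ho⟩ | ⟨h, ho⟩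
  · cases h0 : o 0 <;> cases h1 : o 1 <;> simp only [h0, h1] at ha1 hb1 ho
    · exact h _ _ _ _ ha1 hb1 hab
    · simp at ho
    · simp at ho
    · exact Fin.rev_lt_rev.1 (h _ _ _ _ hb1 ha1 (Fin.rev_lt_rev.2 hab))
  · cases h0 : o 0 <;> cases h1 : o 1 <;> simp only [h0, h1] at ha1 hb1 ho
    · simp at ho
    · exact Fin.rev_lt_rev.1 (h _ _ _ _ ha1 hb1 hab)
    · exact h _ _ _ _ hb1 ha1 (Fin.rev_lt_rev.2 hab)
    · simp at ho

theorem diagram_sign_transfer {a a' : Fin (n₁ + n₂)}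
    (ha : (P.diagram hP o).partner (0, a) = (1, a')) :
    (P.diagram hP o).sign (0, a) = (if o 0 then -1 else 1) ∧
      (P.diagram hP o).sign (1, a') = if o 1 then -1 else 1 := by
  have h1 := P.partner_of_diagram_partner hP o ha
  have h2 : P.partner (1, if o 1 then a'.rev else a') = (0, if o 0 then a.rev else a) := by
    rw [← h1, P.partner_partner]
  constructor
  · change (if o 0 then -1 else 1) * P.jumpSign (0, if o 0 then a.rev else a) = _
    rw [P.jumpSign_transfer (by rw [h1]; simp), mul_one]
  · change (if o 1 then -1 else 1) * P.jumpSign (1, if o 1 then a'.rev else a') = _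
    rw [P.jumpSign_transfer (by rw [h2]; simp), mul_one]

end Pairing

/-! ### Decay of the Fourier transform of J -/

theorem exists_toTorus_eq (v : Torus3) : ∃ w : R3, toTorus w = v := by
  choose w hw using fun i => QuotientAddGroup.mk_surjective (v i)
  exact ⟨WithLp.toLp 2 w, funext hw⟩

theorem IsSchwartz.contDiff_slice {J : R3 → Torus3 → ℂ} (hJ : IsSchwartz J) (v : Torus3) :
    ContDiff ℝ ∞ fun x => J x v := by
  obtain ⟨w, rfl⟩ := exists_toTorus_eq v
  exact hJ.1.comp (contDiff_id.prodMk contDiff_const)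

theorem IsSchwartz.exists_slice_bound {J : R3 → Torus3 → ℂ} (hJ : IsSchwartz J) (m n : ℕ) :
    ∃ C, ∀ x v, ‖x‖ ^ m * ‖iteratedFDeriv ℝ n (fun x => J x v) x‖ ≤ C := by
  obtain ⟨C, hC⟩ := hJ.2 m n
  refine ⟨C, fun x v => le_trans ?_ (hC x (exists_toTorus_eq v).choose)⟩
  have hw := (exists_toTorus_eq v).choose_spec
  set w := (exists_toTorus_eq v).choose
  refine mul_le_mul_of_nonneg_left ?_ (by positivity)
  set F : R3 × R3 → ℂ := fun z => J z.1 (toTorus z.2)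
  have h1 : (fun x => J x v) = (fun z => F (z + (0, w))) ∘ ContinuousLinearMap.inl ℝ R3 R3 := by
    funext x
    simp [F, hw]
  have h2 : ContDiff ℝ n fun z => F (z + (0, w)) :=
    (hJ.1.of_le (mod_cast le_top)).comp (contDiff_id.add contDiff_const)
  rw [h1, ContinuousLinearMap.iteratedFDeriv_comp_right _ h2 _ le_rfl]
  refine (ContinuousMultilinearMap.norm_compContinuousLinearMap_le _ _).trans ?_
  rw [iteratedFDeriv_comp_add_right]
  have h3 : ContinuousLinearMap.inl ℝ R3 R3 x + (0, w) = (x, w) := by simp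
  rw [h3]
  refine mul_le_of_le_one_right (norm_nonneg _) (Finset.prod_le_one (fun _ _ => norm_nonneg _)
    fun _ _ => ContinuousLinearMap.norm_inl_le_one _ _ _)

/-- The bound involves J only through the derivatives of its slices, with weights 1 and ‖x‖^r that
make them integrable. The slice bounds are uniform in v, and so is the result. -/
theorem IsSchwartz.exists_fourier_bound {J : R3 → Torus3 → ℂ} (hJ : IsSchwartz J) (n : ℕ) :
    ∃ C, ∀ ξ v, ‖ξ‖ ^ n * ‖𝓕 (fun x : R3 => J x v) ξ‖ ≤ C := by
  set r := (volume : Measure R3).integrablePower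
  choose A hA using fun i => hJ.exists_slice_bound 0 i
  choose B hB using fun i => hJ.exists_slice_bound r i
  refine ⟨2 ^ n * ∑ p ∈ Finset.range 1 ×ˢ Finset.range (n + 1), 2 ^ r *
      (∫ x : R3, (1 + ‖x‖) ^ (-(r : ℝ))) * (A p.2 + B p.2), fun ξ v => ?_⟩
  have hf := hJ.contDiff_slice v
  have hA' : ∀ i x, ‖iteratedFDeriv ℝ i (fun x => J x v) x‖ ≤ A i := fun i x => by
    simpa using hA i x v
  have hB' : ∀ i x, ‖x‖ ^ (0 + r) * ‖iteratedFDeriv ℝ i (fun x => J x v) x‖ ≤ B i := fun i x => by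
    simpa using hB i x v
  have h := Real.pow_mul_norm_iteratedFDeriv_fourier_le (K := 0) (N := ⊤) hf (by
    intro k i hk _
    have hk : k = 0 := by simpa using hk
    subst hk
    exact integrable_of_le_of_pow_mul_le (hA' i) (hB' i)
      (hf.continuous_iteratedFDeriv (mod_cast le_top)).aestronglyMeasurable)
    (k := 0) (n := n) (by simp) le_top ξ
  simp only [norm_iteratedFDeriv_zero, pow_zero, one_mul, Nat.cast_zero, mul_zero, zero_add] at h
  refine h.trans (mul_le_mul_of_nonneg_left (Finset.sum_le_sum fun p hp => ?_) (by positivity))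
  have hp : p.1 = 0 := by
    have := (Finset.mem_product.1 hp).1
    simpa using this
  rw [hp]
  exact integral_pow_mul_le_of_le_of_pow_mul_le (hA' p.2) (hB' p.2)

/-- The majorant is free of v, and the factor η⁻³ makes its integral over ℝ³ independent of η. The
estimate of the amplitude uses J only through this bound. -/
theorem IsSchwartz.exists_JHat_bound {J : R3 → Torus3 → ℂ} (hJ : IsSchwartz J) :
    ∃ M : ℝ, 0 < M ∧ ∀ η : ℝ, 0 < η → ∃ G : R3 → ℝ≥0∞, Measurable G ∧
      (∀ ξ v, ‖JHat J η ξ v‖ₑ ≤ G ξ) ∧ ∫⁻ ξ, G ξ ≤ ENNReal.ofReal M := by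
  obtain ⟨A, hA⟩ := hJ.exists_fourier_bound 0
  obtain ⟨B, hB⟩ := hJ.exists_fourier_bound 4
  set g : R3 → ℝ := fun ξ => (1 + ‖ξ‖) ^ (-(4 : ℕ) : ℝ) with hg
  have hA0 : 0 ≤ A := le_trans (by positivity) (hA 0 0)
  have hB0 : 0 ≤ B := le_trans (by positivity) (hB 0 0)
  have hgm : Measurable g := by fun_prop
  have hg0 : ∀ ξ, 0 ≤ g ξ := fun ξ => Real.rpow_nonneg (by positivity) _
  have hgi : Integrable g := integrable_one_add_norm (by simp; norm_num)
  set D : ℝ := 2 ^ 4 * (A + B)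
  have hD : 0 ≤ D := by positivity
  have hb : ∀ ξ v, ‖𝓕 (fun x : R3 => J x v) ξ‖ ≤ D * g ξ := by
    intro ξ v
    have := pow_mul_le_of_le_of_pow_mul_le (k := 0) (l := 4) (norm_nonneg ξ)
      (norm_nonneg (𝓕 (fun x : R3 => J x v) ξ)) (by simpa using hA ξ v) (by simpa using hB ξ v)
    rw [pow_zero, one_mul] at this
    exact this
  refine ⟨(D * ∫ ξ, g ξ) + 1, by
    have : 0 ≤ ∫ ξ, g ξ := integral_nonneg hg0
    positivity, fun η hη => ?_⟩
  refine ⟨fun ξ => ENNReal.ofReal ((η ^ 3)⁻¹ * (D * g (η⁻¹ • ξ))), by fun_prop, fun ξ v => ?_, ?_⟩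
  · rw [← ofReal_norm]
    refine ENNReal.ofReal_le_ofReal ?_
    rw [JHat, norm_mul, Complex.norm_real, Real.norm_of_nonneg (by positivity)]
    exact mul_le_mul_of_nonneg_left (hb _ v) (by positivity)
  · have hi : Integrable fun ξ => g (η⁻¹ • ξ) := hgi.comp_smul (inv_ne_zero hη.ne')
    rw [← ofReal_integral_eq_lintegral_ofReal ((hi.const_mul D).const_mul _)
      (Filter.Eventually.of_forall fun ξ => by have := hg0 (η⁻¹ • ξ); positivity)]
    refine ENNReal.ofReal_le_ofReal ?_
    rw [integral_const_mul, integral_const_mul, Measure.integral_comp_smul, finrank_euclideanSpace,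
      Fintype.card_fin, inv_pow, inv_inv, abs_of_pos (by positivity), smul_eq_mul]
    have : (η ^ 3)⁻¹ * (D * (η ^ 3 * ∫ ξ, g ξ)) = D * ∫ ξ, g ξ := by
      field_simp
    linarith

/-! ### Initial data, contours and resolvents on the contours -/

theorem measurable_latticeFourier (φ : LatticeL2) : Measurable (latticeFourier φ) :=
  (Lp.stronglyMeasurable _).measurable

theorem lintegral_latticeFourier_sq (φ : LatticeL2) :
    ∫⁻ k, ‖latticeFourier φ k‖ₑ ^ 2 ∂torusMeasure = ENNReal.ofReal (‖φ‖ ^ 2) := by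
  have h1 : ‖latticeFourier φ‖ = ‖φ‖ := LinearIsometryEquiv.norm_map _ _
  have h2 := eLpNorm_eq_lintegral_rpow_enorm_toReal (p := 2) (by simp) (by simp)
    (f := latticeFourier φ) (μ := torusMeasure)
  have h3 : eLpNorm (latticeFourier φ) 2 torusMeasure = ENNReal.ofReal ‖φ‖ := by
    rw [← h1, Lp.norm_def, ENNReal.ofReal_toReal (Lp.eLpNorm_ne_top _)]
  rw [h3] at h2
  have h4 := congrArg (fun x : ℝ≥0∞ => x ^ 2) h2
  rw [ENNReal.ofReal_pow (norm_nonneg _)]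
  refine Eq.trans ?_ h4.symm
  rw [← ENNReal.rpow_natCast, ← ENNReal.rpow_mul]
  simp

/-- The properties of the points of the contours that matter for the size of the resolvents; the
points of the long edge on the real line are parametrized by the energy `a`, the points of the
other edges are at a distance from the spectrum. -/
def IsEdgePoint (a : ℝ) (z : ℂ) : Prop :=
  z = a ∨ z.re = 7 ∨ z.re = -1 ∨ |z.im| = 1

/-- Every edge, whatever its length, is parametrized by the same energies -1 + 8s, so that one
variable on the torus serves the whole contour. The comparison needs only the inequality
`lintegral_map_le`, which holds without measurability of F. -/
theorem enorm_segmentIntegral_le {z w : ℂ} {f : ℂ → ℂ} {F : ℝ → ℝ≥0∞} {c : ℝ≥0∞}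
    (hc : ‖w - z‖ₑ ≤ c)
    (h : ∀ s ∈ Set.Ioc (0 : ℝ) 1, ‖f (z + s * (w - z))‖ₑ ≤ F (-1 + 8 * s)) :
    ‖segmentIntegral z w f‖ₑ ≤ c * ∫⁻ y, F (energyOf y) ∂torusMeasure := by
  have h1 : ∫⁻ s in Set.Ioc (0 : ℝ) 1, F (-1 + 8 * s) ≤ ∫⁻ y, F (energyOf y) ∂torusMeasure := by
    rw [← measurePreserving_unitRep.map_eq]
    exact lintegral_map_le (fun s => F (-1 + 8 * s)) _
  rw [segmentIntegral, intervalIntegral.integral_of_le zero_le_one, integral_const_mul, enorm_mul]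
  refine mul_le_mul' hc ((enorm_integral_le_lintegral_enorm _).trans (le_trans ?_ h1))
  exact setLIntegral_mono' measurableSet_Ioc h

/-- The factor 18 is the perimeter. Off the real edge the energy `a` is only a label, unrelated to
z, and F has to dominate for all labels. -/
theorem enorm_contourI_le {f : ℂ → ℂ} {F : ℝ → ℝ≥0∞}
    (h : ∀ a z, IsEdgePoint a z → -1 ≤ a → a ≤ 7 → z.im ≤ 0 → ‖f z‖ₑ ≤ F a) :
    ‖contourI f‖ₑ ≤ 18 * ∫⁻ y, F (energyOf y) ∂torusMeasure := by
  have e1 : ‖(7 : ℂ) - (-1)‖ₑ ≤ 8 := by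
    rw [← ofReal_norm]; norm_num
  have e2 : ‖(7 : ℂ) - I - 7‖ₑ ≤ 1 := by
    rw [← ofReal_norm]; simp
  have e3 : ‖(-1 : ℂ) - I - (7 - I)‖ₑ ≤ 8 := by
    rw [← ofReal_norm]; norm_num
  have e4 : ‖(-1 : ℂ) - (-1 - I)‖ₑ ≤ 1 := by
    rw [← ofReal_norm]; simp
  have hr : ∀ s ∈ Set.Ioc (0 : ℝ) 1, -1 ≤ -1 + 8 * s ∧ -1 + 8 * s ≤ 7 := fun s hs =>
    ⟨by linarith [hs.1], by linarith [hs.2]⟩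
  have h1 := enorm_segmentIntegral_le (f := f) (F := F) e1 fun s hs =>
    h _ _ (Or.inl (by push_cast; ring)) (hr s hs).1 (hr s hs).2 (by simp)
  have h2 := enorm_segmentIntegral_le (f := f) (F := F) e2 fun s hs =>
    h _ _ (Or.inr (Or.inl (by simp))) (hr s hs).1 (hr s hs).2 (by simpa using hs.1.le)
  have h3 := enorm_segmentIntegral_le (f := f) (F := F) e3 fun s hs =>
    h _ _ (Or.inr (Or.inr (Or.inr (by simp)))) (hr s hs).1 (hr s hs).2 (by simp)
  have h4 := enorm_segmentIntegral_le (f := f) (F := F) e4 fun s hs =>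
    h _ _ (Or.inr (Or.inr (Or.inl (by simp)))) (hr s hs).1 (hr s hs).2 (by simpa using hs.2)
  refine (enorm_add_le _ _).trans ((add_le_add ((enorm_add_le _ _).trans (add_le_add
    ((enorm_add_le _ _).trans (add_le_add h1 h2)) h3)) h4).trans (le_of_eq ?_))
  rw [← add_mul, ← add_mul, ← add_mul]
  norm_num

theorem enorm_contourIbar_le {f : ℂ → ℂ} {F : ℝ → ℝ≥0∞}
    (h : ∀ a z, IsEdgePoint a z → -1 ≤ a → a ≤ 7 → 0 ≤ z.im → ‖f z‖ₑ ≤ F a) :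
    ‖contourIbar f‖ₑ ≤ 18 * ∫⁻ y, F (energyOf y) ∂torusMeasure := by
  have e1 : ‖(7 : ℂ) - (-1)‖ₑ ≤ 8 := by
    rw [← ofReal_norm]; norm_num
  have e2 : ‖(7 : ℂ) + I - 7‖ₑ ≤ 1 := by
    rw [← ofReal_norm]; simp
  have e3 : ‖(-1 : ℂ) + I - (7 + I)‖ₑ ≤ 8 := by
    rw [← ofReal_norm]; norm_num
  have e4 : ‖(-1 : ℂ) - (-1 + I)‖ₑ ≤ 1 := by
    rw [← ofReal_norm]; simp
  have hr : ∀ s ∈ Set.Ioc (0 : ℝ) 1, -1 ≤ -1 + 8 * s ∧ -1 + 8 * s ≤ 7 := fun s hs =>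
    ⟨by linarith [hs.1], by linarith [hs.2]⟩
  have h1 := enorm_segmentIntegral_le (f := f) (F := F) e1 fun s hs =>
    h _ _ (Or.inl (by push_cast; ring)) (hr s hs).1 (hr s hs).2 (by simp)
  have h2 := enorm_segmentIntegral_le (f := f) (F := F) e2 fun s hs =>
    h _ _ (Or.inr (Or.inl (by simp))) (hr s hs).1 (hr s hs).2 (by simpa using hs.1.le)
  have h3 := enorm_segmentIntegral_le (f := f) (F := F) e3 fun s hs =>
    h _ _ (Or.inr (Or.inr (Or.inr (by simp)))) (hr s hs).1 (hr s hs).2 (by simp)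
  have h4 := enorm_segmentIntegral_le (f := f) (F := F) e4 fun s hs =>
    h _ _ (Or.inr (Or.inr (Or.inl (by simp)))) (hr s hs).1 (hr s hs).2 (by simpa using hs.2)
  refine (enorm_add_le _ _).trans ((add_le_add ((enorm_add_le _ _).trans (add_le_add
    ((enorm_add_le _ _).trans (add_le_add h1 h2)) h3)) h4).trans (le_of_eq ?_))
  rw [← add_mul, ← add_mul, ← add_mul]
  norm_num

/-- On the real edge the modulus is at least both |e - a| and ε. The other edges keep a distance of
at least 1 - 1/3 from the shifted spectrum, and m ≤ 7 gives m/12 ≤ 2/3 there. This is the origin of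
the factor 12; the sign of ε' plays no role. -/
theorem enorm_resolvent_le {ε ε' e a : ℝ} {z : ℂ} (hε : 0 < ε) (hε3 : ε ≤ 1 / 3) (hε' : |ε'| = ε)
    (h0 : 0 ≤ e) (h6 : e ≤ 6) (hz : IsEdgePoint a z) (ha : -1 ≤ a) (ha7 : a ≤ 7) :
    ‖((e : ℂ) - z + I * ε')⁻¹‖ₑ ≤ 12 * cutoffInv ε (e - a) := by
  set m := max |e - a| ε with hm
  have hm0 : 0 < m := lt_max_of_lt_right hε
  have hm7 : m ≤ 7 := max_le (abs_le.2 ⟨by linarith, by linarith⟩) (by linarith)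
  have key : m / 12 ≤ ‖(e : ℂ) - z + I * ε'‖ := by
    have hre := Complex.abs_re_le_norm ((e : ℂ) - z + I * ε')
    have him := Complex.abs_im_le_norm ((e : ℂ) - z + I * ε')
    simp only [add_re, sub_re, ofReal_re, mul_re, I_re, zero_mul, I_im, ofReal_im, mul_zero,
      sub_zero, add_zero, add_im, sub_im, mul_im, one_mul, zero_sub, zero_add] at hre him
    rcases hz with rfl | h | h | h
    · simp only [ofReal_re, ofReal_im, neg_zero, zero_add] at hre him
      rw [hε'] at him
      have : m ≤ ‖(e : ℂ) - a + I * ε'‖ := max_le hre him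
      linarith
    · rw [h] at hre
      have := neg_abs_le (e - 7)
      linarith
    · rw [h] at hre
      have := le_abs_self (e - -1)
      linarith
    · have h1 := abs_sub_abs_le_abs_sub ε' z.im
      have h2 : |z.im| - |ε'| ≤ |-z.im + ε'| := by
        have := abs_sub_abs_le_abs_sub z.im ε'
        rwa [← abs_neg (z.im - ε'), neg_sub', sub_neg_eq_add] at this
      rw [h, hε'] at h2
      linarith
  have hn : 0 < ‖(e : ℂ) - z + I * ε'‖ := lt_of_lt_of_le (by positivity) key
  have h12 : (12 : ℝ≥0∞) = ENNReal.ofReal 12 := by norm_num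
  rw [cutoffInv, h12, ← ENNReal.ofReal_mul (by norm_num), ← ofReal_norm, norm_inv]
  refine ENNReal.ofReal_le_ofReal ?_
  rw [mul_one_div, ← hm, inv_eq_one_div, div_le_div_iff₀ hn hm0]
  linarith

theorem enorm_exp_le_one {t : ℝ} (ht : 0 ≤ t) {α₁ β₁ α₂ β₂ : ℂ} (h1 : α₁.im ≤ 0) (h2 : 0 ≤ β₁.im)
    (h3 : 0 ≤ α₂.im) (h4 : β₂.im ≤ 0) : ‖Complex.exp (-I * t * (α₁ - β₁ - α₂ + β₂))‖ₑ ≤ 1 := by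
  rw [← ofReal_norm, ← ENNReal.ofReal_one]
  refine ENNReal.ofReal_le_ofReal ?_
  rw [Complex.norm_exp, Real.exp_le_one_iff]
  have : (-I * t * (α₁ - β₁ - α₂ + β₂)).re = t * (α₁.im - β₁.im - α₂.im + β₂.im) := by
    simp
  rw [this]
  exact mul_nonpos_of_nonneg_of_nonpos ht (by linarith)

theorem enorm_resolvents_le {n₁ n₂ : ℕ} {k : ℕ → Torus3} {α β : ℂ} {ε ε' a b : ℝ} (hε : 0 < ε)
    (hε3 : ε ≤ 1 / 3) (hε' : |ε'| = ε) (hα : IsEdgePoint a α) (ha : -1 ≤ a) (ha7 : a ≤ 7)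
    (hβ : IsEdgePoint b β) (hb : -1 ≤ b) (hb7 : b ≤ 7) :
    ‖resolvents n₁ n₂ k α β ε'‖ₑ ≤ ∏ l : Fin (n₁ + n₂ + 2),
      12 * cutoffInv ε (kineticEnergy (k l) - bif decide (n₁ < (l : ℕ)) then b else a) := by
  rw [Fin.prod_univ_eq_prod_range
    (fun l => 12 * cutoffInv ε (kineticEnergy (k l) - bif decide (n₁ < l) then b else a)),
    ← Finset.prod_range_mul_prod_Ico _ (show n₁ + 1 ≤ n₁ + n₂ + 2 by omega), resolvents, enorm_mul]
  have hp : ∀ (s : Finset ℕ) (g : ℕ → ℂ), ‖∏ l ∈ s, g l‖ₑ = ∏ l ∈ s, ‖g l‖ₑ := by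
    intro s g
    classical
    induction s using Finset.induction_on with
    | empty => simp
    | insert i s hi ih => rw [Finset.prod_insert hi, Finset.prod_insert hi, enorm_mul, ih]
  rw [hp, hp]
  refine mul_le_mul' (Finset.prod_le_prod' fun l hl => ?_) (Finset.prod_le_prod' fun l hl => ?_)
  · have h : ¬ n₁ < l := by have := Finset.mem_range.1 hl; omega
    rw [decide_eq_false h]
    exact enorm_resolvent_le hε hε3 hε' (kineticEnergy_nonneg _) (kineticEnergy_le _) hα ha ha7
  · have h : n₁ < l := by have := Finset.mem_Ico.1 hl; omega
    rw [decide_eq_true h]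
    have := enorm_resolvent_le hε hε3 (ε' := -ε') (by rw [abs_neg, hε'])
      (kineticEnergy_nonneg (k l)) (kineticEnergy_le _) hβ hb hb7
    rwa [ofReal_neg, mul_neg, ← sub_eq_add_neg] at this

/-! ### Order of integration and reduction to positive integrands -/

theorem measurable_toTorus : Measurable toTorus :=
  measurable_pi_lambda _ fun i =>
    (AddCircle.continuous_mk' (1 : ℝ)).measurable.comp
      (EuclideanSpace.proj (𝕜 := ℝ) i).continuous.measurable

/-- Assembles the integration variables of a diagram. -/
def joinVar {C : Type*} (z : Torus3 × Torus3 × Torus3 × Torus3) (q : C → Torus3) :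
    Diagram.Var C → Torus3 :=
  Sum.elim (fun jb => if jb.1 = 0 then (bif jb.2 then z.2.1 else z.1)
    else (bif jb.2 then z.2.2.2 else z.2.2.1)) q

theorem measurePreserving_joinVar (C : Type*) [Fintype C] :
    MeasurePreserving (fun w : (Torus3 × Torus3 × Torus3 × Torus3) × (C → Torus3) =>
        joinVar w.1 w.2)
      ((torusMeasure.prod (torusMeasure.prod (torusMeasure.prod torusMeasure))).prod
        (Measure.pi fun _ => torusMeasure))
      (Measure.pi fun _ => torusMeasure) := by
  have hm : Measurable (fun w : (Torus3 × Torus3 × Torus3 × Torus3) × (C → Torus3) =>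
      joinVar w.1 w.2) := by
    refine measurable_pi_lambda _ fun v => ?_
    rcases v with ⟨j, b⟩ | c
    · fin_cases j <;> cases b <;> simp only [joinVar, Sum.elim_inl] <;> simp <;> fun_prop
    · simp only [joinVar, Sum.elim_inr]
      fun_prop
  refine ⟨hm, (Measure.pi_eq fun s hs => ?_).symm⟩
  rw [Measure.map_apply hm (MeasurableSet.univ_pi hs)]
  have : (fun w : (Torus3 × Torus3 × Torus3 × Torus3) × (C → Torus3) => joinVar w.1 w.2) ⁻¹'
      Set.univ.pi s = (s (Sum.inl (0, false)) ×ˢ s (Sum.inl (0, true)) ×ˢ s (Sum.inl (1, false)) ×ˢ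
        s (Sum.inl (1, true))) ×ˢ Set.univ.pi fun c => s (Sum.inr c) := by
    ext w
    simp [joinVar, Sum.forall, and_assoc]
  rw [this, Measure.prod_prod, Measure.prod_prod, Measure.prod_prod, Measure.prod_prod,
    Measure.pi_pi, Fintype.prod_sum_type, Fintype.prod_prod_type, Fin.prod_univ_two,
    Fintype.prod_bool, Fintype.prod_bool]
  ring

theorem lintegral_prod_four {μ : Measure Torus3} [SFinite μ]
    {U : Torus3 × Torus3 × Torus3 × Torus3 → ℝ≥0∞} (hU : Measurable U) :
    ∫⁻ y₁, (∫⁻ y₂, (∫⁻ y₃, (∫⁻ y₄, U (y₁, y₂, y₃, y₄) ∂μ) ∂μ) ∂μ) ∂μ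
      = ∫⁻ z, U z ∂(μ.prod (μ.prod (μ.prod μ))) := by
  rw [lintegral_prod U hU.aemeasurable]
  refine lintegral_congr fun y₁ => ?_
  have h1 : Measurable fun z => U (y₁, z) := hU.comp measurable_prodMk_left
  rw [lintegral_prod _ h1.aemeasurable]
  refine lintegral_congr fun y₂ => ?_
  have h2 : Measurable fun z => U (y₁, y₂, z) := h1.comp measurable_prodMk_left
  exact (lintegral_prod _ h2.aemeasurable).symm

/-- By Tonelli the integrals over ξ₁ and ξ₂ are carried out last. The bound `hB` is uniform in ξ, so
the two factors G integrate separately. -/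
theorem lintegral_reorder_le {C : Type*} [Fintype C] {G : R3 → ℝ≥0∞} (hGm : Measurable G)
    {K : (Diagram.Var C → Torus3) → (Fin 2 → Torus3) → R3 × R3 → ℝ≥0∞}
    (hKm : Measurable fun w : (Diagram.Var C → Torus3) × (Fin 2 → Torus3) × R3 × R3 =>
      K w.1 w.2.1 w.2.2) {B : ℝ≥0∞}
    (hB : ∀ ξ, ∫⁻ y, (∫⁻ p, K y p ξ ∂Measure.pi fun _ => torusMeasure)
      ∂(Measure.pi fun _ => torusMeasure) ≤ B) :
    ∫⁻ y₁, (∫⁻ y₂, (∫⁻ y₃, (∫⁻ y₄, (∫⁻ p, (∫⁻ q, (∫⁻ ξ₁, (∫⁻ ξ₂,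
      G ξ₁ * G ξ₂ * K (joinVar (y₁, y₂, y₃, y₄) q) p (ξ₁, ξ₂)))
      ∂(Measure.pi fun _ => torusMeasure)) ∂(Measure.pi fun _ => torusMeasure))
      ∂torusMeasure) ∂torusMeasure) ∂torusMeasure) ∂torusMeasure ≤ (∫⁻ ξ, G ξ) ^ 2 * B := by
  set H : (Diagram.Var C → Torus3) → (Fin 2 → Torus3) → R3 × R3 → ℝ≥0∞ := fun y p ξ =>
    G ξ.1 * G ξ.2 * K y p ξ with hH
  have hHm : Measurable fun w : (Diagram.Var C → Torus3) × (Fin 2 → Torus3) × R3 × R3 =>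
      H w.1 w.2.1 w.2.2 :=
    (by fun_prop : Measurable fun w : (Diagram.Var C → Torus3) ×
      (Fin 2 → Torus3) × R3 × R3 => G w.2.2.1 * G w.2.2.2).mul hKm
  have hJm : ∀ z, Measurable fun q : C → Torus3 => joinVar z q := fun z =>
    (measurePreserving_joinVar C).measurable.comp (by fun_prop : Measurable fun q => (z, q))
  set V : (Diagram.Var C → Torus3) → ℝ≥0∞ := fun y =>
    ∫⁻ ξ, (∫⁻ p, H y p ξ ∂Measure.pi fun _ => torusMeasure)
  have hVm : Measurable V := by
    have h1 : Measurable fun w : ((Diagram.Var C → Torus3) × R3 × R3) × (Fin 2 → Torus3) =>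
        H w.1.1 w.2 w.1.2 := hHm.comp (by fun_prop :
          Measurable fun w : ((Diagram.Var C → Torus3) × R3 × R3) × (Fin 2 → Torus3) =>
            (w.1.1, w.2, w.1.2))
    exact (h1.lintegral_prod_right' (ν := Measure.pi fun _ => torusMeasure)).lintegral_prod_right'
  have hswap : ∀ z, ∫⁻ p, (∫⁻ q, (∫⁻ ξ₁, (∫⁻ ξ₂, H (joinVar z q) p (ξ₁, ξ₂)))
      ∂(Measure.pi fun _ => torusMeasure)) ∂(Measure.pi fun _ => torusMeasure) =
      ∫⁻ q, V (joinVar z q) ∂(Measure.pi fun _ => torusMeasure) := by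
    intro z
    have h1 : Measurable fun w : ((Fin 2 → Torus3) × (C → Torus3)) × R3 × R3 =>
        H (joinVar z w.1.2) w.1.1 w.2 := hHm.comp (((hJm z).comp (by fun_prop)).prodMk
          (by fun_prop : Measurable fun w : ((Fin 2 → Torus3) × (C → Torus3)) × R3 × R3 =>
            (w.1.1, w.2)))
    have h2 : ∀ p q, ∫⁻ ξ₁, (∫⁻ ξ₂, H (joinVar z q) p (ξ₁, ξ₂)) = ∫⁻ ξ, H (joinVar z q) p ξ := by
      intro p q
      exact (lintegral_prod _ (h1.comp (by fun_prop : Measurable fun ξ : R3 × R3 =>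
        ((p, q), ξ))).aemeasurable).symm
    simp only [h2]
    rw [lintegral_lintegral_swap h1.lintegral_prod_right'.aemeasurable]
    refine lintegral_congr fun q => ?_
    exact lintegral_lintegral_swap (h1.comp (by fun_prop : Measurable fun w :
      (Fin 2 → Torus3) × R3 × R3 => ((w.1, q), w.2))).aemeasurable
  have hvar : ∫⁻ y₁, (∫⁻ y₂, (∫⁻ y₃, (∫⁻ y₄, (∫⁻ q, V (joinVar (y₁, y₂, y₃, y₄) q)
      ∂(Measure.pi fun _ => torusMeasure)) ∂torusMeasure) ∂torusMeasure) ∂torusMeasure) ∂torusMeasure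
      = ∫⁻ y, V y ∂(Measure.pi fun _ => torusMeasure) := by
    have hj := measurePreserving_joinVar C
    have hW : Measurable fun w : (Torus3 × Torus3 × Torus3 × Torus3) × (C → Torus3) =>
        V (joinVar w.1 w.2) := hVm.comp hj.measurable
    rw [← hj.lintegral_comp hVm, lintegral_prod _ hW.aemeasurable]
    exact lintegral_prod_four (μ := torusMeasure) hW.lintegral_prod_right'
  have hfinal : ∫⁻ y, V y ∂(Measure.pi fun _ => torusMeasure) ≤ (∫⁻ ξ, G ξ) ^ 2 * B := by
    have h1 : Measurable fun w : ((Diagram.Var C → Torus3) × R3 × R3) × (Fin 2 → Torus3) =>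
        H w.1.1 w.2 w.1.2 := hHm.comp (by fun_prop :
          Measurable fun w : ((Diagram.Var C → Torus3) × R3 × R3) × (Fin 2 → Torus3) =>
            (w.1.1, w.2, w.1.2))
    rw [lintegral_lintegral_swap
      (h1.lintegral_prod_right' (ν := Measure.pi fun _ => torusMeasure)).aemeasurable]
    have h2 : ∫⁻ ξ : R3 × R3, G ξ.1 * G ξ.2 * B = (∫⁻ ξ, G ξ) ^ 2 * B := by
      rw [lintegral_mul_const _ (by fun_prop), sq]
      congr 1
      exact lintegral_prod_mul hGm.aemeasurable hGm.aemeasurable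
    rw [← h2]
    refine lintegral_mono fun ξ => ?_
    have h3 : Measurable fun w : (Diagram.Var C → Torus3) × (Fin 2 → Torus3) =>
        K w.1 w.2 ξ := hKm.comp (by fun_prop : Measurable
          fun w : (Diagram.Var C → Torus3) × (Fin 2 → Torus3) => (w.1, w.2, ξ))
    have h4 : ∀ y, ∫⁻ p, H y p ξ ∂(Measure.pi fun _ => torusMeasure)
        = G ξ.1 * G ξ.2 * ∫⁻ p, K y p ξ ∂(Measure.pi fun _ => torusMeasure) := fun y =>
      lintegral_const_mul _ (h3.comp measurable_prodMk_left)
    simp only [h4]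
    rw [lintegral_const_mul _ h3.lintegral_prod_right']
    exact mul_le_mul_right (hB _) _
  change ∫⁻ y₁, (∫⁻ y₂, (∫⁻ y₃, (∫⁻ y₄, (∫⁻ p, (∫⁻ q, (∫⁻ ξ₁, (∫⁻ ξ₂,
      H (joinVar (y₁, y₂, y₃, y₄) q) p (ξ₁, ξ₂)))
      ∂(Measure.pi fun _ => torusMeasure)) ∂(Measure.pi fun _ => torusMeasure))
      ∂torusMeasure) ∂torusMeasure) ∂torusMeasure) ∂torusMeasure ≤ _
  simp only [hswap]
  rw [hvar]
  exact hfinal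

namespace Pairing

variable {n₁ n₂ : ℕ} (P : Pairing n₁ n₂)

/-- The initial data at the four ends of the lines. -/
noncomputable def boundary (φ : Torus3 → ℝ≥0∞) (p : Fin 2 → Torus3) (q : P.Opening → Torus3)
    (ξ : Fin 2 → R3) : ℝ≥0∞ :=
  φ (p 0) * φ (P.momentum p q ξ 0 (n₁ + n₂ + 1)) * φ (p 1) *
    φ (P.momentum p q ξ 1 (n₁ + n₂ + 1))

theorem measurable_jump (b : Bullet n₁ n₂) : Measurable fun q : P.Opening → Torus3 => P.jump q b := by
  simp only [jump_eq_jumpSign_smul]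
  have h : Measurable fun q : P.Opening → Torus3 => q (P.openingOf b) := measurable_pi_apply _
  exact h.const_smul (P.jumpSign b : ℤ)

theorem measurable_momentum {X : Type*} [MeasurableSpace X] {p : X → Fin 2 → Torus3}
    {q : X → P.Opening → Torus3} {ξ : X → Fin 2 → R3} (hp : Measurable p) (hq : Measurable q)
    (hξ : Measurable ξ) (j : Fin 2) (l : ℕ) :
    Measurable fun x => P.momentum (p x) (q x) (ξ x) j l := by
  unfold momentum
  have hj : Measurable fun x => p x j := (measurable_pi_apply j).comp hp
  refine (hj.add (Finset.measurable_sum _ fun i _ => ?_)).add ?_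
  · split_ifs
    · exact (P.measurable_jump _).comp hq
    · exact measurable_const
  · split_ifs
    · exact measurable_toTorus.comp ((measurable_pi_apply j).comp hξ)
    · exact measurable_const

theorem measurable_boundary {X : Type*} [MeasurableSpace X] {φ : Torus3 → ℝ≥0∞}
    {p : X → Fin 2 → Torus3} {q : X → P.Opening → Torus3} {ξ : X → Fin 2 → R3} (hφ : Measurable φ)
    (hp : Measurable p) (hq : Measurable q) (hξ : Measurable ξ) :
    Measurable fun x => P.boundary φ (p x) (q x) (ξ x) :=
  (((hφ.comp (measurable_pi_iff.1 hp 0)).mul (hφ.comp (P.measurable_momentum hp hq hξ _ _))).mul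
    (hφ.comp (measurable_pi_iff.1 hp 1))).mul (hφ.comp (P.measurable_momentum hp hq hξ _ _))

theorem measurable_resProd {X : Type*} [MeasurableSpace X] (ε : ℝ) {p : X → Fin 2 → Torus3}
    {ξ : X → Fin 2 → R3} {y : X → Diagram.Var P.Opening → Torus3} (hp : Measurable p)
    (hξ : Measurable ξ) (hy : Measurable y) :
    Measurable fun x => P.resProd ε (p x) (ξ x) (y x) := by
  refine Finset.measurable_prod _ fun s _ => (measurable_cutoffInv ε).comp (Measurable.sub ?_ ?_)
  · refine measurable_kineticEnergy.comp (P.measurable_momentum hp ?_ hξ _ _)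
    exact measurable_pi_lambda _ fun c => measurable_pi_iff.1 hy _
  · exact measurable_energyOf.comp (measurable_pi_iff.1 hy _)

theorem enorm_integrand_le {J : R3 → Torus3 → ℂ} {φ₀ : LatticeL2} {η ε a₁ b₁ a₂ b₂ : ℝ}
    {α₁ β₁ α₂ β₂ : ℂ} {G : R3 → ℝ≥0∞} (hG : ∀ ξ v, ‖JHat J η ξ v‖ₑ ≤ G ξ) (hε : 0 < ε)
    (hε3 : ε ≤ 1 / 3)
    (hα₁ : IsEdgePoint a₁ α₁) (ha₁ : -1 ≤ a₁) (ha₁' : a₁ ≤ 7)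
    (hβ₁ : IsEdgePoint b₁ β₁) (hb₁ : -1 ≤ b₁) (hb₁' : b₁ ≤ 7)
    (hα₂ : IsEdgePoint a₂ α₂) (ha₂ : -1 ≤ a₂) (ha₂' : a₂ ≤ 7)
    (hβ₂ : IsEdgePoint b₂ β₂) (hb₂ : -1 ≤ b₂) (hb₂' : b₂ ≤ 7)
    (ξ₁ ξ₂ : R3) (k : Fin 2 → ℕ → Torus3) :
    ‖integrand n₁ n₂ J φ₀ η ε α₁ β₁ α₂ β₂ ξ₁ ξ₂ k‖ₑ ≤
      12 ^ (2 * (n₁ + n₂) + 4) * (G ξ₁ * G ξ₂ *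
      (‖latticeFourier φ₀ (k 0 0)‖ₑ * ‖latticeFourier φ₀ (k 0 (n₁ + n₂ + 1))‖ₑ *
      ‖latticeFourier φ₀ (k 1 0)‖ₑ * ‖latticeFourier φ₀ (k 1 (n₁ + n₂ + 1))‖ₑ *
      ((∏ l : Fin (n₁ + n₂ + 2), cutoffInv ε (kineticEnergy (k 0 l)
        - bif decide (n₁ < (l : ℕ)) then b₁ else a₁)) *
      ∏ l : Fin (n₁ + n₂ + 2), cutoffInv ε (kineticEnergy (k 1 l)
        - bif decide (n₁ < (l : ℕ)) then b₂ else a₂)))) := by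
  have hconj : ∀ z : ℂ, ‖conj z‖ₑ = ‖z‖ₑ := fun z => by
    rw [← ofReal_norm, ← ofReal_norm, RCLike.norm_conj]
  have r1 := enorm_resolvents_le (n₁ := n₁) (n₂ := n₂) (k := k 0) hε hε3 (ε' := -ε)
    (by rw [abs_neg, abs_of_pos hε]) hα₁ ha₁ ha₁' hβ₁ hb₁ hb₁'
  have r2 := enorm_resolvents_le (n₁ := n₁) (n₂ := n₂) (k := k 1) hε hε3 (ε' := ε)
    (abs_of_pos hε) hα₂ ha₂ ha₂' hβ₂ hb₂ hb₂'
  rw [Finset.prod_mul_distrib, Finset.prod_const, Finset.card_univ, Fintype.card_fin] at r1 r2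
  simp only [integrand, enorm_mul, hconj]
  refine (mul_le_mul_left (mul_le_mul_left (mul_le_mul_left (mul_le_mul_left (mul_le_mul'
    (mul_le_mul' (mul_le_mul' (hG ξ₁ _) (hG ξ₂ _)) r1) r2) _) _) _) _).trans (le_of_eq ?_)
  ring

/-- All cancellations are given up. Each of the four contours costs 18 and each of the 2(n₁ + n₂) +
4 resolvents costs 12, while the time exponential is at most 1 because every contour lies in the
appropriate half plane. -/
theorem enorm_amplitude_le {J : R3 → Torus3 → ℂ} (φ₀ : LatticeL2) {lam t ε : ℝ}
    {G : R3 → ℝ≥0∞} (hGm : Measurable G) (hG : ∀ ξ v, ‖JHat J (lam ^ 2) ξ v‖ₑ ≤ G ξ)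
    (ht : 0 ≤ t) (hε : 0 < ε) (hε3 : ε ≤ 1 / 3) {B : ℝ≥0∞}
    (hB : ∀ ξ, ∫⁻ y, (∫⁻ p, P.boundary (fun k => ‖latticeFourier φ₀ k‖ₑ) p
        (fun c => y (Sum.inr c)) ξ * P.resProd ε p ξ y ∂Measure.pi fun _ => torusMeasure)
        ∂(Measure.pi fun _ => torusMeasure) ≤ B) :
    ‖amplitude P J φ₀ lam t ε‖ₑ ≤
      ENNReal.ofReal (Real.exp (4 * ε * t) * lam ^ (2 * (n₁ + n₂))) *
        (18 ^ 4 * 12 ^ (2 * (n₁ + n₂) + 4) * ((∫⁻ ξ, G ξ) ^ 2 * B)) := by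
  set φ : Torus3 → ℝ≥0∞ := fun k => ‖latticeFourier φ₀ k‖ₑ with hφdef
  have hφ : Measurable φ := (measurable_latticeFourier φ₀).enorm
  set M : ℕ := 2 * (n₁ + n₂) + 4
  set K : (Diagram.Var P.Opening → Torus3) → (Fin 2 → Torus3) → R3 × R3 → ℝ≥0∞ := fun y p ξ =>
    P.boundary φ p (fun c => y (Sum.inr c)) ![ξ.1, ξ.2] * P.resProd ε p ![ξ.1, ξ.2] y with hK
  set H : (Diagram.Var P.Opening → Torus3) → (Fin 2 → Torus3) → R3 × R3 → ℝ≥0∞ := fun y p ξ =>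
    G ξ.1 * G ξ.2 * K y p ξ with hH
  have hKm : Measurable fun w : (Diagram.Var P.Opening → Torus3) × (Fin 2 → Torus3) × R3 × R3 =>
      K w.1 w.2.1 w.2.2 := by
    have hξ : Measurable fun w : (Diagram.Var P.Opening → Torus3) × (Fin 2 → Torus3) × R3 × R3 =>
        (![w.2.2.1, w.2.2.2] : Fin 2 → R3) := by
      refine measurable_pi_lambda _ fun j => ?_
      fin_cases j <;> simp <;> fun_prop
    have hp : Measurable fun w : (Diagram.Var P.Opening → Torus3) × (Fin 2 → Torus3) × R3 × R3 =>
        w.2.1 := by fun_prop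
    have hy : Measurable fun w : (Diagram.Var P.Opening → Torus3) × (Fin 2 → Torus3) × R3 × R3 =>
        w.1 := by fun_prop
    have hq : Measurable fun w : (Diagram.Var P.Opening → Torus3) × (Fin 2 → Torus3) × R3 × R3 =>
        fun c => w.1 (Sum.inr c) := by fun_prop
    exact (P.measurable_boundary hφ hp hq hξ).mul (P.measurable_resProd ε hp hξ hy)
  have hHm : Measurable fun w : (Diagram.Var P.Opening → Torus3) × (Fin 2 → Torus3) × R3 × R3 =>
      H w.1 w.2.1 w.2.2 :=
    (by fun_prop : Measurable fun w : (Diagram.Var P.Opening → Torus3) ×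
      (Fin 2 → Torus3) × R3 × R3 => G w.2.2.1 * G w.2.2.2).mul hKm
  have hcont : ‖contourI fun α₁ => contourIbar fun β₁ => contourIbar fun α₂ => contourI fun β₂ =>
      Complex.exp (-I * t * (α₁ - β₁ - α₂ + β₂)) *
      ∫ p : Fin 2 → Torus3, (∫ q : P.Opening → Torus3, (∫ ξ₁ : R3, (∫ ξ₂ : R3,
        integrand n₁ n₂ J φ₀ (lam ^ 2) ε α₁ β₁ α₂ β₂ ξ₁ ξ₂ (P.momentum p q ![ξ₁, ξ₂])))
        ∂(Measure.pi fun _ => torusMeasure)) ∂(Measure.pi fun _ => torusMeasure)‖ₑ ≤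
      18 * ∫⁻ y₁, (18 * ∫⁻ y₂, (18 * ∫⁻ y₃, (18 * ∫⁻ y₄, 12 ^ M * (∫⁻ p, (∫⁻ q, (∫⁻ ξ₁, (∫⁻ ξ₂,
        H (joinVar (y₁, y₂, y₃, y₄) q) p (ξ₁, ξ₂)))
        ∂(Measure.pi fun _ => torusMeasure)) ∂(Measure.pi fun _ => torusMeasure))
        ∂torusMeasure) ∂torusMeasure) ∂torusMeasure) ∂torusMeasure := by
    -- The majorant is kept as a function of four real energies, so that the contours can be treated
    -- one after the other.
    set T : ℝ → ℝ → ℝ → ℝ → ℝ≥0∞ := fun a₁ b₁ a₂ b₂ => ∫⁻ p, (∫⁻ q, (∫⁻ ξ₁, (∫⁻ ξ₂,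
      12 ^ M * (G ξ₁ * G ξ₂ * (P.boundary φ p q ![ξ₁, ξ₂] *
        ((∏ l : Fin (n₁ + n₂ + 2), cutoffInv ε (kineticEnergy (P.momentum p q ![ξ₁, ξ₂] 0 l)
          - bif decide (n₁ < (l : ℕ)) then b₁ else a₁)) *
        ∏ l : Fin (n₁ + n₂ + 2), cutoffInv ε (kineticEnergy (P.momentum p q ![ξ₁, ξ₂] 1 l)
          - bif decide (n₁ < (l : ℕ)) then b₂ else a₂))))))
        ∂(Measure.pi fun _ => torusMeasure)) ∂(Measure.pi fun _ => torusMeasure) with hT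
    have hTH : ∀ y₁ y₂ y₃ y₄, T (energyOf y₁) (energyOf y₂) (energyOf y₃) (energyOf y₄) =
        12 ^ M * (∫⁻ p, (∫⁻ q, (∫⁻ ξ₁, (∫⁻ ξ₂, H (joinVar (y₁, y₂, y₃, y₄) q) p (ξ₁, ξ₂)))
          ∂(Measure.pi fun _ => torusMeasure)) ∂(Measure.pi fun _ => torusMeasure)) := by
      intro y₁ y₂ y₃ y₄
      have h12 : (12 : ℝ≥0∞) ^ M ≠ ⊤ := ENNReal.pow_ne_top (by norm_num)
      simp only [hT, lintegral_const_mul' _ _ h12]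
      congr 1
      refine lintegral_congr fun p => lintegral_congr fun q => lintegral_congr fun ξ₁ =>
        lintegral_congr fun ξ₂ => ?_
      simp only [hH, hK, resProd]
      rw [Fintype.prod_prod_type, Fin.prod_univ_two]
      congr 3
      · refine Finset.prod_congr rfl fun l _ => ?_
        congr 2
        cases decide (n₁ < (l : ℕ)) <;> rfl
      · refine Finset.prod_congr rfl fun l _ => ?_
        congr 2
        cases decide (n₁ < (l : ℕ)) <;> rfl
    simp only [← hTH]
    refine enorm_contourI_le (F := fun a₁ => 18 * ∫⁻ y₂, (18 * ∫⁻ y₃, (18 * ∫⁻ y₄,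
      T a₁ (energyOf y₂) (energyOf y₃) (energyOf y₄) ∂torusMeasure) ∂torusMeasure) ∂torusMeasure)
      fun a₁ α₁ hα₁ ha₁ ha₁' hi₁ => ?_
    refine enorm_contourIbar_le (F := fun b₁ => 18 * ∫⁻ y₃, (18 * ∫⁻ y₄,
      T a₁ b₁ (energyOf y₃) (energyOf y₄) ∂torusMeasure) ∂torusMeasure)
      fun b₁ β₁ hβ₁ hb₁ hb₁' hi₂ => ?_
    refine enorm_contourIbar_le (F := fun a₂ => 18 * ∫⁻ y₄,
      T a₁ b₁ a₂ (energyOf y₄) ∂torusMeasure) fun a₂ α₂ hα₂ ha₂ ha₂' hi₃ => ?_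
    refine enorm_contourI_le (F := fun b₂ => T a₁ b₁ a₂ b₂) fun b₂ β₂ hβ₂ hb₂ hb₂' hi₄ => ?_
    rw [enorm_mul]
    refine (mul_le_mul_left (enorm_exp_le_one ht hi₁ hi₂ hi₃ hi₄) _).trans ?_
    rw [one_mul]
    refine (enorm_integral_le_lintegral_enorm _).trans (lintegral_mono fun p => ?_)
    refine (enorm_integral_le_lintegral_enorm _).trans (lintegral_mono fun q => ?_)
    refine (enorm_integral_le_lintegral_enorm _).trans (lintegral_mono fun ξ₁ => ?_)
    refine (enorm_integral_le_lintegral_enorm _).trans (lintegral_mono fun ξ₂ => ?_)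
    refine (enorm_integrand_le hG hε hε3 hα₁ ha₁ ha₁' hβ₁ hb₁ hb₁' hα₂ ha₂ ha₂' hβ₂ hb₂ hb₂'
      ξ₁ ξ₂ _).trans (le_of_eq ?_)
    rw [momentum_zero, momentum_zero]
    rfl
  have hpref : ‖((Real.exp (4 * ε * t) * lam ^ (2 * (n₁ + n₂)) / (2 * Real.pi) ^ 4 : ℝ) : ℂ)‖ₑ ≤
      ENNReal.ofReal (Real.exp (4 * ε * t) * lam ^ (2 * (n₁ + n₂))) := by
    have h0 : 0 ≤ Real.exp (4 * ε * t) * lam ^ (2 * (n₁ + n₂)) :=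
      mul_nonneg (Real.exp_pos _).le (Even.pow_nonneg (even_two_mul _) _)
    rw [← ofReal_norm, Complex.norm_real, Real.norm_of_nonneg (by positivity)]
    refine ENNReal.ofReal_le_ofReal (div_le_self h0 (one_le_pow₀ ?_))
    linarith [Real.pi_gt_three]
  have h12 : (12 : ℝ≥0∞) ^ M ≠ ⊤ := ENNReal.pow_ne_top (by norm_num)
  have h18 : (18 : ℝ≥0∞) ≠ ⊤ := by norm_num
  simp only [lintegral_const_mul' _ _ h12, lintegral_const_mul' _ _ h18] at hcont
  have hfinal := lintegral_reorder_le hGm hKm fun ξ => hB ![ξ.1, ξ.2]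
  rw [amplitude, enorm_mul]
  refine mul_le_mul' hpref (hcont.trans ?_)
  refine le_trans (le_of_eq ?_) (mul_le_mul_right hfinal _)
  ring

end Pairing

/-! ### Far and near shifts for the four orientations -/

theorem measurableSet_isFar (δ : ℝ) : MeasurableSet {w : Torus3 | IsFar δ w} := by
  have h : ∀ c : UnitAddCircle, IsClosed {w : Torus3 | ∃ j, δ ≤ ‖w j - c‖} := fun c => by
    have : {w : Torus3 | ∃ j, δ ≤ ‖w j - c‖} = ⋃ j, {w : Torus3 | δ ≤ ‖w j - c‖} := by
      ext; simp
    rw [this]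
    exact isClosed_iUnion_of_finite fun j => isClosed_le continuous_const (by fun_prop)
  have h1 := ((h 0).inter (h halfPeriod)).measurableSet
  simp only [sub_zero] at h1
  exact h1

theorem norm_units_smul (u : ℤˣ) (k : UnitAddCircle) : ‖(u : ℤ) • k‖ = ‖k‖ := by
  rcases Int.units_eq_one_or u with rfl | rfl <;> simp

/-- The exceptional set is covered by two cubes of measure at most 8δ³, one for each exceptional
shift. -/
theorem torusMeasure_not_isFar_le {δ : ℝ} (hδ : 0 ≤ δ) (z : Torus3) (u : ℤˣ) :
    torusMeasure {k | ¬ IsFar δ (z + (u : ℤ) • k)} ≤ ENNReal.ofReal (16 * δ ^ 3) := by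
  have h1 : ∀ (c : UnitAddCircle) (k : Torus3) (j : Fin 3),
      ‖(z + (u : ℤ) • k) j - c‖ = ‖k j - (u : ℤ) • (c - z j)‖ := by
    intro c k j
    have hu : (u : ℤ) * (u : ℤ) = 1 := by
      rcases Int.units_eq_one_or u with rfl | rfl <;> simp
    have : (u : ℤ) • ((z + (u : ℤ) • k) j - c) = k j - (u : ℤ) • (c - z j) := by
      simp only [Pi.add_apply, Pi.smul_apply, smul_sub, smul_add, smul_smul, hu, one_smul]
      abel
    rw [← this, norm_units_smul]
  have h2 : {k | ¬ IsFar δ (z + (u : ℤ) • k)} ⊆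
      cube (fun j => (u : ℤ) • (0 - z j)) δ ∪ cube (fun j => (u : ℤ) • (halfPeriod - z j)) δ := by
    intro k hk
    rw [Set.mem_ofPred_eq, IsFar, not_and_or] at hk
    rcases hk with hk | hk
    · push Not at hk
      refine Or.inl fun j => ?_
      rw [← h1, sub_zero]
      exact hk j
    · push Not at hk
      refine Or.inr fun j => ?_
      rw [← h1]
      exact hk j
  refine (measure_mono h2).trans ((measure_union_le _ _).trans ((add_le_add
    (torusMeasure_cube_le _ hδ) (torusMeasure_cube_le _ hδ)).trans (le_of_eq ?_)))
  rw [← ENNReal.ofReal_add (by positivity) (by positivity)]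
  ring_nf

theorem lintegral_pair_sq {φ : Torus3 → ℝ≥0∞} (hφ : Measurable φ) :
    ∫⁻ x : Fin 2 → Torus3, (φ (x 0) * φ (x 1)) ^ 2 ∂(Measure.pi fun _ => torusMeasure)
      = (∫⁻ k, φ k ^ 2 ∂torusMeasure) ^ 2 := by
  have h := (measurePreserving_finTwoArrow torusMeasure).lintegral_comp
    (f := fun z : Torus3 × Torus3 => φ z.1 ^ 2 * φ z.2 ^ 2) (by fun_prop)
  rw [lintegral_prod_mul (hφ.pow_const 2).aemeasurable (hφ.pow_const 2).aemeasurable] at h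
  rw [sq, ← h]
  exact lintegral_congr fun x => mul_pow _ _ _

namespace Pairing

variable {n₁ n₂ : ℕ} (P : Pairing n₁ n₂)

/-- The momentum that a line receives if it is read backwards. -/
noncomputable def shift (o : Fin 2 → Bool) (ξ : Fin 2 → R3) (k : Torus3) (j : Fin 2) : Torus3 :=
  if o j then k + toTorus (ξ j) else 0

theorem start_eq (o : Fin 2 → Bool) (p : Fin 2 → Torus3) (q : P.Opening → Torus3)
    (ξ : Fin 2 → R3) : P.start o p q ξ = p + shift o ξ (∑ i, P.jump q (0, i)) := rfl

/-- The total momentum transfer. -/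
noncomputable def transfer (y : Diagram.Var P.Opening → Torus3) : Torus3 :=
  ∑ i, P.jump (fun c => y (Sum.inr c)) (0, i)

theorem measurable_transfer : Measurable P.transfer :=
  Finset.measurable_sum _ fun i _ => (P.measurable_jump (0, i)).comp
    (measurable_pi_lambda (fun (y : Diagram.Var P.Opening → Torus3) c => y (Sum.inr c)) fun c =>
      measurable_pi_apply (Sum.inr c))

theorem measurable_shift (o : Fin 2 → Bool) (ξ : Fin 2 → R3) : Measurable (shift o ξ) := by
  refine measurable_pi_lambda _ fun j => ?_
  unfold shift
  split_ifs
  · exact measurable_id.add_const _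
  · exact measurable_const

/-- For fixed y the passage from p to the starting momenta is a translation. Integrating over the
starting momenta x last, the squares of φ give the norms of the initial data, and the rest is
bounded uniformly in x. -/
theorem lintegral_oriented_le (hP : ∀ j, ¬ P.HasGeneralizedCrossing j) (o : Fin 2 → Bool) (ε : ℝ)
    (ξ : Fin 2 → R3) {φ : Torus3 → ℝ≥0∞} (hφ : Measurable φ)
    {g : (Fin 2 → Torus3) → (Diagram.Var P.Opening → Torus3) → ℝ≥0∞}
    (hg : Measurable fun w : (Fin 2 → Torus3) × (Diagram.Var P.Opening → Torus3) => g w.1 w.2)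
    {B : ℝ≥0∞}
    (hB : ∀ x, ∫⁻ y, (∏ s, (P.diagram hP o).res ε x (gapJump o ξ) y s) * g x y
      ∂(Measure.pi fun _ => torusMeasure) ≤ B) :
    ∫⁻ y, (∫⁻ p, (φ (P.start o p (fun c => y (Sum.inr c)) ξ 0) *
        φ (P.start o p (fun c => y (Sum.inr c)) ξ 1)) ^ 2 *
        (P.resProd ε p ξ y * g (P.start o p (fun c => y (Sum.inr c)) ξ) y)
        ∂Measure.pi fun _ => torusMeasure) ∂(Measure.pi fun _ => torusMeasure) ≤
      (∫⁻ k, φ k ^ 2 ∂torusMeasure) ^ 2 * B := by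
  set f : (Fin 2 → Torus3) → (Diagram.Var P.Opening → Torus3) → ℝ≥0∞ := fun x y =>
    (∏ s, (P.diagram hP o).res ε x (gapJump o ξ) y s) * g x y with hf
  have hfm : Measurable fun w : (Fin 2 → Torus3) × (Diagram.Var P.Opening → Torus3) =>
      f w.1 w.2 := by
    have h1 : Measurable fun w : (Fin 2 → Torus3) × (Diagram.Var P.Opening → Torus3) =>
        P.resProd ε (w.1 - shift o ξ (P.transfer w.2)) ξ w.2 :=
      P.measurable_resProd ε (measurable_fst.sub ((measurable_shift o ξ).comp
        (P.measurable_transfer.comp measurable_snd))) measurable_const measurable_snd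
    refine Measurable.mul ?_ hg
    convert h1 using 2 with w
    rw [← P.prod_diagram_res hP o, start_eq]
    refine Finset.prod_congr rfl fun s _ => ?_
    congr 1
    exact (sub_add_cancel _ _).symm
  have : torusMeasure.IsAddLeftInvariant := inferInstance
  have h1 : ∀ y, ∫⁻ p, (φ (P.start o p (fun c => y (Sum.inr c)) ξ 0) *
        φ (P.start o p (fun c => y (Sum.inr c)) ξ 1)) ^ 2 *
        (P.resProd ε p ξ y * g (P.start o p (fun c => y (Sum.inr c)) ξ) y)
        ∂(Measure.pi fun _ => torusMeasure) =
      ∫⁻ x, (φ (x 0) * φ (x 1)) ^ 2 * f x y ∂(Measure.pi fun _ => torusMeasure) := by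
    intro y
    have h3 := lintegral_add_right_eq_self (μ := Measure.pi fun _ : Fin 2 => torusMeasure)
      (fun x => (φ (x 0) * φ (x 1)) ^ 2 * f x y) (shift o ξ (P.transfer y))
    rw [← h3]
    refine lintegral_congr fun p => ?_
    simp only [hf]
    rw [← P.prod_diagram_res hP o]
    rfl
  clear_value f
  have h2 : Measurable fun w : (Diagram.Var P.Opening → Torus3) × (Fin 2 → Torus3) =>
      (φ (w.2 0) * φ (w.2 1)) ^ 2 * f w.2 w.1 := by
    have h4 : Measurable fun w : (Diagram.Var P.Opening → Torus3) × (Fin 2 → Torus3) =>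
      f w.2 w.1 := hfm.comp measurable_swap
    exact Measurable.mul (by fun_prop) h4
  simp only [h1]
  rw [lintegral_lintegral_swap h2.aemeasurable, ← lintegral_pair_sq hφ,
    ← lintegral_mul_const _ (by fun_prop)]
  refine lintegral_mono fun x => ?_
  have h3 : Measurable fun y => f x y := hfm.comp measurable_prodMk_left
  rw [lintegral_const_mul _ h3]
  refine mul_le_mul_right ?_ _
  rw [hf]
  exact hB x

theorem start_apply (o : Fin 2 → Bool) (p : Fin 2 → Torus3) (q : P.Opening → Torus3)
    (ξ : Fin 2 → R3) (j : Fin 2) :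
    P.start o p q ξ j = if o j then P.momentum p q ξ j (n₁ + n₂ + 1) else p j := by
  rw [start, momentum_last]
  split_ifs
  · rfl
  · exact add_zero _

/-- The phases of two orientations which differ on one line differ by the momentum transfer. -/
theorem exists_eq_add_smul_transfer (hP : ∀ j, ¬ P.HasGeneralizedCrossing j) (o o' : Fin 2 → Bool)
    (ho : xor (o 0) (o 1) ≠ xor (o' 0) (o' 1)) (u₀ u₁ : ℤˣ) (κ : Torus3) (ξ : Fin 2 → R3)
    (x : Fin 2 → Torus3) : ∃ (z : Torus3) (u : ℤˣ), ∀ y : Diagram.Var P.Opening → Torus3,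
      (u₁ : ℤ) • (x 1 + shift o ξ (P.transfer y) 1 - shift o' ξ (P.transfer y) 1)
        - (u₀ : ℤ) • (x 0 + shift o ξ (P.transfer y) 0 - shift o' ξ (P.transfer y) 0) + κ
      = z + (u : ℤ) • ∑ i, (P.diagram hP o').jump y (0, i) := by
  have h1 : ∀ y, ∑ i, (P.diagram hP o').jump y (0, i)
      = ((if o' 0 then -1 else 1 : ℤˣ) : ℤ) • P.transfer y := by
    intro y
    rw [diagram_sum_jump]
    split_ifs <;> simp [transfer]
  have key : ∃ (z : Torus3) (v : ℤˣ), ∀ Q : Torus3,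
      (u₁ : ℤ) • (x 1 + shift o ξ Q 1 - shift o' ξ Q 1)
        - (u₀ : ℤ) • (x 0 + shift o ξ Q 0 - shift o' ξ Q 0) + κ = z + (v : ℤ) • Q := by
    have h0 : ∀ j, ∃ c : ℤ, ∃ d : Torus3, ∀ Q, x j + shift o ξ Q j - shift o' ξ Q j = d + c • Q ∧
        c = (if o j then 1 else 0) - (if o' j then 1 else 0) := by
      intro j
      refine ⟨_, x j + shift o ξ 0 j - shift o' ξ 0 j, fun Q => ⟨?_, rfl⟩⟩
      unfold shift
      split_ifs <;> simp <;> abel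
    obtain ⟨c₀, d₀, h₀⟩ := h0 0
    obtain ⟨c₁, d₁, h₁⟩ := h0 1
    -- By `ho` the two orientations differ on exactly one line, so exactly one of c₀ and c₁ is
    -- nonzero, and it is 1 or -1.
    have hu : IsUnit ((u₁ : ℤ) * c₁ - u₀ * c₀) := by
      rw [(h₀ 0).2, (h₁ 0).2]
      revert ho
      generalize o 0 = b₁
      generalize o 1 = b₂
      generalize o' 0 = b₃
      generalize o' 1 = b₄
      intro ho
      rcases Int.units_eq_one_or u₀ with rfl | rfl <;> rcases Int.units_eq_one_or u₁ with rfl | rfl <;>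
      cases b₁ <;> cases b₂ <;> cases b₃ <;> cases b₄ <;> simp at ho ⊢
    obtain ⟨v, hv⟩ := hu
    refine ⟨(u₁ : ℤ) • d₁ - (u₀ : ℤ) • d₀ + κ, v, fun Q => ?_⟩
    rw [(h₀ Q).1, (h₁ Q).1, hv, sub_smul, mul_smul, mul_smul, smul_add, smul_add]
    abel
  obtain ⟨z, v, h⟩ := key
  refine ⟨z, v * (if o' 0 then -1 else 1), fun y => ?_⟩
  rw [h, h1, smul_smul, Units.val_mul, mul_assoc]
  split_ifs <;> simp

end Pairing

theorem mul_le_sq_add_sq (a b : ℝ≥0∞) : a * b ≤ a ^ 2 + b ^ 2 := by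
  rcases le_total a b with h | h
  · calc a * b ≤ b * b := mul_le_mul_left h _
      _ = b ^ 2 := (sq b).symm
      _ ≤ _ := le_add_self
  · calc a * b ≤ a * a := mul_le_mul_right h _
      _ = a ^ 2 := (sq a).symm
      _ ≤ _ := le_self_add

/-- A decomposition into a far and a near part, with different groupings of the factors. -/
theorem mul_le_far_add_near {V : Fin 2 → Bool → ℝ≥0∞} (s : Bool) (W : ℝ≥0∞) (F G : Prop)
    [Decidable F] [Decidable G] :
    V 0 false * V 0 true * V 1 false * V 1 true * W ≤
      (V 0 false * V 1 s) ^ 2 * (W * if F then 1 else 0) +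
      (V 0 true * V 1 (!s)) ^ 2 * (W * if G then 1 else 0) +
      ((V 0 false * V 1 (!s)) ^ 2 * (W * if F then 0 else 1) +
      (V 0 true * V 1 s) ^ 2 * (W * if F then 0 else 1)) +
      ((V 0 false * V 1 (!s)) ^ 2 * (W * if G then 0 else 1) +
      (V 0 true * V 1 s) ^ 2 * (W * if G then 0 else 1)) := by
  have h1 : V 0 false * V 0 true * V 1 false * V 1 true
      ≤ (V 0 false * V 1 s) ^ 2 + (V 0 true * V 1 (!s)) ^ 2 := by
    refine le_trans (le_of_eq ?_) (mul_le_sq_add_sq _ _)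
    cases s <;> simp only [Bool.not_false, Bool.not_true] <;> ring
  have h2 : V 0 false * V 0 true * V 1 false * V 1 true
      ≤ (V 0 false * V 1 (!s)) ^ 2 + (V 0 true * V 1 s) ^ 2 := by
    refine le_trans (le_of_eq ?_) (mul_le_sq_add_sq _ _)
    cases s <;> simp only [Bool.not_false, Bool.not_true] <;> ring
  have h1' := mul_le_mul_left h1 W
  have h2' := mul_le_mul_left h2 W
  rw [add_mul] at h1' h2'
  -- If F and G both hold, the first grouping is controlled by the two far terms. If one of them
  -- fails, the second grouping is controlled by the two near terms belonging to it.
  by_cases hF : F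
  · by_cases hG : G
    · simp only [hF, hG, if_true, mul_one, mul_zero, add_zero]
      exact h1'
    · simp only [hF, hG, if_true, if_false, mul_one, mul_zero, add_zero]
      exact h2'.trans le_add_self
  · refine (h2'.trans ?_).trans le_self_add
    simp only [hF, if_false, mul_one, mul_zero, zero_add]
    exact le_add_self

namespace Pairing

variable {n₁ n₂ : ℕ} (P : Pairing n₁ n₂)

/-- The phase of the first transfer contraction as a function of the momenta at which the lines
start, up to a constant. -/
def phase (o : Fin 2 → Bool) (x : Fin 2 → Torus3) : Torus3 :=
  ((if o 1 then -1 else 1 : ℤˣ) : ℤ) • x 1 - ((if o 0 then -1 else 1 : ℤˣ) : ℤ) • x 0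

theorem measurable_phase (o : Fin 2 → Bool) : Measurable (phase o) := by
  have h0 : Measurable fun x : Fin 2 → Torus3 => x 0 := measurable_pi_apply 0
  have h1 : Measurable fun x : Fin 2 → Torus3 => x 1 := measurable_pi_apply 1
  exact (h1.const_smul (_ : ℤ)).sub (h0.const_smul (_ : ℤ))

-- The shift in the far estimate is `phase` of the starting momenta plus a constant: on transfer
-- contractions the sign of a jump is decided by the direction of the line alone.
open Classical in
theorem exists_far_bound (hP : ∀ j, ¬ P.HasGeneralizedCrossing j) {ε δ : ℝ} (hε : 0 < ε) {Λ Ξ : ℝ≥0∞}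
    (hmom : ∀ a, ∫⁻ k, cutoffInv ε (kineticEnergy k - a) ∂torusMeasure ≤ Λ)
    (hen : ∀ a, 0 ≤ a → a ≤ 6 → ∫⁻ y, cutoffInv ε (a - energyOf y) ∂torusMeasure ≤ Λ)
    (hfar : ∀ a b w, IsFar δ w → ∫⁻ k, cutoffInv ε (kineticEnergy k - a)
      * cutoffInv ε (kineticEnergy (k + w) - b) ∂torusMeasure ≤ Ξ)
    (hconn : P.IsConnected) (ξ : Fin 2 → R3) {φ : Torus3 → ℝ≥0∞} (hφ : Measurable φ)
    (o : Fin 2 → Bool) (hpar : (P.HasParallelTransfers ∧ o 0 = o 1) ∨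
    (P.HasAntiparallelTransfers ∧ o 0 ≠ o 1)) :
    ∃ κ : Torus3, ∫⁻ y, (∫⁻ p, (φ (P.start o p (fun c => y (Sum.inr c)) ξ 0) *
        φ (P.start o p (fun c => y (Sum.inr c)) ξ 1)) ^ 2 *
        (P.resProd ε p ξ y *
          if IsFar δ (phase o (P.start o p (fun c => y (Sum.inr c)) ξ) + κ) then 1 else 0)
        ∂Measure.pi fun _ => torusMeasure) ∂(Measure.pi fun _ => torusMeasure) ≤
      (∫⁻ k, φ k ^ 2 ∂torusMeasure) ^ 2 *
        (ENNReal.ofReal (1 / ε) ^ (n₁ + n₂ - 1) * (Λ ^ (n₁ + n₂ + 3) * Ξ)) := by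
  obtain ⟨a, a', κ, ha, h⟩ := (P.diagram hP o).lintegral_prod_res_le_of_isFar P.card_opening hε
    hmom hen hfar (P.diagram_connected hP o hconn) (P.diagram_parallel hP o hpar) (gapJump o ξ)
  obtain ⟨hs0, hs1⟩ := P.diagram_sign_transfer hP o ha
  rw [hs0, hs1] at h
  refine ⟨κ, P.lintegral_oriented_le hP o ε ξ hφ
    (g := fun x _ => if IsFar δ (phase o x + κ) then 1 else 0) ?_ fun x => ?_⟩
  · refine Measurable.ite ?_ measurable_const measurable_const
    exact measurableSet_isFar δ |>.preimage
      (((measurable_phase o).comp measurable_fst).add_const κ)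
  · by_cases hx : IsFar δ (phase o x + κ)
    · simp only [hx, if_true, mul_one]
      exact h x hx
    · simp [hx]

-- The squares of φ sit at the starting momenta of `o'`, while the condition concerns those of `o`.
-- The two differ by multiples of the total transfer, so for fixed starting momenta of `o'` the
-- condition restricts the total transfer to a set of measure at most 16δ³.
open Classical in
theorem near_bound (hP : ∀ j, ¬ P.HasGeneralizedCrossing j) {ε δ : ℝ} (hε : 0 < ε) (hδ : 0 ≤ δ)
    {Λ : ℝ≥0∞}
    (hmom : ∀ a, ∫⁻ k, cutoffInv ε (kineticEnergy k - a) ∂torusMeasure ≤ Λ)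
    (hen : ∀ a, 0 ≤ a → a ≤ 6 → ∫⁻ y, cutoffInv ε (a - energyOf y) ∂torusMeasure ≤ Λ)
    (hconn : P.IsConnected) (ξ : Fin 2 → R3) {φ : Torus3 → ℝ≥0∞} (hφ : Measurable φ)
    (o o' : Fin 2 → Bool) (ho : xor (o 0) (o 1) ≠ xor (o' 0) (o' 1)) (κ : Torus3) :
    ∫⁻ y, (∫⁻ p, (φ (P.start o' p (fun c => y (Sum.inr c)) ξ 0) *
        φ (P.start o' p (fun c => y (Sum.inr c)) ξ 1)) ^ 2 *
        (P.resProd ε p ξ y *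
          if IsFar δ (phase o (P.start o p (fun c => y (Sum.inr c)) ξ) + κ) then 0 else 1)
        ∂Measure.pi fun _ => torusMeasure) ∂(Measure.pi fun _ => torusMeasure) ≤
      (∫⁻ k, φ k ^ 2 ∂torusMeasure) ^ 2 *
        (ENNReal.ofReal (1 / ε) ^ (n₁ + n₂ + 1) *
          (Λ ^ (n₁ + n₂ + 3) * ENNReal.ofReal (16 * δ ^ 3))) := by
  set X : (Fin 2 → Torus3) → (Diagram.Var P.Opening → Torus3) → Fin 2 → Torus3 := fun x y =>
    x + shift o ξ (P.transfer y) - shift o' ξ (P.transfer y) with hX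
  have hXs : ∀ p y, P.start o p (fun c => y (Sum.inr c)) ξ
      = X (P.start o' p (fun c => y (Sum.inr c)) ξ) y := by
    intro p y
    rw [start_eq, start_eq]
    simp only [hX, transfer]
    abel
  have hXm : Measurable fun w : (Fin 2 → Torus3) × (Diagram.Var P.Opening → Torus3) =>
      X w.1 w.2 :=
    (measurable_fst.add ((measurable_shift o ξ).comp (P.measurable_transfer.comp
      measurable_snd))).sub ((measurable_shift o' ξ).comp (P.measurable_transfer.comp
      measurable_snd))
  simp only [hXs]
  refine P.lintegral_oriented_le hP o' ε ξ hφ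
    (g := fun x y => if IsFar δ (phase o (X x y) + κ) then 0 else 1) ?_ fun x => ?_
  · refine Measurable.ite ?_ measurable_const measurable_const
    exact measurableSet_isFar δ |>.preimage (((measurable_phase o).comp hXm).add_const κ)
  · obtain ⟨z, u, h⟩ := P.exists_eq_add_smul_transfer hP o o' ho
      (if o 0 then -1 else 1) (if o 1 then -1 else 1) κ ξ x
    have hA : MeasurableSet {k : Torus3 | ¬ IsFar δ (z + (u : ℤ) • k)} := by
      have hm : Measurable fun k : Torus3 => z + (u : ℤ) • k :=
        (measurable_id.const_smul (u : ℤ)).const_add z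
      exact ((measurableSet_isFar δ).preimage hm).compl
    refine le_trans (le_of_eq (lintegral_congr fun y => ?_))
      (((P.diagram hP o').lintegral_prod_res_mul_indicator_le P.card_opening hε hmom hen
        (P.diagram_connected hP o' hconn) x (gapJump o' ξ) hA).trans
        (mul_le_mul_right (mul_le_mul_right (torusMeasure_not_isFar_le hδ z u) _) _))
    congr 1
    have h1 : phase o (X x y) + κ = z + (u : ℤ) • ∑ i, (P.diagram hP o').jump y (0, i) := by
      rw [← h y]
      rfl
    rw [h1]
    by_cases hF : IsFar δ (z + (u : ℤ) • ∑ i, (P.diagram hP o').jump y (0, i))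
    · rw [if_pos hF, Set.indicator_of_notMem
        (show _ ∉ {k | ¬ IsFar δ (z + (u : ℤ) • k)} from fun h' => h' hF)]
    · rw [if_neg hF, Set.indicator_of_mem (show _ ∈ {k | ¬ IsFar δ (z + (u : ℤ) • k)} from hF)]
      rfl

theorem measurable_start {X : Type*} [MeasurableSpace X] (o : Fin 2 → Bool) (ξ : Fin 2 → R3)
    {p : X → Fin 2 → Torus3} {y : X → Diagram.Var P.Opening → Torus3} (hp : Measurable p)
    (hy : Measurable y) : Measurable fun w => P.start o (p w) (fun c => y w (Sum.inr c)) ξ :=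
  hp.add ((measurable_shift o ξ).comp (P.measurable_transfer.comp hy))

open Classical in
theorem measurable_oriented (o o' : Fin 2 → Bool) (ε δ : ℝ) (ξ : Fin 2 → R3) (κ : Torus3)
    {φ : Torus3 → ℝ≥0∞} (hφ : Measurable φ) (e f : ℝ≥0∞) :
    Measurable fun w : (Diagram.Var P.Opening → Torus3) × (Fin 2 → Torus3) =>
      (φ (P.start o' w.2 (fun c => w.1 (Sum.inr c)) ξ 0) *
        φ (P.start o' w.2 (fun c => w.1 (Sum.inr c)) ξ 1)) ^ 2 *
        (P.resProd ε w.2 ξ w.1 *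
          if IsFar δ (phase o (P.start o w.2 (fun c => w.1 (Sum.inr c)) ξ) + κ) then e else f) := by
  have h' := P.measurable_start o' ξ (X := (Diagram.Var P.Opening → Torus3) × (Fin 2 → Torus3))
    measurable_snd measurable_fst
  have h := P.measurable_start o ξ (X := (Diagram.Var P.Opening → Torus3) × (Fin 2 → Torus3))
    measurable_snd measurable_fst
  have h0 := (measurable_pi_apply (0 : Fin 2)).comp h'
  have h1 := (measurable_pi_apply (1 : Fin 2)).comp h'
  refine Measurable.mul (((hφ.comp h0).mul (hφ.comp h1)).pow_const 2) (Measurable.mul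
    (P.measurable_resProd ε measurable_snd measurable_const measurable_fst)
    (Measurable.ite ?_ measurable_const measurable_const))
  exact (measurableSet_isFar δ).preimage (((measurable_phase o).comp h).add_const κ)

/-- The two complementary orientations in which the transfers are parallel give the two far terms.
Each of their exceptional sets is treated in the two remaining orientations, which gives the four
near terms. -/
theorem lintegral_boundary_mul_resProd_le (hP : ∀ j, ¬ P.HasGeneralizedCrossing j) {ε δ : ℝ}
    (hε : 0 < ε) (hδ : 0 ≤ δ) {Λ Ξ : ℝ≥0∞}
    (hmom : ∀ a, ∫⁻ k, cutoffInv ε (kineticEnergy k - a) ∂torusMeasure ≤ Λ)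
    (hen : ∀ a, 0 ≤ a → a ≤ 6 → ∫⁻ y, cutoffInv ε (a - energyOf y) ∂torusMeasure ≤ Λ)
    (hfar : ∀ a b w, IsFar δ w → ∫⁻ k, cutoffInv ε (kineticEnergy k - a)
      * cutoffInv ε (kineticEnergy (k + w) - b) ∂torusMeasure ≤ Ξ)
    (hconn : P.IsConnected) (hpar : P.HasParallelTransfers ∨ P.HasAntiparallelTransfers)
    (ξ : Fin 2 → R3) {φ : Torus3 → ℝ≥0∞} (hφ : Measurable φ) :
    ∫⁻ y, (∫⁻ p, P.boundary φ p (fun c => y (Sum.inr c)) ξ * P.resProd ε p ξ y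
        ∂Measure.pi fun _ => torusMeasure) ∂(Measure.pi fun _ => torusMeasure) ≤
      (∫⁻ k, φ k ^ 2 ∂torusMeasure) ^ 2 *
        (2 * (ENNReal.ofReal (1 / ε) ^ (n₁ + n₂ - 1) * (Λ ^ (n₁ + n₂ + 3) * Ξ)) +
        4 * (ENNReal.ofReal (1 / ε) ^ (n₁ + n₂ + 1) *
          (Λ ^ (n₁ + n₂ + 3) * ENNReal.ofReal (16 * δ ^ 3)))) := by
  classical
  -- `s` records whether the second line has to be reversed relative to the first to make the
  -- transfers parallel.
  obtain ⟨s, hs⟩ : ∃ s : Bool, (P.HasParallelTransfers ∧ false = s) ∨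
      (P.HasAntiparallelTransfers ∧ false ≠ s) := by
    rcases hpar with h | h
    · exact ⟨false, Or.inl ⟨h, rfl⟩⟩
    · exact ⟨true, Or.inr ⟨h, by simp⟩⟩
  obtain ⟨κ₁, h1⟩ := P.exists_far_bound hP hε hmom hen hfar hconn ξ hφ ![false, s] hs
  obtain ⟨κ₂, h2⟩ := P.exists_far_bound hP hε hmom hen hfar hconn ξ hφ ![true, !s] (by
    cases s <;> simpa using hs)
  have hn := fun o o' ho κ => P.near_bound hP hε hδ hmom hen hconn ξ hφ o o' ho κ
  have h3 := hn ![false, s] ![false, !s] (by cases s <;> simp) κ₁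
  have h4 := hn ![false, s] ![true, s] (by cases s <;> simp) κ₁
  have h5 := hn ![true, !s] ![false, !s] (by cases s <;> simp) κ₂
  have h6 := hn ![true, !s] ![true, s] (by cases s <;> simp) κ₂
  have hm := fun o o' κ => P.measurable_oriented o o' ε δ ξ κ hφ
  have hadd : ∀ {f g : (Diagram.Var P.Opening → Torus3) → (Fin 2 → Torus3) → ℝ≥0∞} {A B : ℝ≥0∞},
      (Measurable fun w : (Diagram.Var P.Opening → Torus3) × (Fin 2 → Torus3) => f w.1 w.2) →
      ∫⁻ y, (∫⁻ p, f y p ∂Measure.pi fun _ => torusMeasure)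
        ∂(Measure.pi fun _ => torusMeasure) ≤ A →
      ∫⁻ y, (∫⁻ p, g y p ∂Measure.pi fun _ => torusMeasure)
        ∂(Measure.pi fun _ => torusMeasure) ≤ B →
      ∫⁻ y, (∫⁻ p, (f y p + g y p) ∂Measure.pi fun _ => torusMeasure)
        ∂(Measure.pi fun _ => torusMeasure) ≤ A + B := by
    intro f g A B hf hA hB
    have e1 : ∀ y, ∫⁻ p, (f y p + g y p) ∂(Measure.pi fun _ => torusMeasure) =
        ∫⁻ p, f y p ∂(Measure.pi fun _ => torusMeasure) +
        ∫⁻ p, g y p ∂(Measure.pi fun _ => torusMeasure) := fun y =>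
      lintegral_add_left (hf.comp measurable_prodMk_left) _
    simp only [e1]
    rw [lintegral_add_left hf.lintegral_prod_right']
    exact add_le_add hA hB
  have h12 := hadd (hm _ _ κ₁ _ _) h1 h2
  have h34 := hadd (hm _ _ κ₁ _ _) h3 h4
  have h56 := hadd (hm _ _ κ₂ _ _) h5 h6
  have h := hadd (((hm _ _ κ₁ _ _).add (hm _ _ κ₂ _ _)).add ((hm _ _ κ₁ _ _).add (hm _ _ κ₁ _ _)))
    (hadd ((hm _ _ κ₁ _ _).add (hm _ _ κ₂ _ _)) h12 h34) h56
  refine (lintegral_mono fun y => lintegral_mono fun p => ?_).trans (h.trans (le_of_eq (by ring)))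
  have hb := mul_le_far_add_near
    (V := fun j b => φ (if b then P.momentum p (fun c => y (Sum.inr c)) ξ j (n₁ + n₂ + 1) else p j))
    s (P.resProd ε p ξ y)
    (IsFar δ (phase ![false, s] (P.start ![false, s] p (fun c => y (Sum.inr c)) ξ) + κ₁))
    (IsFar δ (phase ![true, !s] (P.start ![true, !s] p (fun c => y (Sum.inr c)) ξ) + κ₂))
  have hs0 : ∀ b b', P.start ![b, b'] p (fun c => y (Sum.inr c)) ξ 0
      = if b then P.momentum p (fun c => y (Sum.inr c)) ξ 0 (n₁ + n₂ + 1) else p 0 := fun b b' =>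
    P.start_apply _ _ _ _ _
  have hs1 : ∀ b b', P.start ![b, b'] p (fun c => y (Sum.inr c)) ξ 1
      = if b' then P.momentum p (fun c => y (Sum.inr c)) ξ 1 (n₁ + n₂ + 1) else p 1 := fun b b' =>
    P.start_apply _ _ _ _ _
  simp only [hs0, hs1]
  exact hb

end Pairing

/-! ### Powers of ε and constants -/

theorem far_power {ε : ℝ} (hε : 0 < ε) {n : ℕ} (hn : 1 ≤ n) :
    (1 / ε) ^ (n - 1) * ε ^ (-(4 / 5) : ℝ) = ε ^ ((1 : ℝ) / 5 - (n : ℝ)) := by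
  rw [one_div, inv_pow, ← Real.rpow_natCast, ← Real.rpow_neg hε.le, ← Real.rpow_add hε,
    Nat.cast_sub hn]
  congr 1
  push_cast
  ring

/-- The exponent 2/5 of δ is chosen here: δ³ = ε^(6/5) pays for the extra resolvent and leaves
ε^(1/5). The far estimate reaches the same power because its average is ε^(-4/5) instead of 1/ε. -/
theorem near_power {ε : ℝ} (hε : 0 < ε) (n : ℕ) :
    (1 / ε) ^ (n + 1) * (ε ^ (2 / 5 : ℝ)) ^ 3 = ε ^ ((1 : ℝ) / 5 - (n : ℝ)) := by
  rw [one_div, inv_pow, ← Real.rpow_natCast, ← Real.rpow_neg hε.le, ← Real.rpow_natCast,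
    ← Real.rpow_mul hε.le, ← Real.rpow_add hε]
  congr 1
  push_cast
  ring

theorem lintegral_boundary_mul_resProd_bound : ∃ K : ℝ, 1 ≤ K ∧
    ∀ (n₁ n₂ : ℕ) (P : Pairing n₁ n₂), P.IsConnected → (∀ j, ¬ P.HasGeneralizedCrossing j) →
      (P.HasParallelTransfers ∨ P.HasAntiparallelTransfers) → ∀ (ε : ℝ), 0 < ε → ε ≤ 1 / 3 →
      ∀ (ξ : Fin 2 → R3) (φ : Torus3 → ℝ≥0∞), Measurable φ →
      ∫⁻ y, (∫⁻ p, P.boundary φ p (fun c => y (Sum.inr c)) ξ * P.resProd ε p ξ y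
        ∂Measure.pi fun _ => torusMeasure) ∂(Measure.pi fun _ => torusMeasure) ≤
      (∫⁻ k, φ k ^ 2 ∂torusMeasure) ^ 2 * ENNReal.ofReal (K ^ (n₁ + n₂ + 5) *
        |Real.log ε| ^ (n₁ + n₂ + 5) * ε ^ ((1 : ℝ) / 5 - ((n₁ + n₂ : ℕ) : ℝ))) := by
  obtain ⟨K₁, hK₁, h₁⟩ := lintegral_cutoffInv_kineticEnergy_le
  obtain ⟨K₂, hK₂, h₂⟩ := lintegral_cutoffInv_mul_cutoffInv_le
  set K₀ := max K₁ 20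
  have hK₀ : 1 ≤ K₀ := le_trans (by norm_num) (le_max_right _ _)
  have hK₂' : 1 ≤ 2 * K₂ + 64 := by linarith
  -- There are two far terms with constant K₂ and four near terms with constant 16. Of the n + 5
  -- logarithms, n + 3 come from `Λ` and two from `Ξ`.
  refine ⟨K₀ * (2 * K₂ + 64), one_le_mul_of_one_le_of_one_le hK₀ hK₂', ?_⟩
  intro n₁ n₂ P hconn hP hpar ε hε hε3 ξ φ hφ
  have hL := one_le_abs_log hε hε3
  set L := |Real.log ε|
  -- A connected pairing has at least one interaction on each line; this makes the truncated
  -- subtraction in the exponent n - 1 a true one.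
  have hn : 1 ≤ n₁ + n₂ := by
    obtain ⟨a, -⟩ := hconn
    have := a.2
    omega
  refine (P.lintegral_boundary_mul_resProd_le hP hε (δ := ε ^ (2 / 5 : ℝ)) (by positivity)
    (Λ := ENNReal.ofReal (K₀ * L)) (Ξ := ENNReal.ofReal (K₂ * L ^ 2 * ε ^ (-(4 / 5) : ℝ)))
    (fun a => (h₁ ε a hε hε3).trans (ENNReal.ofReal_le_ofReal
      (mul_le_mul_of_nonneg_right (le_max_left _ _) (by positivity))))
    (fun a h0 h6 => (lintegral_cutoffInv_energyOf_le hε hε3 h0 h6).trans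
      (ENNReal.ofReal_le_ofReal (mul_le_mul_of_nonneg_right (le_max_right _ _) (by positivity))))
    (fun a b w hw => h₂ ε a b w hε hε3 hw) hconn hpar ξ hφ).trans (mul_le_mul_right ?_ _)
  set n := n₁ + n₂
  set E := ε ^ ((1 : ℝ) / 5 - (n : ℝ))
  have hE : 0 < E := Real.rpow_pos_of_pos hε _
  have e1 : ENNReal.ofReal (1 / ε) ^ (n - 1) * (ENNReal.ofReal (K₀ * L) ^ (n + 3) *
      ENNReal.ofReal (K₂ * L ^ 2 * ε ^ (-(4 / 5) : ℝ)))
      = ENNReal.ofReal (K₀ ^ (n + 3) * L ^ (n + 5) * K₂ * E) := by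
    rw [← ENNReal.ofReal_pow (by positivity), ← ENNReal.ofReal_pow (by positivity),
      ← ENNReal.ofReal_mul (by positivity), ← ENNReal.ofReal_mul (by positivity),
      show E = _ from (far_power hε hn).symm]
    congr 1
    ring
  have e2 : ENNReal.ofReal (1 / ε) ^ (n + 1) * (ENNReal.ofReal (K₀ * L) ^ (n + 3) *
      ENNReal.ofReal (16 * (ε ^ (2 / 5 : ℝ)) ^ 3))
      = ENNReal.ofReal (K₀ ^ (n + 3) * L ^ (n + 3) * 16 * E) := by
    rw [← ENNReal.ofReal_pow (by positivity), ← ENNReal.ofReal_pow (by positivity),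
      ← ENNReal.ofReal_mul (by positivity), ← ENNReal.ofReal_mul (by positivity),
      show E = _ from (near_power hε n).symm]
    congr 1
    ring
  rw [e1, e2, show (2 : ℝ≥0∞) = ENNReal.ofReal 2 by norm_num,
    show (4 : ℝ≥0∞) = ENNReal.ofReal 4 by norm_num, ← ENNReal.ofReal_mul (by norm_num),
    ← ENNReal.ofReal_mul (by norm_num), ← ENNReal.ofReal_add (by positivity) (by positivity)]
  refine ENNReal.ofReal_le_ofReal ?_
  have hL' : L ^ (n + 3) ≤ L ^ (n + 5) := pow_le_pow_right₀ hL (by omega)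
  have hK' : K₀ ^ (n + 3) ≤ K₀ ^ (n + 5) := pow_le_pow_right₀ hK₀ (by omega)
  have hC : 2 * K₂ + 64 ≤ (2 * K₂ + 64) ^ (n + 5) := le_self_pow₀ hK₂' (by omega)
  calc 2 * (K₀ ^ (n + 3) * L ^ (n + 5) * K₂ * E) + 4 * (K₀ ^ (n + 3) * L ^ (n + 3) * 16 * E)
      ≤ 2 * (K₀ ^ (n + 3) * L ^ (n + 5) * K₂ * E) + 4 * (K₀ ^ (n + 3) * L ^ (n + 5) * 16 * E) := by
        gcongr
    _ = K₀ ^ (n + 3) * (2 * K₂ + 64) * L ^ (n + 5) * E := by ring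
    _ ≤ K₀ ^ (n + 5) * (2 * K₂ + 64) ^ (n + 5) * L ^ (n + 5) * E := by gcongr
    _ = (K₀ * (2 * K₂ + 64)) ^ (n + 5) * L ^ (n + 5) * E := by rw [mul_pow]

end KineticGraphs

/-! ### The estimate of the amplitude -/

theorem lemma4p5 (J : KineticGraphs.R3 → KineticGraphs.Torus3 → ℂ)
    (hJ : KineticGraphs.IsSchwartz J) :
    ∃ c : ℝ, 0 < c ∧
      ∀ (n₁ n₂ : ℕ) (P : KineticGraphs.Pairing n₁ n₂),
        P.IsConnected → (∀ j, ¬ P.HasGeneralizedCrossing j) →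
        (P.HasParallelTransfers ∨ P.HasAntiparallelTransfers) →
        ∀ (φ₀ : KineticGraphs.LatticeL2) (lam t ε : ℝ),
          0 < lam → 0 ≤ t → 0 < ε → ε ≤ 1 / 3 →
          ‖KineticGraphs.amplitude P J φ₀ lam t ε‖ ≤
            Real.exp (4 * ε * t) * lam ^ (2 * (n₁ + n₂)) *
              ε ^ ((1 : ℝ) / 5 - ((n₁ + n₂ : ℕ) : ℝ)) *
              |c * Real.log ε| ^ (n₁ + n₂ + 5) * ‖φ₀‖ ^ 4 := by
  obtain ⟨M, hM, hJb⟩ := hJ.exists_JHat_bound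
  obtain ⟨K, hK, hb⟩ := KineticGraphs.lintegral_boundary_mul_resProd_bound
  have hM1 : 1 ≤ (M + 1) ^ 2 := one_le_pow₀ (by linarith)
  -- All factors are at least 1, which allows them to be raised to the power n + 5; this is why M +
  -- 1 replaces M. The factor 144 = 12² accounts for two resolvents per contraction.
  refine ⟨18 ^ 4 * 144 * (M + 1) ^ 2 * K, by positivity, ?_⟩
  intro n₁ n₂ P hconn hP hpar φ₀ lam t ε hlam ht hε hε3
  obtain ⟨G, hGm, hG, hGi⟩ := hJb (lam ^ 2) (by positivity)
  have h := P.enorm_amplitude_le φ₀ hGm hG ht hε hε3 fun ξ =>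
    hb n₁ n₂ P hconn hP hpar ε hε hε3 ξ _ (KineticGraphs.measurable_latticeFourier φ₀).enorm
  rw [KineticGraphs.lintegral_latticeFourier_sq] at h
  set n := n₁ + n₂
  set E := ε ^ ((1 : ℝ) / 5 - (n : ℝ))
  have hE : 0 < E := Real.rpow_pos_of_pos hε _
  rw [abs_mul, abs_of_pos (by positivity)]
  set L := |Real.log ε|
  have hL : 0 ≤ L := abs_nonneg _
  have h' := h.trans (mul_le_mul_right (mul_le_mul_right (mul_le_mul_left
    (pow_le_pow_left' hGi 2) _) _) _)
  rw [show (18 : ℝ≥0∞) = ENNReal.ofReal 18 by norm_num,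
    show (12 : ℝ≥0∞) = ENNReal.ofReal 12 by norm_num,
    ← ENNReal.ofReal_pow (by positivity), ← ENNReal.ofReal_pow (by positivity),
    ← ENNReal.ofReal_pow (by positivity), ← ENNReal.ofReal_pow (by positivity),
    ← ENNReal.ofReal_mul (by positivity), ← ENNReal.ofReal_mul (by positivity),
    ← ENNReal.ofReal_mul (by positivity), ← ENNReal.ofReal_mul (by positivity),
    ← ENNReal.ofReal_mul (by positivity), ← ofReal_norm] at h'
  refine ((ENNReal.ofReal_le_ofReal_iff (by positivity)).1 h').trans ?_
  have c1 : (18 : ℝ) ^ 4 ≤ (18 ^ 4) ^ (n + 5) := le_self_pow₀ (by norm_num) (by omega)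
  have c2 : (12 : ℝ) ^ (2 * n + 4) ≤ 144 ^ (n + 5) := by
    rw [show 2 * n + 4 = 2 * (n + 2) by ring, pow_mul, show (12 : ℝ) ^ 2 = 144 by norm_num]
    exact pow_le_pow_right₀ (by norm_num) (by omega)
  have c3 : M ^ 2 ≤ ((M + 1) ^ 2) ^ (n + 5) :=
    (pow_le_pow_left₀ hM.le (by linarith) 2).trans (le_self_pow₀ hM1 (by omega))
  calc Real.exp (4 * ε * t) * lam ^ (2 * n) * (18 ^ 4 * 12 ^ (2 * n + 4) *
        (M ^ 2 * ((‖φ₀‖ ^ 2) ^ 2 * (K ^ (n + 5) * L ^ (n + 5) * E))))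
      = Real.exp (4 * ε * t) * lam ^ (2 * n) * E * L ^ (n + 5) * K ^ (n + 5) * ‖φ₀‖ ^ 4 *
        (18 ^ 4 * 12 ^ (2 * n + 4) * M ^ 2) := by ring
    _ ≤ Real.exp (4 * ε * t) * lam ^ (2 * n) * E * L ^ (n + 5) * K ^ (n + 5) * ‖φ₀‖ ^ 4 *
        ((18 ^ 4) ^ (n + 5) * 144 ^ (n + 5) * ((M + 1) ^ 2) ^ (n + 5)) := by gcongr
    _ = _ := by
        rw [mul_pow, mul_pow, mul_pow, mul_pow]
        ring
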